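/- **Setting.** For $n,d\ge 1$ let $\Sigma_{n,d}=\{1,\dots,n\}\times\{1,\dots,d\}\times\{1,\dots,n\}$. A game graph with $n$ nodes and priorities up to $d$ consists of the node set $V=\{1,\dots,n\}$, each node being owned by Even or by Odd, a starting node $v_I$, and a set $E\subseteq\Sigma_{n,d}$ of edges $(u,p,v)$ (source, priority, target), such that every node has an outgoing edge; $m=|E|$. A play is an infinite path from $v_I$, where the owner of the current node chooses the next edge; Even (Odd) wins a play if the largest priority occurring infinitely often is even (odd). A positional strategy of a player consists of exactly one outgoing edge for each of her nodes; it is winning if she wins all plays consistent with it. $\mathrm{PosEven}_{n,d}$ ($\mathrm{PosOdd}_{n,d}$) is the set of plays arising from positional winning strategies of Even (Odd) in game graphs with $n$ nodes and priorities up to $d$; $\mathrm{LimsupOdd}_{n,d}\subseteq\Sigma_{n,d}^\omega$ is the set of words in which the largest priority occurring infinitely often is odd. A parity automaton over $\Sigma_{n,d}$ has a finite state set $Q$, an initial state and a total transition relation $\Delta\subseteq Q\times\Sigma_{n,d}\times\{1,\dots,d'\}\times Q$; a run is accepting if the largest emitted priority occurring infinitely often is even, and a word is accepted if some run reading it is accepting.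 It is a safety automaton if $d'=2$ and there is a set of rejecting states such that every transition emitting $1$ leads to a rejecting state, and every transition from a rejecting state emits $1$ and leads to a rejecting state. A transition strategy chooses a transition depending on the word read so far, the current state and the next letter. The automaton is a strong SFPG (suitable for parity games) separator if * it accepts all words of $\mathrm{PosEven}_{n,d}$, and rejects all words of $\mathrm{PosOdd}_{n,d}$ and of $\mathrm{LimsupOdd}_{n,d}$; and * for every game graph $G$ with $n$ nodes and priorities up to $d$ and every positional winning strategy $\tau$ of Even in $G$ there is a transition strategy such that for every play arising from $\tau$ the run following the transition strategy is accepting. The product $G\times\mathcal A$ is the game graph with nodes $(V\cup E)\times Q$, starting node $(v_I,s_I)$ with $s_I$ the initial state, and edges $((u,s),1,(e,s))$ for $e=(u,p,v)\in E$, $s\in Q$, and $((e,s),p',(v,s'))$ for $e=(u,p,v)\in E$, $(s,e,p',s')\in\Delta$; nodes $(v,s)$ are owned by the owner of $v$, nodes $(e,s)$ by Even. A game graph is a safety game if there is a set of nodes such that Even wins exactly the plays avoiding this set. **The automata.** Let $\mathit{rn}(n)=1+\lfloor\log_2 n\rfloor$ and let $d$ be even. The states of $\mathcal R_{n,d}$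 are the non-increasing sequences $s=\langle r_{\mathit{rn}(n)},\dots,r_1\rangle$ of registers with values in $\{1,\dots,d\}$; the initial state is $\langle 1,\dots,1\rangle$. The update of $s$ by $(u,p,v)$ replaces by $p$ all registers with value less than $p$. The $k$-reset of $s$, for $1\le k\le\mathit{rn}(n)$, is $\langle r_{\mathit{rn}(n)},\dots,r_{k+1},r_{k-1},\dots,r_1,1\rangle$; it is even or odd according to the parity of $r_k$. If $s'$ is the update of $s$ by $e$, the transitions are the non-reset transition $(s,e,1,s')$ and, for every $k$ and the $k$-reset $s''$ of $s'$, the transition $(s,e,2k,s'')$ if the reset is even, and $(s,e,2k+1,s'')$ if it is odd. The states of $\mathcal S_{n,d}$ are a rejecting state $\mathsf{rej}$ and the pairs $(s,c)$ of a state $s$ of $\mathcal R_{n,d}$ and counters $c=\langle c_{\mathit{rn}(n)},\dots,c_1,c_0\rangle$ with values in $\{1,\dots,n\}$; initially all registers are $1$ and all counters are $n$. Its transitions are: * $((s,c),e,2,(s',c'))$ with $c'=\langle c_{\mathit{rn}(n)},\dots,c_k,n,\dots,n\rangle$, for every transition $(s,e,2k,s')$ of $\mathcal R_{n,d}$; *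 for every transition $(s,e,2k+1,s')$ of $\mathcal R_{n,d}$ (with $k\geq 0$): $((s,c),e,2,(s',c'))$ with $c'=\langle c_{\mathit{rn}(n)},\dots,c_{k+1},c_k-1,n,\dots,n\rangle$ if $c_k>1$, and $((s,c),e,1,\mathsf{rej})$ if $c_k=1$; * $(\mathsf{rej},e,1,\mathsf{rej})$ for every letter $e$. **Theorem.** 1. For all $n\ge1$ and all even $d\ge 2$, $\mathcal S_{n,d}$ is a safety automaton and a strong SFPG separator. It has $\xi_{n,d}=\binom{\mathit{rn}(n)+d-1}{\mathit{rn}(n)}\cdot n^{\mathit{rn}(n)+1}+1$ states. For every game graph $G$ with $n$ nodes, $m$ edges and priorities up to $d$, the product $G\times\mathcal S_{n,d}$ is a safety game with $(n+m)\cdot\xi_{n,d}$ nodes and at most $m\cdot\xi_{n,d}\cdot(\mathit{rn}(n)+2)$ edges, and Even has a winning strategy in $G$ if and only if she has one in $G\times\mathcal S_{n,d}$. 2. If moreover $d\le n$, the number of nodes and edges of $G\times\mathcal S_{n,d}$ is $n^{O(\log n)}$, that is, at most $C\cdot n^{C\lfloor\log_2 n\rfloor}$ for an absolute constant $C$. 3.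 There is an algorithm (a program of a random access machine with addition and subtraction at unit cost) that, given a game graph with $n$ nodes and priorities up to $d$ ($n,d\ge1$ arbitrary) as a list of edges, decides whether Even has a winning strategy, in at most $C\cdot(nd)^{C(1+\lfloor\log_2 n\rfloor)}$ steps, and, if $d\le n$, in at most $C\cdot n^{C\lfloor\log_2 n\rfloor}=n^{O(\log n)}$ steps, for an absolute constant $C$. -/

import Mathlib

open Filter

namespace ParityGames

/-! ### Parity games -/

/-- The set `{1, 2, …, k}`; used for priorities, registers and counters. -/
abbrev Upto (k : ℕ) : Type := ↥(Set.Icc 1 k)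

inductive Player
  | even
  | odd

/-- An edge `(u, p, v)`: source, priority, target.  The alphabet `Σ_{n,d}` is `Edge (Fin n) d`. -/
abbrev Edge (V : Type*) (d : ℕ) : Type _ := V × Upto d × V

/-- A game graph with node set `V` and priorities up to `d`. -/
structure GameGraph (V : Type*) (d : ℕ) where
  owner : V → Player
  start : V
  edges : Set (Edge V d)
  exists_out : ∀ u, ∃ e ∈ edges, e.1 = u

/-- The largest number occurring infinitely often in the sequence exists and is even. -/
def LimsupEven (x : ℕ → ℕ) : Prop :=
  ∃ p, Even p ∧ (∃ᶠ i in atTop, x i = p) ∧ ∀ q, p < q → ¬ ∃ᶠ i in atTop, x i = q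

/-- The largest number occurring infinitely often in the sequence exists and is odd. -/
def LimsupOdd (x : ℕ → ℕ) : Prop :=
  ∃ p, Odd p ∧ (∃ᶠ i in atTop, x i = p) ∧ ∀ q, p < q → ¬ ∃ᶠ i in atTop, x i = q

/-- The sequence of priorities of an infinite word of edges. -/
def prios {V : Type*} {d : ℕ} (w : ℕ → Edge V d) : ℕ → ℕ := fun i => ((w i).2.1 : ℕ)

/-- The prefix of length `i` of an infinite word. -/
def pre {α : Type*} (w : ℕ → α) (i : ℕ) : List α := (List.range i).map w

/-- Which infinite words are won by a player. -/
def Wins {V : Type*} {d : ℕ} : Player → (ℕ → Edge V d) → Prop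
  | .even, w => LimsupEven (prios w)
  | .odd, w => LimsupOdd (prios w)

namespace GameGraph

variable {V : Type*} {d : ℕ}

/-- Infinite paths from the starting node. -/
def IsPlay (G : GameGraph V d) (w : ℕ → Edge V d) : Prop :=
  (w 0).1 = G.start ∧ (∀ i, w i ∈ G.edges) ∧ ∀ i, (w (i + 1)).1 = (w i).2.2

/-- A positional strategy of player `P`: exactly one outgoing edge for each node of `P`. -/
def IsPositionalStrategy (G : GameGraph V d) (P : Player) (τ : Set (Edge V d)) : Prop :=
  τ ⊆ G.edges ∧ (∀ e ∈ τ, G.owner e.1 = P) ∧ ∀ u, G.owner u = P → ∃! e, e ∈ τ ∧ e.1 = u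

/-- The plays that arise from the positional strategy `τ` of player `P`. -/
def PlaysOf (G : GameGraph V d) (P : Player) (τ : Set (Edge V d)) : Set (ℕ → Edge V d) :=
  {w | G.IsPlay w ∧ ∀ i, G.owner (w i).1 = P → w i ∈ τ}

def IsPositionalWinning (G : GameGraph V d) (P : Player) (τ : Set (Edge V d)) : Prop :=
  G.IsPositionalStrategy P τ ∧ ∀ w ∈ G.PlaysOf P τ, Wins P w

/-- Player `P` has a (history-dependent) winning strategy `σ`, which maps the edges traversed so
far and the current node to the next edge. -/
def HasWinningStrategy (G : GameGraph V d) (P : Player) : Prop :=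
  ∃ σ : List (Edge V d) → V → Edge V d,
    (∀ h u, G.owner u = P → σ h u ∈ G.edges ∧ (σ h u).1 = u) ∧
    ∀ w, G.IsPlay w → (∀ i, G.owner (w i).1 = P → w i = σ (pre w i) (w i).1) → Wins P w

/-- A safety game: Even wins exactly those plays that avoid a certain set of nodes. -/
def IsSafetyGame (G : GameGraph V d) : Prop :=
  ∃ bad : Set V, ∀ w, G.IsPlay w → (Wins .even w ↔ ∀ i, (w i).1 ∉ bad)

end GameGraph

/-- Plays arising from positional winning strategies of Even in game graphs with `n` nodes and
priorities up to `d`. -/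
def PosEven (n d : ℕ) : Set (ℕ → Edge (Fin n) d) :=
  {w | ∃ (G : GameGraph (Fin n) d) (τ : Set (Edge (Fin n) d)),
    G.IsPositionalWinning .even τ ∧ w ∈ G.PlaysOf .even τ}

/-- Plays arising from positional winning strategies of Odd in game graphs with `n` nodes and
priorities up to `d`. -/
def PosOdd (n d : ℕ) : Set (ℕ → Edge (Fin n) d) :=
  {w | ∃ (G : GameGraph (Fin n) d) (τ : Set (Edge (Fin n) d)),
    G.IsPositionalWinning .odd τ ∧ w ∈ G.PlaysOf .odd τ}

/-! ### Automata -/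

/-- A nondeterministic parity automaton with input alphabet `α`, states `Q` and emitted priorities
in `{1, …, d'}`. -/
structure ParityAutomaton (α : Type*) (d' : ℕ) (Q : Type*) where
  finite : Finite Q
  init : Q
  trans : Set (Q × α × Upto d' × Q)
  total : ∀ s e, ∃ p s', (s, e, p, s') ∈ trans

namespace ParityAutomaton

variable {α Q : Type*} {d' : ℕ}

/-- `s` and `p` are the states and the emitted priorities of a run reading `w`. -/
def IsRun (A : ParityAutomaton α d' Q) (w : ℕ → α) (s : ℕ → Q) (p : ℕ → Upto d') : Prop :=
  s 0 = A.init ∧ ∀ i, (s i, w i, p i, s (i + 1)) ∈ A.trans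

def Accepts (A : ParityAutomaton α d' Q) (w : ℕ → α) : Prop :=
  ∃ s p, A.IsRun w s p ∧ LimsupEven (fun i => (p i : ℕ))

/-- Safety automata (they emit only the priorities 1 and 2). -/
def IsSafety (A : ParityAutomaton α 2 Q) : Prop :=
  ∃ rejecting : Set Q,
    (∀ s e p s', (s, e, p, s') ∈ A.trans → (p : ℕ) = 1 → s' ∈ rejecting) ∧
    (∀ s e p s', s ∈ rejecting → (s, e, p, s') ∈ A.trans → (p : ℕ) = 1 ∧ s' ∈ rejecting)

/-- A transition strategy; `σ h s e` consists of the emitted priority and the next state of the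
chosen transition, where `h` is the word read so far. -/
def IsTransitionStrategy (A : ParityAutomaton α d' Q)
    (σ : List α → Q → α → Upto d' × Q) : Prop :=
  ∀ h s e, (s, e, (σ h s e).1, (σ h s e).2) ∈ A.trans

/-- On every word of `L`, the run that follows `σ` is accepting. -/
def IsWinningFor (A : ParityAutomaton α d' Q) (σ : List α → Q → α → Upto d' × Q)
    (L : Set (ℕ → α)) : Prop :=
  ∀ w ∈ L, ∀ s p, A.IsRun w s p → (∀ i, (p i, s (i + 1)) = σ (pre w i) (s i) (w i)) →
    LimsupEven (fun i => (p i : ℕ))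

end ParityAutomaton

section Separators

variable {n d d' : ℕ} {Q : Type*}

def IsPGSeparator (A : ParityAutomaton (Edge (Fin n) d) d' Q) : Prop :=
  (∀ w ∈ PosEven n d, A.Accepts w) ∧ ∀ w ∈ PosOdd n d, ¬ A.Accepts w

def IsStrongPGSeparator (A : ParityAutomaton (Edge (Fin n) d) d' Q) : Prop :=
  IsPGSeparator A ∧ ∀ w, LimsupOdd (prios w) → ¬ A.Accepts w

/-- PG separators that are suitable for parity games. -/
def IsSFPGSeparator (A : ParityAutomaton (Edge (Fin n) d) d' Q) : Prop :=
  IsPGSeparator A ∧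
    ∀ (G : GameGraph (Fin n) d) (τ : Set (Edge (Fin n) d)), G.IsPositionalWinning .even τ →
      ∃ σ, A.IsTransitionStrategy σ ∧ A.IsWinningFor σ (G.PlaysOf .even τ)

def IsStrongSFPGSeparator (A : ParityAutomaton (Edge (Fin n) d) d' Q) : Prop :=
  IsStrongPGSeparator A ∧ IsSFPGSeparator A

end Separators

/-- The synchronized product of a game graph and a parity automaton. -/
def GameGraph.product {V Q : Type*} {d d' : ℕ} (G : GameGraph V d)
    (A : ParityAutomaton (Edge V d) d' Q) : GameGraph ((V ⊕ ↥G.edges) × Q) d' where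
  owner
    | (.inl v, _) => G.owner v
    | (.inr _, _) => .even
  start := (.inl G.start, A.init)
  edges :=
    {x | ∃ (e : ↥G.edges) (s : Q) (p : Upto d'), (p : ℕ) = 1 ∧
      x = ((.inl e.1.1, s), p, (.inr e, s))} ∪
    {x | ∃ (e : ↥G.edges) (s : Q) (p : Upto d') (s' : Q), (s, e.1, p, s') ∈ A.trans ∧
      x = ((.inr e, s), p, (.inl e.1.2.2, s'))}
  exists_out := by
    rintro ⟨v | e, s⟩
    · obtain ⟨e, he, rfl⟩ := G.exists_out v
      obtain ⟨p, -⟩ := A.total s e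
      exact ⟨_, Or.inl ⟨⟨e, he⟩, s, ⟨1, le_rfl, p.2.1.trans p.2.2⟩, rfl, rfl⟩, rfl⟩
    · obtain ⟨p, s', h⟩ := A.total s e.1
      exact ⟨_, Or.inr ⟨e, s, p, s', h, rfl⟩, rfl⟩

/-! ### The register automaton `R_{n,d}` -/

/-- The number of registers. -/
def rn (n : ℕ) : ℕ := 1 + Nat.log 2 n

/-- States of `R_{n,d}`: the value at `i` is the content of the register number `i + 1`, and
`⟨r_{rn(n)}, …, r_2, r_1⟩` is non-increasing. -/
abbrev RState (n d : ℕ) : Type := {r : Fin (rn n) → Upto d // Monotone r}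

/-- The update of `s` by a priority `p`: the registers smaller than `p` (these are the lowest ones)
get the value `p`. -/
def RState.update {n d : ℕ} (s : RState n d) (p : Upto d) : RState n d :=
  ⟨fun i => max (s.1 i) p, fun _ _ h => max_le_max_right p (s.2 h)⟩

/-- The reset of the register number `k + 1`: its content is removed, the contents of the lower
registers are moved one register up, and the register number `1` gets the value `1`. -/
def RState.reset {n d : ℕ} (hd : 0 < d) (s : RState n d) (k : Fin (rn n)) : RState n d :=
  ⟨fun i =>
      if k < i then s.1 i
      else if i.1 = 0 then ⟨1, le_rfl, hd⟩
      else s.1 ⟨i.1 - 1, lt_of_le_of_lt (Nat.sub_le _ _) i.2⟩, by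
    intro i j hij
    have hij' : i.1 ≤ j.1 := hij
    dsimp only
    split_ifs with h1 h2 h3 h4 h5 h6
    · exact s.2 hij
    · exact absurd (lt_of_lt_of_le h1 hij) h2
    · exact absurd (lt_of_lt_of_le h1 hij) h2
    · exact (s.1 j).2.1
    · exact le_rfl
    · exact (s.1 _).2.1
    · exact s.2 (show i.1 - 1 ≤ j.1 by omega)
    · omega
    · exact s.2 (show i.1 - 1 ≤ j.1 - 1 by omega)⟩

/-- The register automaton `R_{n,d}`. -/
def registerAutomaton (n d : ℕ) (hd : 0 < d) :
    ParityAutomaton (Edge (Fin n) d) (2 * rn n + 1) (RState n d) where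
  finite := inferInstance
  init := ⟨fun _ => ⟨1, le_rfl, hd⟩, fun _ _ _ => le_rfl⟩
  trans := {x | ∃ (s : RState n d) (e : Edge (Fin n) d) (q : Upto (2 * rn n + 1)) (s' : RState n d),
    x = (s, e, q, s') ∧
      -- a non-reset transition
      (((q : ℕ) = 1 ∧ s' = s.update e.2.1) ∨
      -- an even reset of the register `k + 1`
      (∃ k : Fin (rn n), Even (((s.update e.2.1).1 k : Upto d) : ℕ) ∧
        (q : ℕ) = 2 * (k.1 + 1) ∧ s' = (s.update e.2.1).reset hd k) ∨
      -- an odd reset of the register `k + 1`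
      (∃ k : Fin (rn n), Odd (((s.update e.2.1).1 k : Upto d) : ℕ) ∧
        (q : ℕ) = 2 * (k.1 + 1) + 1 ∧ s' = (s.update e.2.1).reset hd k))}
  total s e := ⟨⟨1, le_rfl, by omega⟩, _, _, _, _, _, rfl, Or.inl ⟨rfl, rfl⟩⟩

/-! ### The safety automaton `S_{n,d}` -/

/-- Counters `c_0, c_1, …, c_{rn(n)}`. -/
abbrev Counters (n : ℕ) : Type := Fin (rn n + 1) → Upto n

/-- States of `S_{n,d}`; the rejecting state `rej` is `none`. -/
abbrev SState (n d : ℕ) : Type := Option (RState n d × Counters n)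

/-- All counters below the counter `k` are set to `n`, the other ones are left unchanged. -/
def Counters.refill {n : ℕ} (hn : 0 < n) (c : Counters n) (k : Fin (rn n + 1)) : Counters n :=
  fun j => if j < k then ⟨n, hn, le_rfl⟩ else c j

/-- The counter `k` is decreased by one (this is used only if it is greater than `1`). -/
def Counters.decr {n : ℕ} (c : Counters n) (k : Fin (rn n + 1)) (hk : 1 < (c k : ℕ)) :
    Counters n :=
  Function.update c k ⟨(c k : ℕ) - 1, Nat.le_sub_one_of_lt hk, (Nat.sub_le _ _).trans (c k).2.2⟩

/-- The transitions of `S_{n,d}`. -/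
inductive STrans (n d : ℕ) (hn : 0 < n) (hd : 0 < d) :
    SState n d → Edge (Fin n) d → ℕ → SState n d → Prop
  | even (s : RState n d) (c : Counters n) (e : Edge (Fin n) d) (q : Upto (2 * rn n + 1))
      (s' : RState n d) (k : Fin (rn n + 1)) :
      (s, e, q, s') ∈ (registerAutomaton n d hd).trans → (q : ℕ) = 2 * k.1 →
      STrans n d hn hd (some (s, c)) e 2 (some (s', c.refill hn k))
  | odd (s : RState n d) (c : Counters n) (e : Edge (Fin n) d) (q : Upto (2 * rn n + 1))
      (s' : RState n d) (k : Fin (rn n + 1)) (hk : 1 < (c k : ℕ)) :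
      (s, e, q, s') ∈ (registerAutomaton n d hd).trans → (q : ℕ) = 2 * k.1 + 1 →
      STrans n d hn hd (some (s, c)) e 2 (some (s', (c.decr k hk).refill hn k))
  | reject (s : RState n d) (c : Counters n) (e : Edge (Fin n) d) (q : Upto (2 * rn n + 1))
      (s' : RState n d) (k : Fin (rn n + 1)) :
      (s, e, q, s') ∈ (registerAutomaton n d hd).trans → (q : ℕ) = 2 * k.1 + 1 → (c k : ℕ) = 1 →
      STrans n d hn hd (some (s, c)) e 1 none
  | sink (e : Edge (Fin n) d) : STrans n d hn hd none e 1 none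

/-- The safety automaton `S_{n,d}`. -/
def safetyAutomaton (n d : ℕ) (hn : 0 < n) (hd : 0 < d) :
    ParityAutomaton (Edge (Fin n) d) 2 (SState n d) where
  finite := inferInstance
  init := some ((registerAutomaton n d hd).init, fun _ => ⟨n, hn, le_rfl⟩)
  trans := {x | STrans n d hn hd x.1 x.2.1 x.2.2.1 x.2.2.2}
  total s e := by
    rcases s with _ | ⟨s, c⟩
    · exact ⟨⟨1, by simp⟩, none, STrans.sink e⟩
    · have ht : (s, e, (⟨1, le_rfl, by omega⟩ : Upto (2 * rn n + 1)), s.update e.2.1) ∈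
          (registerAutomaton n d hd).trans := ⟨_, _, _, _, rfl, Or.inl ⟨rfl, rfl⟩⟩
      by_cases hk : 1 < (c 0 : ℕ)
      · exact ⟨⟨2, by simp⟩, _, STrans.odd s c e _ _ 0 hk ht rfl⟩
      · have h1 : (c 0 : ℕ) = 1 := le_antisymm (not_lt.1 hk) (c 0).2.1
        exact ⟨⟨1, by simp⟩, _, STrans.reject s c e _ _ 0 ht rfl h1⟩

/-- The number of states of `S_{n,d}` is claimed to be this number. -/
def numStates (n d : ℕ) : ℕ := (rn n + d - 1).choose (rn n) * n ^ (rn n + 1) + 1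

/-! ### Random access machines with unit cost

Programs are built from elementary instructions by composition, branching and loops.  The
arithmetic operations are addition and truncated subtraction; there is no multiplication, so unit
cost is polynomially related to the running time of Turing machines. -/

namespace RAM

/-- Registers (a program mentions only finitely many of them) and an indirectly addressed memory. -/
structure State where
  reg : ℕ → ℕ
  mem : ℕ → ℕ

inductive Program
  /-- `reg x := a` -/
  | const (x a : ℕ)
  /-- `reg x := reg y + reg z` -/
  | add (x y z : ℕ)
  /-- `reg x := reg y - reg z` (`0` if this is negative) -/
  | sub (x y z : ℕ)
  /-- `reg x := mem (reg y)` -/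
  | load (x y : ℕ)
  /-- `mem (reg x) := reg y` -/
  | store (x y : ℕ)
  | seq (P Q : Program)
  /-- if `reg x ≠ 0` then `P` else `Q` -/
  | branch (x : ℕ) (P Q : Program)
  /-- while `reg x ≠ 0` do `P` -/
  | loop (x : ℕ) (P : Program)

/-- Assignment to a register. -/
def State.setReg (s : State) (x a : ℕ) : State := { s with reg := Function.update s.reg x a }

/-- Assignment to a memory cell. -/
def State.setMem (s : State) (i a : ℕ) : State := { s with mem := Function.update s.mem i a }

/-- `Exec P s t s'`: started in `s`, the program `P` halts in `s'` after exactly `t` steps.  Each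
elementary instruction and each test takes one step. -/
inductive Exec : Program → State → ℕ → State → Prop
  | const (s : State) (x a : ℕ) : Exec (.const x a) s 1 (s.setReg x a)
  | add (s : State) (x y z : ℕ) : Exec (.add x y z) s 1 (s.setReg x (s.reg y + s.reg z))
  | sub (s : State) (x y z : ℕ) : Exec (.sub x y z) s 1 (s.setReg x (s.reg y - s.reg z))
  | load (s : State) (x y : ℕ) : Exec (.load x y) s 1 (s.setReg x (s.mem (s.reg y)))
  | store (s : State) (x y : ℕ) : Exec (.store x y) s 1 (s.setMem (s.reg x) (s.reg y))
  | seq {P Q : Program} {s s₁ s₂ : State} {t₁ t₂ : ℕ} :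
      Exec P s t₁ s₁ → Exec Q s₁ t₂ s₂ → Exec (.seq P Q) s (t₁ + t₂) s₂
  | branch_true {x : ℕ} {P Q : Program} {s s₁ : State} {t : ℕ} :
      s.reg x ≠ 0 → Exec P s t s₁ → Exec (.branch x P Q) s (t + 1) s₁
  | branch_false {x : ℕ} {P Q : Program} {s s₁ : State} {t : ℕ} :
      s.reg x = 0 → Exec Q s t s₁ → Exec (.branch x P Q) s (t + 1) s₁
  | loop_true {x : ℕ} {P : Program} {s s₁ s₂ : State} {t₁ t₂ : ℕ} :
      s.reg x ≠ 0 → Exec P s t₁ s₁ → Exec (.loop x P) s₁ t₂ s₂ →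
      Exec (.loop x P) s (t₁ + t₂ + 1) s₂
  | loop_false {x : ℕ} {P : Program} {s : State} :
      s.reg x = 0 → Exec (.loop x P) s 1 s

/-- The initial state: the input is in the memory cells `0, 1, 2, …`, everything else is `0`. -/
def input (l : List ℕ) : State where
  reg := fun _ => 0
  mem := fun i => l.getD i 0

end RAM

/-- Code of the owner of a node. -/
def Player.code : Player → ℕ
  | .even => 0
  | .odd => 1

/-- A game graph as a list of numbers: the number of nodes, the bound on priorities, the starting
node, the number of edges, the owners of the nodes, and the edges (each as three numbers), in the
order given by the list `l`. -/
def GameGraph.encode {n d : ℕ} (G : GameGraph (Fin n) d) (l : List (Edge (Fin n) d)) : List ℕ :=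
  [n, d, G.start.1, l.length] ++ List.ofFn (fun u => (G.owner u).code) ++
    l.flatMap (fun e => [e.1.1, (e.2.1 : ℕ), e.2.2.1])

/-- Started on `G`, given with any enumeration of its edges, the program `P` halts after at most
`T` steps, and the register `0` then contains `1` if Even has a winning strategy in `G`, and `0`
otherwise. -/
def SolvesWithin (P : RAM.Program) {n d : ℕ} (G : GameGraph (Fin n) d) (T : ℕ) : Prop :=
  ∀ l : List (Edge (Fin n) d), l.Nodup → (∀ e, e ∈ l ↔ e ∈ G.edges) →
    ∃ t s', RAM.Exec P (RAM.input (G.encode l)) t s' ∧ t ≤ T ∧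
      (G.HasWinningStrategy .even → s'.reg 0 = 1) ∧
      (¬ G.HasWinningStrategy .even → s'.reg 0 = 0)

end ParityGames

/-!
Why the safety automaton accepts the plays of a winning strategy: a winning strategy of Even turns
the nodes into the leaves of an ordered tree of height `d`, such that every edge that agrees with
the strategy descends in the tree in the sense of progress measures (`GameGraph.exists_ranking`; the
keys of the tree are ranks of the well-founded relations "an odd priority is read before a larger
one"). The strategy does not have to be positional.

For the automaton `S_{n,d}`, call the counters sufficient at a node with given registers if every
counter is larger than the number of leaves to the left of (or in) a certain subtree that contains
the node (`Ranking.Fits`). The counter number `j` deals with the subtrees that have at least `2 ^ j`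
leaves; this is why `1 + ⌊log₂ n⌋` registers are enough. An edge with an even priority `q` may stay
in the same subtree of level `q`: the automaton resets the register whose number is determined by
the size of this subtree, and if one of the registers concerned contains an odd value, this is
garbage that is paid for once by a counter. All other edges move to the left in the tree, and the
counters have more room. In this way `exists_safe_step` always finds a transition that does not
reject. Conversely, in an accepting run of `S_{n,d}` the largest priority emitted infinitely often
by the underlying run of `R_{n,d}` is even, say `2 k`; were the largest priority read infinitely
often odd, then the register number `k` would contain it from some point on and could not have an
even reset (`not_limsupOdd_of_register_run`). The product game is a safety game, so Even can win it
by staying inside a set of nodes; such a set is obtained from the tree in one direction and gives a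
strategy that simulates the automaton in the other direction.

The algorithm does not build the product, but lifts progress measures whose values are vectors of `L
= 1 + ⌊log₂ n⌋` digits up to `2 d`. Every ranking embeds into the tree formed by these vectors: at
every level one splits at a median child, and the two remaining parts have at most half as many
leaves, so a vector has at most `L` digits that record such a split (`Ranking.exists_embedding`).
Starting with the least vectors, one increments the vector of any node that violates the condition
of a progress measure, and never exceeds a progress measure (`Below.lift`). When nothing is left to
increment, Even wins if and only if the vector of the starting node is not `⊤` (`winning_of_good`,
`not_winning_of_top`). There are at most `2 n (2 d + 1) ^ L` increments, which is `(n d) ^ O(log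
n)`. The correctness and the running time of the program are proved by loop invariants for each of
its parts; the predicate `RAM.Runs` combines partial correctness, termination and a bound on the
number of steps.
-/

namespace ParityGames

/-! ### Largest values occurring infinitely often -/

lemma exists_limsup {x : ℕ → ℕ} {N : ℕ} (hx : ∀ i, x i ≤ N) :
    ∃ p, (∃ᶠ i in atTop, x i = p) ∧ ∀ᶠ i in atTop, x i ≤ p := by
  classical
  have hex : ∃ p ≤ N, ∃ᶠ i in atTop, x i = p := by
    by_contra! hcon
    have h1 : ∀ᶠ i in atTop, ∀ p ∈ Set.Iic N, ¬ x i = p :=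
      (Filter.eventually_all_finite (Set.finite_Iic N)).2 fun p hp =>
        hcon p hp
    obtain ⟨i, hi⟩ := h1.exists
    exact hi (x i) (hx i) rfl
  obtain ⟨p₀, hp₀, hf₀⟩ := hex
  have hspec := Nat.findGreatest_spec (P := fun p => ∃ᶠ i in atTop, x i = p) hp₀ hf₀
  refine ⟨_, hspec, ?_⟩
  have h1 : ∀ᶠ i in atTop, ∀ q ∈ Set.Icc
      (Nat.findGreatest (fun p => ∃ᶠ i in atTop, x i = p) N + 1) N, ¬ x i = q :=
    (Filter.eventually_all_finite (Set.finite_Icc _ _)).2 fun q hq =>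
      Filter.not_frequently.1 (Nat.findGreatest_is_greatest (Nat.lt_of_succ_le hq.1) hq.2)
  filter_upwards [h1] with i hi
  by_contra hlt
  exact hi (x i) ⟨by omega, hx i⟩ rfl

lemma limsupEven_of {x : ℕ → ℕ} {p : ℕ} (hp : Even p) (hf : ∃ᶠ i in atTop, x i = p)
    (he : ∀ᶠ i in atTop, x i ≤ p) : LimsupEven x :=
  ⟨p, hp, hf, fun q hq h => by
    obtain ⟨i, hi, hi'⟩ := (h.and_eventually he).exists
    omega⟩

lemma limsupOdd_of {x : ℕ → ℕ} {p : ℕ} (hp : Odd p) (hf : ∃ᶠ i in atTop, x i = p)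
    (he : ∀ᶠ i in atTop, x i ≤ p) : LimsupOdd x :=
  ⟨p, hp, hf, fun q hq h => by
    obtain ⟨i, hi, hi'⟩ := (h.and_eventually he).exists
    omega⟩

lemma LimsupEven.not_limsupOdd {x : ℕ → ℕ} (h : LimsupEven x) : ¬ LimsupOdd x := by
  rintro ⟨q, hq, hqf, hqm⟩
  obtain ⟨p, hp, hpf, hpm⟩ := h
  rcases lt_trichotomy p q with hlt | rfl | hlt
  · exact hpm q hlt hqf
  · exact (Nat.not_even_iff_odd.2 hq) hp
  · exact hqm p hlt hpf

lemma limsupEven_of_not_odd {x : ℕ → ℕ} {N : ℕ} (hx : ∀ i, x i ≤ N) (h : ¬ LimsupOdd x) :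
    LimsupEven x := by
  obtain ⟨p, hf, he⟩ := exists_limsup hx
  rcases Nat.even_or_odd p with hp | hp
  · exact limsupEven_of hp hf he
  · exact absurd (limsupOdd_of hp hf he) h

lemma LimsupOdd.exists_le {x : ℕ → ℕ} {N : ℕ} (hx : ∀ i, x i ≤ N) (h : LimsupOdd x) :
    ∃ p, Odd p ∧ (∃ᶠ i in atTop, x i = p) ∧ ∀ᶠ i in atTop, x i ≤ p := by
  obtain ⟨p, hf, he⟩ := exists_limsup hx
  rcases Nat.even_or_odd p with hp | hp
  · exact absurd h (limsupEven_of hp hf he).not_limsupOdd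
  · exact ⟨p, hp, hf, he⟩

lemma prios_le {V : Type*} {d : ℕ} (w : ℕ → Edge V d) (i : ℕ) : prios w i ≤ d := (w i).2.1.2.2

/-! ### Histories consistent with a strategy -/

lemma pre_succ {α : Type*} (w : ℕ → α) (i : ℕ) : pre w (i + 1) = pre w i ++ [w i] := by
  simp [pre, List.range_succ]

lemma length_pre {α : Type*} (w : ℕ → α) (i : ℕ) : (pre w i).length = i := by simp [pre]

namespace GameGraph

variable {V : Type*} {d : ℕ}

/-- The node reached after traversing the edges of a history. -/
def lastNode (G : GameGraph V d) (h : List (Edge V d)) : V :=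
  (h.getLast?.map fun e => e.2.2).getD G.start

@[simp] lemma lastNode_append (G : GameGraph V d) (h : List (Edge V d)) (e : Edge V d) :
    G.lastNode (h ++ [e]) = e.2.2 := by simp [lastNode]

/-- The finite paths from the starting node on which Even follows the strategy `σ`. -/
inductive Consistent (G : GameGraph V d) (σ : List (Edge V d) → V → Edge V d) :
    List (Edge V d) → Prop
  | nil : Consistent G σ []
  | snoc (h : List (Edge V d)) (e : Edge V d) : Consistent G σ h → e ∈ G.edges →
      e.1 = G.lastNode h → (G.owner e.1 = .even → e = σ h e.1) → Consistent G σ (h ++ [e])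

variable {G : GameGraph V d} {σ : List (Edge V d) → V → Edge V d}

lemma consistent_snoc_iff {h : List (Edge V d)} {e : Edge V d} :
    G.Consistent σ (h ++ [e]) ↔ G.Consistent σ h ∧ e ∈ G.edges ∧ e.1 = G.lastNode h ∧
      (G.owner e.1 = .even → e = σ h e.1) := by
  refine ⟨fun hc => ?_, fun ⟨h1, h2, h3, h4⟩ => .snoc h e h1 h2 h3 h4⟩
  generalize hl : h ++ [e] = l at hc
  cases hc with
  | nil => simp at hl
  | snoc h' e' h1 h2 h3 h4 =>
    obtain ⟨rfl, he⟩ := List.append_inj' hl rfl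
    obtain rfl : e = e' := by simpa using he
    exact ⟨h1, h2, h3, h4⟩

lemma Consistent.of_append {h t : List (Edge V d)} (hc : G.Consistent σ (h ++ t)) :
    G.Consistent σ h := by
  induction t using List.reverseRecOn with
  | nil => simpa using hc
  | append_singleton t e ih =>
    rw [← List.append_assoc] at hc
    exact ih (consistent_snoc_iff.1 hc).1

lemma play_of_consistent {w : ℕ → Edge V d} (hw : ∀ k, G.Consistent σ (pre w k)) :
    G.IsPlay w ∧ ∀ i, G.owner (w i).1 = .even → w i = σ (pre w i) (w i).1 := by
  have h1 : ∀ k, w k ∈ G.edges ∧ (w k).1 = G.lastNode (pre w k) ∧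
      (G.owner (w k).1 = .even → w k = σ (pre w k) (w k).1) := fun k => by
    have := hw (k + 1)
    rw [pre_succ, consistent_snoc_iff] at this
    exact this.2
  refine ⟨⟨(h1 0).2.1, fun i => (h1 i).1, fun i => ?_⟩, fun i => (h1 i).2.2⟩
  rw [(h1 (i + 1)).2.1, pre_succ, lastNode_append]

/-- An infinite strictly increasing chain of consistent histories has a play as its limit. -/
lemma exists_limit_play {H : ℕ → List (Edge V d)} (hc : ∀ i, G.Consistent σ (H i))
    (hH : ∀ i, ∃ t, t ≠ [] ∧ H (i + 1) = H i ++ t) :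
    ∃ w, (∀ k, G.Consistent σ (pre w k)) ∧ ∀ i, pre w (H i).length = H i := by
  have hlen : ∀ i, i ≤ (H i).length := by
    intro i
    induction i with
    | zero => exact Nat.zero_le _
    | succ i ih =>
      obtain ⟨t, ht, he⟩ := hH i
      have := List.length_pos_iff.2 ht
      rw [he, List.length_append]; omega
  have hmono : ∀ i j, i ≤ j → H i <+: H j := by
    intro i j hij
    induction j, hij using Nat.le_induction with
    | base => exact List.prefix_refl _
    | succ j hj ih =>
      obtain ⟨t, -, he⟩ := hH j
      exact ih.trans (he ▸ List.prefix_append _ _)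
  have hpre : ∀ i, pre (fun k => (H (k + 1))[k]'(hlen (k + 1))) (H i).length = H i := by
    intro i
    apply List.ext_getElem (length_pre _ _)
    intro k hk hk'
    simp only [pre, List.getElem_map, List.getElem_range]
    rcases le_total i (k + 1) with hle | hle
    · exact ((hmono _ _ hle).getElem hk').symm
    · exact (hmono _ _ hle).getElem (hlen (k + 1))
  refine ⟨_, fun k => ?_, hpre⟩
  obtain ⟨l, hl⟩ := Nat.exists_eq_add_of_le (hlen k)
  have := hc k
  rw [← hpre k, hl, pre, List.range_add, List.map_append] at this
  exact this.of_append

/-- Every consistent history can be prolonged to a play. -/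
lemma Consistent.exists_play {h : List (Edge V d)} (hc : G.Consistent σ h)
    (hσ : ∀ h u, G.owner u = .even → σ h u ∈ G.edges ∧ (σ h u).1 = u) :
    ∃ w, (∀ k, G.Consistent σ (pre w k)) ∧ pre w h.length = h := by
  have hnext : ∀ h : List (Edge V d), G.Consistent σ h → ∃ e, G.Consistent σ (h ++ [e]) := by
    intro h hc
    by_cases ho : G.owner (G.lastNode h) = .even
    · obtain ⟨h1, h2⟩ := hσ h _ ho
      exact ⟨_, .snoc h _ hc h1 h2 fun _ => by rw [h2]⟩
    · obtain ⟨e, he, hu⟩ := G.exists_out (G.lastNode h)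
      exact ⟨e, .snoc h e hc he hu fun h' => absurd (hu ▸ h') ho⟩
  have : Nonempty (Edge V d) := ⟨(hnext h hc).choose⟩
  choose! nx hnx using hnext
  let H : ℕ → List (Edge V d) := fun i => (fun l => l ++ [nx l])^[i] h
  have hs : ∀ i, H (i + 1) = H i ++ [nx (H i)] := fun i =>
    Function.iterate_succ_apply' _ _ _
  have hH : ∀ i, G.Consistent σ (H i) := by
    intro i
    induction i with
    | zero => exact hc
    | succ i ih => rw [hs]; exact hnx _ ih
  obtain ⟨w, hw, hp⟩ := exists_limit_play hH fun i => ⟨_, by simp, hs i⟩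
  exact ⟨w, hw, hp 0⟩

end GameGraph
/-! ### Rankings of the nodes -/

/-- A family of linear preorders on the nodes, one for every level `h`, given by keys.  The preorder
of a lower level refines those of the higher levels; at level `0` it is a linear order, and from
level `d` on all nodes are equivalent.  The equivalence classes are the subtrees of an ordered tree
of height `d` whose leaves are the nodes. -/
structure Ranking (n d : ℕ) where
  key : ℕ → Fin n → Ordinal.{0}
  nest : ∀ h x y, key (h + 1) x < key (h + 1) y → key h x < key h y
  inj : Function.Injective (key 0)
  top : ∀ h, d ≤ h → ∀ x y, key h x = key h y

namespace Ranking

variable {n d : ℕ} (K : Ranking n d)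

/-- The condition of a progress measure for an edge `(u, q, v)`: above the priority `q` the key
does not increase, and if `q` is odd, then it decreases. -/
def Descends (u : Fin n) (q : ℕ) (v : Fin n) : Prop :=
  (Odd q → K.key (q - 1) v < K.key (q - 1) u) ∧ (Even q → K.key q v ≤ K.key q u)

end Ranking

namespace GameGraph

/-- The rank of a history measures how often the odd priority `p` can be read before a larger
one. -/
lemma exists_rank {V : Type} {d : ℕ} {G : GameGraph V d} {σ : List (Edge V d) → V → Edge V d}
    (hwin : ∀ w, (∀ k, G.Consistent σ (pre w k)) → LimsupEven (prios w)) {p : ℕ} (hp : Odd p) :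
    ∃ ρ : List (Edge V d) → Ordinal.{0}, ∀ h e, G.Consistent σ (h ++ [e]) →
      ((e.2.1 : ℕ) < p → ρ (h ++ [e]) ≤ ρ h) ∧ ((e.2.1 : ℕ) = p → ρ (h ++ [e]) < ρ h) := by
  let r : List (Edge V d) → List (Edge V d) → Prop := fun h' h =>
    G.Consistent σ h' ∧ ∃ t, h' = h ++ t ∧ (∀ e ∈ t, (e.2.1 : ℕ) ≤ p) ∧ ∃ e ∈ t, (e.2.1 : ℕ) = p
  have hwf : WellFounded r := by
    rw [wellFounded_iff_isEmpty_descending_chain]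
    refine ⟨fun ⟨f, hf⟩ => ?_⟩
    have hc : ∀ i, G.Consistent σ (f i) := fun i => by
      obtain ⟨h1, t, h2, -⟩ := hf i
      exact (h2 ▸ h1).of_append
    choose h1 t ht hle e het hep using hf
    obtain ⟨w, hw, hpre⟩ := exists_limit_play hc fun i =>
      ⟨t i, List.ne_nil_of_mem (het i), ht i⟩
    have hget : ∀ i (l : List (Edge V d)), f i = f 0 ++ l →
        ∀ m (hm : m < l.length), w ((f 0).length + m) = l[m] := by
      intro i l hl m hm
      have h2 : pre w (f i).length = f 0 ++ l := (hpre i).trans hl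
      have hm' : (f 0).length + m < (pre w (f i).length).length := by
        rw [length_pre, hl, List.length_append]; omega
      have h3 : (pre w (f i).length)[(f 0).length + m] = w ((f 0).length + m) := by
        simp [pre]
      rw [← h3, List.getElem_of_eq h2]
      simp
    have hacc : ∀ i, ∃ l, f i = f 0 ++ l ∧ (∀ e ∈ l, (e.2.1 : ℕ) ≤ p) ∧ i ≤ l.length := by
      intro i
      induction i with
      | zero => exact ⟨[], by simp, by simp, by simp⟩
      | succ i ih =>
        obtain ⟨l, hl, hl2, hl3⟩ := ih
        refine ⟨l ++ t i, by rw [ht, hl, List.append_assoc], ?_, ?_⟩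
        · intro e' he'
          rcases List.mem_append.1 he' with h | h
          · exact hl2 e' h
          · exact hle i e' h
        · have := List.length_pos_iff.2 (List.ne_nil_of_mem (het i))
          rw [List.length_append]; omega
    refine (hwin w hw).not_limsupOdd (limsupOdd_of hp ?_ ?_)
    · rw [Filter.frequently_atTop]
      intro N
      obtain ⟨l, hl, -, hN⟩ := hacc N
      obtain ⟨m, hm, hme⟩ := List.getElem_of_mem (het N)
      refine ⟨(f 0).length + (l.length + m), by omega, ?_⟩
      have h2 := hget (N + 1) (l ++ t N) (by rw [ht, hl, List.append_assoc]) (l.length + m)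
        (by rw [List.length_append]; omega)
      rw [prios, h2]
      simpa [hme] using hep N
    · filter_upwards [Filter.eventually_ge_atTop (f 0).length] with k hk
      obtain ⟨m, rfl⟩ := Nat.exists_eq_add_of_le hk
      obtain ⟨l, hl, hl2, hm⟩ := hacc (m + 1)
      rw [prios, hget _ l hl m (by omega)]
      exact hl2 _ (List.getElem_mem _)
  have : IsWellFounded _ r := ⟨hwf⟩
  refine ⟨IsWellFounded.rank r, fun h e hc => ⟨fun hlt => ?_, fun heq => ?_⟩⟩
  · rw [IsWellFounded.rank_eq r (h ++ [e])]
    refine Ordinal.iSup_le fun ⟨b, hb⟩ => Order.succ_le_of_lt (IsWellFounded.rank_lt_of_rel ?_)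
    obtain ⟨h1, t, h2, h3, e', h4, h5⟩ := hb
    refine ⟨h1, [e] ++ t, h2.trans (List.append_assoc _ _ _), ?_, e', by simp [h4], h5⟩
    intro e'' he''
    rcases List.mem_append.1 he'' with h6 | h6
    · rw [List.mem_singleton.1 h6]; exact hlt.le
    · exact h3 e'' h6
  · exact IsWellFounded.rank_lt_of_rel
      ⟨hc, [e], rfl, fun e' he' => by rw [List.mem_singleton.1 he']; exact heq.le, e, by simp, heq⟩

/-- The ordinal number with the digits `f d, f (d - 1), …, f (d - t + 1)` in base `Ω`. -/
noncomputable def digitSum {α : Type} (Ω : Ordinal.{0}) (d : ℕ) (f : ℕ → α → Ordinal.{0}) :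
    ℕ → α → Ordinal.{0}
  | 0, _ => 0
  | t + 1, x => Ω * digitSum Ω d f t x + f (d - t) x

section digitSum

variable {α : Type} {Ω : Ordinal.{0}} {d : ℕ} {f : ℕ → α → Ordinal.{0}}

lemma digitSum_lt_succ (hΩ : ∀ p x, f p x < Ω) {t : ℕ} {x y : α}
    (h : digitSum Ω d f t x < digitSum Ω d f t y) :
    digitSum Ω d f (t + 1) x < digitSum Ω d f (t + 1) y := by
  calc Ω * digitSum Ω d f t x + f (d - t) x < Ω * digitSum Ω d f t x + Ω := by
        gcongr; exact hΩ _ _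
    _ = Ω * Order.succ (digitSum Ω d f t x) := (Ordinal.mul_succ _ _).symm
    _ ≤ Ω * digitSum Ω d f t y := by gcongr; exact Order.succ_le_of_lt h
    _ ≤ _ := le_self_add

lemma digitSum_lt_of_le (hΩ : ∀ p x, f p x < Ω) {t t' : ℕ} (htt : t ≤ t') {x y : α}
    (h : digitSum Ω d f t x < digitSum Ω d f t y) :
    digitSum Ω d f t' x < digitSum Ω d f t' y := by
  induction t', htt using Nat.le_induction with
  | base => exact h
  | succ k _ ih => exact digitSum_lt_succ hΩ ih

lemma digitSum_le {t : ℕ} {x y : α} (h : ∀ s < t, f (d - s) x ≤ f (d - s) y) :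
    digitSum Ω d f t x ≤ digitSum Ω d f t y := by
  induction t with
  | zero => exact le_rfl
  | succ t ih =>
    exact add_le_add (mul_le_mul_right (ih fun s hs => h s (by omega)) _) (h t (by omega))

lemma digitSum_lt {t : ℕ} {x y : α} (h : ∀ s < t, f (d - s) x ≤ f (d - s) y)
    (hlt : f (d - t) x < f (d - t) y) :
    digitSum Ω d f (t + 1) x < digitSum Ω d f (t + 1) y :=
  add_lt_add_of_le_of_lt (mul_le_mul_right (digitSum_le h) _) hlt

end digitSum

/-- A winning strategy of Even yields a ranking of the nodes along which her strategy descends: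
at a node `u` it suffices to play as after a fixed history `c u` that leads to `u`. -/
theorem exists_ranking {n d : ℕ} {G : GameGraph (Fin n) d}
    {σ : List (Edge (Fin n) d) → Fin n → Edge (Fin n) d}
    (hwin : ∀ w, (∀ k, G.Consistent σ (pre w k)) → LimsupEven (prios w)) :
    ∃ (K : Ranking n d) (R : Set (Fin n)) (c : Fin n → List (Edge (Fin n) d)), G.start ∈ R ∧
      ∀ e ∈ G.edges, e.1 ∈ R → (G.owner e.1 = .even → e = σ (c e.1) e.1) →
        e.2.2 ∈ R ∧ K.Descends e.1 e.2.1 e.2.2 := by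
  classical
  choose! ρ hρ using fun (p : ℕ) (hp : Odd p) => exists_rank hwin hp
  let f : ℕ → List (Edge (Fin n) d) → Ordinal.{0} := fun p h => if Odd p then ρ p h else 0
  obtain ⟨B, hB⟩ := Ordinal.bddAbove_of_small
    (s := Set.range fun x : ℕ × List (Edge (Fin n) d) => f x.1 x.2)
  have hΩ : ∀ p x, f p x < Order.succ B := fun p x =>
    Order.lt_succ_of_le (hB ⟨(p, x), rfl⟩)
  set S := digitSum (Order.succ B) d f with hS
  let R : Set (Fin n) := {u | ∃ h, G.Consistent σ h ∧ G.lastNode h = u}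
  have hmin : ∀ u, ∃ h, u ∈ R → (G.Consistent σ h ∧ G.lastNode h = u ∧
      ∀ h', G.Consistent σ h' → G.lastNode h' = u → S d h ≤ S d h') := by
    intro u
    by_cases hu : u ∈ R
    · obtain ⟨h, hh, hmin⟩ := (InvImage.wf (S d) Ordinal.lt_wf).has_min
        {h | G.Consistent σ h ∧ G.lastNode h = u} hu
      exact ⟨h, fun _ => ⟨hh.1, hh.2, fun h' h1 h2 => not_lt.1 (hmin h' ⟨h1, h2⟩)⟩⟩
    · exact ⟨[], fun h => absurd h hu⟩
  choose c hc using hmin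
  have hnest : ∀ h x y, S (d - (h + 1)) (c x) < S (d - (h + 1)) (c y) →
      S (d - h) (c x) < S (d - h) (c y) := fun h x y hxy =>
    digitSum_lt_of_le hΩ (by omega) hxy
  -- at level `0` ties are broken by the numbers of the nodes
  have htie : ∀ x y : Fin n, S d (c x) < S d (c y) →
      (n : Ordinal.{0}) * S d (c x) + (x.1 : Ordinal.{0}) <
        (n : Ordinal.{0}) * S d (c y) + (y.1 : Ordinal.{0}) := by
    intro x y hxy
    calc (n : Ordinal.{0}) * S d (c x) + (x.1 : Ordinal.{0})
        < (n : Ordinal.{0}) * S d (c x) + n := by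
          gcongr; exact_mod_cast x.2
      _ = n * Order.succ (S d (c x)) := (Ordinal.mul_succ _ _).symm
      _ ≤ n * S d (c y) := by gcongr; exact Order.succ_le_of_lt hxy
      _ ≤ _ := le_self_add
  let K : Ranking n d :=
    { key := fun h v => match h with
        | 0 => (n : Ordinal.{0}) * S d (c v) + (v.1 : Ordinal.{0})
        | h + 1 => S (d - (h + 1)) (c v)
      nest := fun h x y hxy => by
        cases h with
        | zero => exact htie x y (hnest 0 x y hxy)
        | succ h => exact hnest _ x y hxy
      inj := fun x y hxy => by
        dsimp only at hxy
        have hS : S d (c x) = S d (c y) := by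
          rcases lt_trichotomy (S d (c x)) (S d (c y)) with h | h | h
          · exact absurd hxy (htie x y h).ne
          · exact h
          · exact absurd hxy (htie y x h).ne'
        rw [hS] at hxy
        exact Fin.ext (by exact_mod_cast add_left_cancel hxy)
      top := fun h hh x y => by
        cases h with
        | zero =>
          obtain rfl : d = 0 := by omega
          exact absurd (G.exists_out x).choose.2.1.2 (by
            have := (G.exists_out x).choose.2.1.2
            simp only [Set.mem_Icc, not_and, not_le]; omega)
        | succ h =>
          dsimp only
          rw [Nat.sub_eq_zero_of_le hh]; rfl }
  refine ⟨K, R, c, ⟨[], .nil, rfl⟩, fun e he hu hev => ?_⟩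
  obtain ⟨hcu, hlu, hmu⟩ := hc _ hu
  have hce : G.Consistent σ (c e.1 ++ [e]) := .snoc _ _ hcu he hlu.symm hev
  have hvR : e.2.2 ∈ R := ⟨_, hce, by simp⟩
  obtain ⟨hcv, hlv, hmv⟩ := hc _ hvR
  have hmv' : ∀ t ≤ d, S t (c e.2.2) ≤ S t (c e.1 ++ [e]) := fun t ht => by
    by_contra hlt
    exact absurd (hmv _ hce (by simp)) (not_le.2 (digitSum_lt_of_le hΩ ht (not_le.1 hlt)))
  obtain ⟨hq1, hqd⟩ := e.2.1.2
  set q : ℕ := (e.2.1 : ℕ) with hq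
  have hdig : ∀ p, q < p → f p (c e.1 ++ [e]) ≤ f p (c e.1) := fun p hp => by
    by_cases hodd : Odd p
    · simp only [f, if_pos hodd]; exact ((hρ p hodd) _ e hce).1 hp
    · simp only [f, if_neg hodd]; exact le_rfl
  refine ⟨hvR, fun hodd => ?_, fun heven => ?_⟩
  · have hlt : S (d - (q - 1)) (c e.2.2) < S (d - (q - 1)) (c e.1) := by
      refine (hmv' _ (by omega)).trans_lt ?_
      have hdq : d - (q - 1) = (d - q) + 1 := by omega
      rw [hdq]
      refine digitSum_lt (fun s hs => hdig _ (by omega)) ?_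
      have : d - (d - q) = q := by omega
      simp only [f, this, if_pos hodd]
      exact ((hρ q hodd) _ e hce).2 rfl
    rcases hq' : q - 1 with _ | k
    · rw [hq'] at hlt; exact htie _ _ hlt
    · rw [hq'] at hlt; exact hlt
  · obtain ⟨k, hk⟩ : ∃ k, q = k + 1 := ⟨q - 1, by omega⟩
    have hle : S (d - q) (c e.2.2) ≤ S (d - q) (c e.1) :=
      (hmv' _ (by omega)).trans (digitSum_le fun s hs => hdig _ (by omega))
    change K.key q _ ≤ K.key q _
    rw [hk] at hle ⊢
    exact hle

end GameGraph

namespace Ranking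

/-! ### Sizes of the subtrees of a ranking -/

variable {n d : ℕ} (K : Ranking n d)

lemma key_lt {g h : ℕ} (hgh : g ≤ h) {x y : Fin n} (hxy : K.key h x < K.key h y) :
    K.key g x < K.key g y := by
  induction h, hgh using Nat.le_induction with
  | base => exact hxy
  | succ k _ ih => exact ih (K.nest _ _ _ hxy)

lemma key_le {g h : ℕ} (hgh : g ≤ h) {x y : Fin n} (hxy : K.key g x ≤ K.key g y) :
    K.key h x ≤ K.key h y :=
  not_lt.1 fun hlt => not_lt.2 hxy (K.key_lt hgh hlt)

lemma key_eq {g h : ℕ} (hgh : g ≤ h) {x y : Fin n} (hxy : K.key g x = K.key g y) :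
    K.key h x = K.key h y :=
  le_antisymm (K.key_le hgh hxy.le) (K.key_le hgh hxy.ge)

open Classical in
/-- The number of nodes to the left of the subtree of `v` at level `h`. -/
noncomputable def left (h : ℕ) (v : Fin n) : ℕ :=
  (Finset.univ.filter fun x => K.key h x < K.key h v).card

open Classical in
/-- The number of nodes in the subtree of `v` at level `h` and to the left of it. -/
noncomputable def right (h : ℕ) (v : Fin n) : ℕ :=
  (Finset.univ.filter fun x => K.key h x ≤ K.key h v).card

open Classical in
/-- The number of nodes in the subtree of `v` at level `h`. -/
noncomputable def size (h : ℕ) (v : Fin n) : ℕ :=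
  (Finset.univ.filter fun x => K.key h x = K.key h v).card

lemma right_le (h : ℕ) (v : Fin n) : K.right h v ≤ n := by
  classical
  exact (Finset.card_le_univ _).trans (by simp)

lemma size_le (h : ℕ) (v : Fin n) : K.size h v ≤ n := by
  classical
  exact (Finset.card_le_univ _).trans (by simp)

lemma left_add_size (h : ℕ) (v : Fin n) : K.left h v + K.size h v = K.right h v := by
  classical
  rw [left, size, right, ← Finset.card_union_of_disjoint]
  · congr 1
    ext x
    simp [le_iff_lt_or_eq]
  · rw [Finset.disjoint_filter]
    exact fun x _ h1 h2 => h1.ne h2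

lemma size_pos (h : ℕ) (v : Fin n) : 0 < K.size h v := by
  classical
  exact Finset.card_pos.2 ⟨v, by simp⟩

lemma left_lt_right (h : ℕ) (v : Fin n) : K.left h v < K.right h v := by
  have := K.left_add_size h v
  have := K.size_pos h v
  omega

lemma left_anti {g h : ℕ} (hgh : g ≤ h) (v : Fin n) : K.left h v ≤ K.left g v := by
  classical
  exact Finset.card_le_card (Finset.monotone_filter_right _ fun x _ hx => K.key_lt hgh hx)

lemma right_mono {g h : ℕ} (hgh : g ≤ h) (v : Fin n) : K.right g v ≤ K.right h v := by
  classical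
  exact Finset.card_le_card (Finset.monotone_filter_right _ fun x _ hx => K.key_le hgh hx)

lemma size_mono {g h : ℕ} (hgh : g ≤ h) (v : Fin n) : K.size g v ≤ K.size h v := by
  classical
  exact Finset.card_le_card (Finset.monotone_filter_right _ fun x _ hx => K.key_eq hgh hx)

variable {K}

lemma right_le_left {h : ℕ} {u v : Fin n} (huv : K.key h v < K.key h u) :
    K.right h v ≤ K.left h u := by
  classical
  exact Finset.card_le_card (Finset.monotone_filter_right _ fun x _ hx => lt_of_le_of_lt hx huv)

lemma left_congr {h : ℕ} {u v : Fin n} (huv : K.key h v = K.key h u) :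
    K.left h v = K.left h u := by rw [left, left, huv]

lemma right_congr {h : ℕ} {u v : Fin n} (huv : K.key h v = K.key h u) :
    K.right h v = K.right h u := by rw [right, right, huv]

lemma size_congr {h : ℕ} {u v : Fin n} (huv : K.key h v = K.key h u) :
    K.size h v = K.size h u := by rw [size, size, huv]

/-- Distinct subtrees of the same subtree are disjoint. -/
lemma size_add_size_le {g h : ℕ} (hgh : g ≤ h) {x y : Fin n} (hg : K.key g x ≠ K.key g y)
    (hh : K.key h x = K.key h y) : K.size g x + K.size g y ≤ K.size h y := by
  classical
  rw [size, size, size, ← Finset.card_union_of_disjoint]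
  · refine Finset.card_le_card fun z hz => ?_
    simp only [Finset.mem_union, Finset.mem_filter, Finset.mem_univ, true_and] at hz ⊢
    rcases hz with hz | hz
    · rw [K.key_eq hgh hz, hh]
    · exact K.key_eq hgh hz
  · rw [Finset.disjoint_filter]
    exact fun z _ h1 h2 => hg (h1.symm.trans h2)

lemma exists_height (K : Ranking n d) (j : ℕ) (v : Fin n) :
    ∃ h, 2 ^ j ≤ K.size h v ∨ d < h := ⟨d + 1, Or.inr (Nat.lt_succ_self d)⟩

open Classical in
/-- The least level at which the subtree of `v` has at least `2 ^ j` nodes (`d + 1` if there is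
no such level). -/
noncomputable def height (K : Ranking n d) (j : ℕ) (v : Fin n) : ℕ := Nat.find (K.exists_height j v)

lemma height_le {j h : ℕ} {v : Fin n} (hs : 2 ^ j ≤ K.size h v) : K.height j v ≤ h := by
  classical
  exact Nat.find_min' _ (Or.inl hs)

lemma height_zero (v : Fin n) : K.height 0 v = 0 :=
  Nat.le_zero.1 (height_le (by rw [pow_zero]; exact K.size_pos 0 v))

lemma lt_height {j h : ℕ} {v : Fin n} (hd : h ≤ d) (hs : K.size h v < 2 ^ j) :
    h < K.height j v := by
  classical
  rw [height, Nat.lt_find_iff]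
  rintro m hm (h1 | h1)
  · exact absurd (h1.trans (K.size_mono hm v)) (not_le.2 hs)
  · omega

lemma height_congr {j h : ℕ} {u v : Fin n} (huv : K.key h v = K.key h u)
    (hs : K.size h u < 2 ^ j) : K.height j v = K.height j u := by
  classical
  have hiff : ∀ m, (2 ^ j ≤ K.size m v ∨ d < m) ↔ (2 ^ j ≤ K.size m u ∨ d < m) := by
    intro m
    rcases le_total m h with hm | hm
    · have h1 := K.size_mono hm u
      have h2 := K.size_mono hm v
      rw [size_congr huv] at h2
      constructor <;> rintro (h3 | h3) <;> first | exact Or.inr h3 | omega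
    · rw [size_congr (K.key_eq hm huv)]
  simp only [height, hiff]

/-! ### The potential of a node with given registers -/

/-- A register below `j` holds an odd value above the level `h`, although the subtree of `v` at
level `h` uses more than `j` registers. -/
def Garbage (K : Ranking n d) (j : ℕ) (v : Fin n) (r : ℕ → ℕ) (h : ℕ) : Prop :=
  2 ^ j ≤ K.size h v ∧ ∃ i < j, Odd (r i) ∧ h < r i ∧ 1 < r i

/-- An odd reset of the register with index `i` can become necessary in a subtree of `v` for which
this is the highest register in use: its value is odd and too large, or the play can still descend
into a child that uses the same number of registers, and the register is not prepared for this. -/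
def Spoiled (K : Ranking n d) (i : ℕ) (v : Fin n) (r : ℕ → ℕ) : Prop :=
  K.height i v < K.height (i + 1) v ∧
    ((Odd (r i) ∧ K.height i v < r i ∧ 1 < r i) ∨
      ((∃ x, K.key (K.height i v) x = K.key (K.height i v) v ∧
          K.key (K.height i v - 1) x < K.key (K.height i v - 1) v ∧
          2 ^ i ≤ K.size (K.height i v - 1) x) ∧
        ¬ (Even (r i) ∧ K.height i v ≤ r i)))

/-- The value `c` of the counter number `j` suffices to continue from `v` with registers `r`.  The
register number `i + 1` is `r i`. -/
structure Fits (K : Ranking n d) (c j : ℕ) (v : Fin n) (r : ℕ → ℕ) : Prop where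
  garbage : ∀ h, K.Garbage j v r h → K.right h v < c
  left : K.left (K.height j v - 1) v < c
  spoiled : ∀ i, j = i + 1 → K.Spoiled i v r → K.left (K.height j v - 1) v + 1 < c

/-- The update of registers. -/
def upd (r : ℕ → ℕ) (q : ℕ) : ℕ → ℕ := fun i => max (r i) q

/-- The reset of the register with index `k`. -/
def rst (r : ℕ → ℕ) (k : ℕ) : ℕ → ℕ := fun i =>
  if k < i then r i else if i = 0 then 1 else r (i - 1)

/-- The value `n` of a counter suffices if the registers below it contain no odd values except the
initial one. -/
lemma fits_of_fresh {j : ℕ} {v : Fin n} {r : ℕ → ℕ} (hr : ∀ i < j, Even (r i) ∨ r i = 1) :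
    K.Fits n j v r where
  garbage h hg := by
    obtain ⟨-, i, hi, hodd, -, h1⟩ := hg
    rcases hr i hi with h2 | h2
    · exact absurd h2 (Nat.not_even_iff_odd.2 hodd)
    · omega
  left := (K.left_lt_right _ v).trans_le (K.right_le _ v)
  spoiled i hi hs := by
    classical
    obtain ⟨h1, ⟨hodd, -, h2⟩ | ⟨⟨x, hx, hlt, -⟩, -⟩⟩ := hs
    · rcases hr i (by omega) with h3 | h3
      · exact absurd h3 (Nat.not_even_iff_odd.2 hodd)
      · omega
    · -- the node `x` lies in the same subtree as `v`
      rw [← hi] at h1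
      have hxv : x ≠ v := by rintro rfl; exact lt_irrefl _ hlt
      have h2 : 2 ≤ K.size (K.height j v - 1) v := by
        rw [← Finset.card_pair hxv]
        refine Finset.card_le_card fun z hz => ?_
        have hz' : z = x ∨ z = v := by simpa using hz
        rcases hz' with rfl | rfl
        · simpa using K.key_eq (by omega) hx
        · simp
      have := K.left_add_size (K.height j v - 1) v
      have := K.right_le (K.height j v - 1) v
      omega

lemma fits_of_right_lt {c j g : ℕ} {v : Fin n} {r : ℕ → ℕ} (hg : K.height j v ≤ g + 1)
    (hc : K.right g v < c) (hgarb : ∀ h, g < h → K.Garbage j v r h → K.right h v < c) :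
    K.Fits c j v r := by
  have h1 := K.left_lt_right (K.height j v - 1) v
  have h2 := K.right_mono (g := K.height j v - 1) (h := g) (by omega) v
  refine ⟨fun h hh => ?_, by omega, fun _ _ _ => by omega⟩
  rcases lt_or_ge g h with h3 | h3
  · exact hgarb h h3 hh
  · exact (K.right_mono h3 v).trans_lt hc

lemma not_spoiled {i : ℕ} {v : Fin n} {r : ℕ → ℕ}
    (h : (Even (r i) ∧ K.height i v ≤ r i) ∨ (i = 0 ∧ r i = 1)) : ¬ K.Spoiled i v r := by
  rintro ⟨-, ⟨hodd, -, h1⟩ | ⟨⟨x, hx, hlt, -⟩, h2⟩⟩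
  · rcases h with h | h
    · exact absurd h.1 (Nat.not_even_iff_odd.2 hodd)
    · omega
  · rcases h with h | ⟨rfl, -⟩
    · exact h2 h
    · rw [height_zero] at hx hlt
      exact hlt.ne hx

/-- Passing to a node of the same subtree at level `h` creates no garbage at the levels from `h`
on. -/
lemma Garbage.of_upd {j h q : ℕ} {u v : Fin n} {r r' : ℕ → ℕ} (hqh : q ≤ h)
    (huv : K.key h v = K.key h u) (hr' : ∀ i < j, ∃ i' < j, r' i ≤ 1 ∨ r' i = upd r q i')
    (hg : K.Garbage j v r' h) : K.Garbage j u r h := by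
  obtain ⟨h1, i, hi, hodd, hlt, h2⟩ := hg
  obtain ⟨i', hi', h3 | h3⟩ := hr' i hi
  · omega
  · refine ⟨size_congr huv ▸ h1, i', hi', ?_⟩
    have h4 : r' i = r i' := by
      rw [h3, upd, max_eq_left]
      rw [h3, upd] at hlt
      rcases lt_max_iff.1 hlt with h5 | h5 <;> omega
    rw [← h4]
    exact ⟨hodd, hlt, h2⟩

/-! ### Jumps -/

section Jump

variable {q κ : ℕ} {u v : Fin n} {r : ℕ → ℕ}

lemma rst_upd_values {i₀ j : ℕ} (i : ℕ) (hi : i < j) :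
    ∃ i' < j, rst (upd r q) i₀ i ≤ 1 ∨ rst (upd r q) i₀ i = upd r q i' := by
  unfold rst
  split_ifs with h1 h2
  · exact ⟨i, hi, Or.inr rfl⟩
  · exact ⟨i, hi, Or.inl le_rfl⟩
  · exact ⟨i - 1, by omega, Or.inr rfl⟩

lemma rst_fresh {i₀ : ℕ} (hev : ∀ i < i₀, Even (upd r q i)) (i : ℕ) (hi : i < i₀ + 1) :
    Even (rst (upd r q) i₀ i) ∨ rst (upd r q) i₀ i = 1 := by
  unfold rst
  split_ifs with h1 h2
  · omega
  · exact Or.inr rfl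
  · exact Or.inl (hev _ (by omega))

lemma not_spoiled_rst {i₀ : ℕ} (huv : K.key q v = K.key q u) (hs : 2 ^ i₀ ≤ K.size q u)
    (hev : ∀ i < i₀, Even (upd r q i)) : ¬ K.Spoiled i₀ v (rst (upd r q) i₀) := by
  have h0 : K.height i₀ v ≤ q := height_le (size_congr huv ▸ hs)
  apply not_spoiled
  rcases Nat.eq_zero_or_pos i₀ with rfl | hpos
  · exact Or.inr ⟨rfl, by simp [rst]⟩
  · left
    have h1 : rst (upd r q) i₀ i₀ = upd r q (i₀ - 1) := by
      simp [rst, Nat.pos_iff_ne_zero.1 hpos]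
    rw [h1]
    exact ⟨hev _ (by omega), h0.trans (le_max_right _ _)⟩

lemma Spoiled.of_jump {i : ℕ} {r' : ℕ → ℕ} (hqd : q ≤ d) (hq : Even q)
    (huv : K.key q v = K.key q u) (hs : K.size q u < 2 ^ (i + 1)) (hr' : r' i = upd r q i)
    (hsp : K.Spoiled i v r') : K.Spoiled i u r := by
  have hq1 : ∀ h, q < h → r' i = max (r i) q → h ≤ r' i → r i = r' i := fun h h1 h2 h3 => by
    rw [h2, max_eq_left]; rw [h2] at h3
    rcases le_max_iff.1 h3 with h4 | h4 <;> omega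
  rw [upd] at hr'
  obtain ⟨h1, h2⟩ := hsp
  rcases lt_or_ge (K.size q u) (2 ^ i) with hsi | hsi
  · have hh := height_congr huv hsi
    have hh' := height_congr huv hs
    have hlt := lt_height hqd hsi
    rw [hh, hh'] at h1
    rw [hh] at h2
    refine ⟨h1, ?_⟩
    rcases h2 with ⟨hodd, h3, h4⟩ | ⟨⟨x, hx, hx', hx''⟩, h3⟩
    · rw [hq1 _ hlt hr' h3.le]; exact Or.inl ⟨hodd, h3, h4⟩
    · refine Or.inr ⟨⟨x, hx.trans (K.key_eq hlt.le huv), ?_, hx''⟩, fun h4 => h3 ?_⟩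
      · rw [← K.key_eq (by omega) huv]; exact hx'
      · rw [hr', max_eq_left (by omega)]; exact h4
  · have hv : K.height i v ≤ q := height_le (size_congr huv ▸ hsi)
    have hu : K.height i u ≤ q := height_le hsi
    have hnot : ¬ Even (r' i) := by
      intro he
      rcases h2 with ⟨hodd, -⟩ | ⟨-, h3⟩
      · exact (Nat.not_even_iff_odd.2 hodd) he
      · exact h3 ⟨he, by omega⟩
    have hri : r' i = r i ∧ q < r i := by
      rcases le_or_gt (r i) q with h3 | h3
      · rw [hr', max_eq_right h3] at hnot; exact absurd hq hnot
      · exact ⟨by rw [hr', max_eq_left h3.le], h3⟩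
    refine ⟨hu.trans_lt (lt_height hqd hs), Or.inl ⟨?_, by omega, ?_⟩⟩
    · rw [← hri.1]; exact Nat.not_even_iff_odd.1 hnot
    · have : r i ≠ 1 := by
        intro h3
        obtain rfl : q = 0 := by omega
        rcases h2 with ⟨-, -, h4⟩ | ⟨⟨x, hx, hx', -⟩, -⟩
        · omega
        · obtain h5 : K.height i v = 0 := by omega
          rw [h5] at hx hx'
          exact hx'.ne hx
      omega

lemma jump_left_eq {j : ℕ} (hqd : q ≤ d) (huv : K.key q v = K.key q u)
    (hs : K.size q u < 2 ^ j) :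
    K.height j v = K.height j u ∧ K.left (K.height j v - 1) v = K.left (K.height j u - 1) u := by
  have hh := height_congr huv hs
  refine ⟨hh, ?_⟩
  have := lt_height hqd hs
  rw [hh]
  exact left_congr (K.key_eq (by omega) huv)

/-- A jump in a subtree with less than `2 ^ j` nodes, if the highest register below `j` is not
touched by the reset, or is in order after it. -/
lemma fits_jump_small {c i₀ j : ℕ} (hqd : q ≤ d) (hq : Even q) (huv : K.key q v = K.key q u)
    (hs : K.size q u < 2 ^ j) (hj : i₀ < j)
    (hsp : ∀ i, j = i + 1 → i = i₀ → ¬ K.Spoiled i v (rst (upd r q) i₀))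
    (hf : K.Fits c j u r) : K.Fits c j v (rst (upd r q) i₀) := by
  obtain ⟨hh, hl⟩ := jump_left_eq hqd huv hs
  have hlt := lt_height hqd hs
  refine ⟨fun h hg => ?_, hl ▸ hf.left, fun i hi hi' => hl ▸ ?_⟩
  · have hqh : q ≤ h := by
      have := height_le hg.1
      omega
    rw [right_congr (K.key_eq hqh huv)]
    exact hf.garbage h (hg.of_upd hqh (K.key_eq hqh huv) fun i hi => rst_upd_values i hi)
  · rcases eq_or_ne i i₀ with rfl | hne
    · exact absurd hi' (hsp i hi rfl)
    · refine hf.spoiled i hi (hi'.of_jump hqd hq huv (hi ▸ hs) ?_)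
      have : i₀ < i := by omega
      simp [rst, this]

lemma fits_jump_even {c j : ℕ} (hqd : q ≤ d) (hq : Even q) (huv : K.key q v = K.key q u)
    (hκ : 2 ^ κ ≤ K.size q u) (hκ' : K.size q u < 2 ^ (κ + 1))
    (hev : ∀ i ≤ κ, Even (upd r q i)) (hj : κ < j) (hf : K.Fits c j u r) :
    K.Fits c j v (rst (upd r q) κ) := by
  refine fits_jump_small hqd hq huv
    (hκ'.trans_le (Nat.pow_le_pow_right (by norm_num) hj)) hj ?_ hf
  rintro i - rfl
  exact not_spoiled_rst huv hκ fun i hi => hev i hi.le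

lemma jump_garbage {i₀ j : ℕ} (hq : Even q) (hq2 : 0 < q) (hs : 2 ^ j ≤ K.size q u)
    (hodd : Odd (upd r q i₀)) (hj : i₀ < j) : K.Garbage j u r q := by
  have h1 : q < r i₀ := by
    by_contra h
    rw [upd, max_eq_right (not_lt.1 h)] at hodd
    exact (Nat.not_even_iff_odd.2 hodd) hq
  refine ⟨hs, i₀, hj, ?_, h1, by omega⟩
  rwa [upd, max_eq_left h1.le] at hodd

lemma fits_jump_odd {c i₀ j : ℕ} (hqd : q ≤ d) (hq : Even q) (hq2 : 0 < q)
    (huv : K.key q v = K.key q u) (hodd : Odd (upd r q i₀)) (hj : i₀ + 1 < j)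
    (hf : K.Fits c j u r) : K.Fits c j v (rst (upd r q) i₀) := by
  rcases lt_or_ge (K.size q u) (2 ^ j) with hs | hs
  · exact fits_jump_small hqd hq huv hs (by omega) (fun i hi hi' => by omega) hf
  · have hg := hf.garbage q (jump_garbage hq hq2 hs hodd (by omega))
    have hh : K.height j v ≤ q := height_le (size_congr huv ▸ hs)
    refine fits_of_right_lt (g := q) (by omega) (right_congr huv ▸ hg) fun h hqh hg => ?_
    rw [right_congr (K.key_eq hqh.le huv)]
    exact hf.garbage h (hg.of_upd hqh.le (K.key_eq hqh.le huv)
      fun i hi => rst_upd_values i hi)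

/-- An odd reset pays with the counter of the register that is cleaned. -/
lemma fits_jump_odd_self {c i₀ : ℕ} (hqd : q ≤ d) (hq : Even q) (hq2 : 0 < q)
    (huv : K.key q v = K.key q u) (hs : 2 ^ i₀ ≤ K.size q u)
    (hodd : Odd (upd r q i₀)) (hev : ∀ i < i₀, Even (upd r q i))
    (hf : K.Fits (c + 1) (i₀ + 1) u r) : K.Fits c (i₀ + 1) v (rst (upd r q) i₀) := by
  have hns := not_spoiled_rst (v := v) huv hs hev
  refine ⟨fun h hg => ?_, ?_, fun i hi hi' => ?_⟩
  · obtain ⟨-, i, hi, hodd', -, h1⟩ := hg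
    rcases rst_fresh hev i hi with h2 | h2
    · exact absurd h2 (Nat.not_even_iff_odd.2 hodd')
    · omega
  · rcases lt_or_ge (K.size q u) (2 ^ (i₀ + 1)) with hs' | hs'
    · rw [(jump_left_eq hqd huv hs').2]
      have h2 : q < r i₀ := by
        by_contra h
        rw [upd, max_eq_right (not_lt.1 h)] at hodd
        exact (Nat.not_even_iff_odd.2 hodd) hq
      have h3 := height_le hs
      refine Nat.lt_of_succ_lt_succ (hf.spoiled i₀ rfl
        ⟨h3.trans_lt (lt_height hqd hs'), Or.inl ⟨?_, by omega, by omega⟩⟩)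
      rwa [upd, max_eq_left h2.le] at hodd
    · have hg := hf.garbage q (jump_garbage hq hq2 hs' hodd (by omega))
      rw [← right_congr huv] at hg
      have hh : K.height (i₀ + 1) v ≤ q := height_le (size_congr huv ▸ hs')
      have h1 := K.left_lt_right (K.height (i₀ + 1) v - 1) v
      have h2 := K.right_mono (g := K.height (i₀ + 1) v - 1) (h := q) (by omega) v
      omega
  · obtain rfl : i = i₀ := by omega
    exact absurd hi' hns

end Jump

/-! ### Descents -/

section Descent

variable {q g : ℕ} {u v : Fin n} {r : ℕ → ℕ}

lemma descent_lt_top (hlt : K.key g v < K.key g u) : g < d := by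
  by_contra h
  exact hlt.ne (K.top g (not_lt.1 h) _ _)

lemma fits_descent_zero {c : ℕ} (hlt : K.key g v < K.key g u) (hf : K.Fits (c + 1) 0 u r) :
    K.Fits c 0 v (upd r q) := by
  have h1 := hf.left
  have h2 := right_le_left (K.key_lt (Nat.zero_le g) hlt)
  have h3 := K.left_lt_right 0 v
  rw [height_zero] at h1
  refine ⟨fun h hg => ?_, ?_, fun i hi => by omega⟩
  · obtain ⟨-, i, hi, -⟩ := hg
    omega
  · rw [height_zero]
    change K.left 0 u < _ at h1
    change K.left 0 v < _
    omega

lemma Spoiled.of_descent {i : ℕ} (hlt : K.key g v < K.key g u)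
    (huv : K.key (g + 1) v = K.key (g + 1) u) (hq : q ≤ g + 1)
    (hs : K.size (g + 1) u < 2 ^ (i + 1)) (hsp : K.Spoiled i v (upd r q)) : K.Spoiled i u r := by
  have hgd := descent_lt_top hlt
  have hupd : ∀ h, q ≤ h → h < upd r q i → upd r q i = r i := fun h h1 h2 => by
    rw [upd] at h2 ⊢
    rcases lt_max_iff.1 h2 with h3 | h3 <;> omega
  have hupd' : ∀ h, q ≤ h → h ≤ r i → upd r q i = r i := fun h h1 h2 =>
    max_eq_left (by omega)
  obtain ⟨h1, h2⟩ := hsp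
  rcases lt_or_ge (K.size (g + 1) u) (2 ^ i) with hsi | hsi
  · have hh := height_congr huv hsi
    have hh' := height_congr huv hs
    have hl := lt_height (by omega) hsi
    rw [hh, hh'] at h1
    rw [hh] at h2
    refine ⟨h1, ?_⟩
    rcases h2 with ⟨hodd, h3, h4⟩ | ⟨⟨x, hx, hx', hx''⟩, h3⟩
    · have he := hupd _ (by omega) h3
      rw [he] at hodd h3 h4
      exact Or.inl ⟨hodd, h3, h4⟩
    · refine Or.inr ⟨⟨x, hx.trans (K.key_eq hl.le huv), ?_, hx''⟩, fun h4 => h3 ?_⟩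
      · rw [← K.key_eq (by omega) huv]; exact hx'
      · rw [hupd' _ (by omega) h4.2]; exact h4
  · have hsi' : 2 ^ i ≤ K.size (g + 1) v := size_congr huv ▸ hsi
    have htop := lt_height (by omega) hs
    -- two children cannot both have `2 ^ i` nodes
    have hdisj : ∀ x, K.key g x < K.key g u → K.key (g + 1) x = K.key (g + 1) u →
        2 ^ i ≤ K.size g x → K.height i u = g + 1 := by
      intro x hx hx' hsx
      have h3 := size_add_size_le (K := K) (h := g + 1) (Nat.le_succ g) hx.ne hx'
      have h4 : 2 ^ (i + 1) = 2 * 2 ^ i := by ring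
      have h5 := lt_height (j := i) (K := K) (v := u) hgd.le (by omega)
      have h6 := height_le hsi
      omega
    rcases le_or_gt (2 ^ i) (K.size g v) with hgv | hgv
    · have hu := hdisj v hlt huv hgv
      have hv : K.height i v ≤ g := height_le hgv
      refine ⟨by omega, Or.inr ⟨⟨v, by rw [hu, huv], by rw [hu]; exact hlt, by rw [hu]; exact hgv⟩,
        ?_⟩⟩
      rw [hu]
      rintro ⟨he, hle⟩
      rw [hupd' _ hq hle] at h2
      rcases h2 with ⟨hodd, -⟩ | ⟨-, h3⟩
      · exact (Nat.not_even_iff_odd.2 hodd) he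
      · exact h3 ⟨he, by omega⟩
    · have hv : K.height i v = g + 1 := by
        have h5 := lt_height hgd.le hgv
        have h6 := height_le hsi'
        omega
      rw [hv] at h2
      have hu := height_le hsi
      refine ⟨by omega, ?_⟩
      rcases h2 with ⟨hodd, h3, h4⟩ | ⟨⟨x, hx, hx', hx''⟩, h3⟩
      · have he := hupd _ hq h3
        rw [he] at hodd h3 h4
        exact Or.inl ⟨hodd, by omega, h4⟩
      · have hxu : K.key g x < K.key g u := lt_trans hx' hlt
        have hu' := hdisj x hxu (hx.trans huv) hx''
        rw [hu']
        refine Or.inr ⟨⟨x, hx.trans huv, hxu, hx''⟩, fun h4 => h3 ?_⟩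
        rw [hupd' _ hq h4.2]; exact h4

lemma fits_descent {c j : ℕ} (hlt : K.key g v < K.key g u)
    (huv : K.key (g + 1) v = K.key (g + 1) u) (hq : q ≤ g + 1) (hf : K.Fits c j u r) :
    K.Fits c j v (upd r q) := by
  have hgd := descent_lt_top hlt
  have hgarb : ∀ h, g < h → K.Garbage j v (upd r q) h → K.right h v < c := fun h hgh hg => by
    rw [right_congr (K.key_eq (by omega) huv)]
    exact hf.garbage h (hg.of_upd (by omega) (K.key_eq (by omega) huv)
      fun i hi => ⟨i, hi, Or.inr rfl⟩)
  rcases lt_or_ge (K.size (g + 1) u) (2 ^ j) with hs | hs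
  · obtain ⟨hh, hl⟩ := jump_left_eq (by omega) huv hs
    have hlt' := lt_height (by omega) hs
    refine ⟨fun h hg => hgarb h ?_ hg, hl ▸ hf.left, fun i hi hi' => hl ▸ ?_⟩
    · have := height_le hg.1
      omega
    · exact hf.spoiled i hi (hi'.of_descent hlt huv hq (hi ▸ hs))
  · have h1 := height_le hs
    have h2 := height_le (size_congr huv ▸ hs : 2 ^ j ≤ K.size (g + 1) v)
    refine fits_of_right_lt (g := g) (by omega) ?_ hgarb
    calc K.right g v ≤ K.left g u := right_le_left hlt
      _ ≤ K.left (K.height j u - 1) u := K.left_anti (by omega) u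
      _ < c := hf.left

end Descent

/-- Either `q` is even and the edge stays in the same subtree of level `q`, or the edge moves to the
left; then `g` is the highest level at which the subtrees of `u` and `v` differ. -/
lemma jump_or_descent {q : ℕ} {u v : Fin n} (h : K.Descends u q v) :
    (Even q ∧ K.key q v = K.key q u) ∨
      ∃ g, K.key g v < K.key g u ∧ K.key (g + 1) v = K.key (g + 1) u ∧ q ≤ g + 1 := by
  classical
  by_cases hj : Even q ∧ K.key q v = K.key q u
  · exact Or.inl hj
  right
  obtain ⟨g₀, hg₀, hqg⟩ : ∃ g, K.key g v < K.key g u ∧ q ≤ g + 1 := by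
    rcases Nat.even_or_odd q with he | ho
    · exact ⟨q, lt_of_le_of_ne (h.2 he) fun h' => hj ⟨he, h'⟩, by omega⟩
    · exact ⟨q - 1, h.1 ho, by omega⟩
  have hg₀d := descent_lt_top hg₀
  have hspec := Nat.findGreatest_spec (P := fun g => K.key g v < K.key g u) hg₀d.le hg₀
  have hle := Nat.le_findGreatest (P := fun g => K.key g v < K.key g u) hg₀d.le hg₀
  refine ⟨_, hspec, ?_, by omega⟩
  have hgd := descent_lt_top hspec
  have hn := Nat.findGreatest_is_greatest (P := fun g => K.key g v < K.key g u) (n := d)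
    (Nat.lt_succ_self _) hgd
  exact le_antisymm (K.key_le (Nat.le_succ _) hspec.le) (not_lt.1 hn)

end Ranking
/-! ### Accepting runs of the safety automaton -/

variable {n d : ℕ}

/-- The counters `c` suffice to continue from the node `v` with registers `s`. -/
def Safe (K : Ranking n d) (v : Fin n) (s : RState n d) (c : Counters n) : Prop :=
  ∃ r : ℕ → ℕ, (∀ i : Fin (rn n), r i = s.1 i) ∧ ∀ j : Fin (rn n + 1), K.Fits (c j) j v r

lemma update_eq_upd {s : RState n d} {r : ℕ → ℕ} (hr : ∀ i : Fin (rn n), r i = s.1 i)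
    (p : Upto d) (i : Fin (rn n)) : Ranking.upd r p i = (s.update p).1 i := by
  rw [Ranking.upd, hr]
  exact ((Subtype.mono_coe _).map_max).symm

lemma reset_eq_rst (hd : 0 < d) {s : RState n d} {r : ℕ → ℕ}
    (hr : ∀ i : Fin (rn n), r i = s.1 i) (k i : Fin (rn n)) :
    Ranking.rst r k i = (s.reset hd k).1 i := by
  unfold Ranking.rst RState.reset
  dsimp only
  by_cases h1 : k < i
  · rw [if_pos h1, if_pos (show (k : ℕ) < i from h1), hr]
  · rw [if_neg h1, if_neg (show ¬ (k : ℕ) < i from h1)]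
    by_cases h2 : i.1 = 0
    · rw [if_pos h2, if_pos h2]
    · rw [if_neg h2, if_neg h2, ← hr]

lemma lt_rn_of_pow_le {κ m : ℕ} (h : 2 ^ κ ≤ m) (hm : m ≤ n) : κ < rn n := by
  have h0 : n ≠ 0 := by
    have := Nat.pos_of_ne_zero (pow_ne_zero κ (two_ne_zero (α := ℕ)))
    omega
  have := (Nat.le_log_iff_pow_le (by norm_num) h0).2 (h.trans hm)
  rw [rn]; omega

lemma safe_init (hn : 0 < n) (hd : 0 < d) (K : Ranking n d) (v : Fin n) :
    Safe K v (registerAutomaton n d hd).init (fun _ => ⟨n, hn, le_rfl⟩) :=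
  ⟨fun _ => 1, fun _ => rfl, fun _ => Ranking.fits_of_fresh fun _ _ => Or.inr rfl⟩

/-- Along an edge that descends in the ranking, the safety automaton can avoid rejecting. -/
lemma exists_safe_step (hn : 0 < n) (hd : 0 < d) {K : Ranking n d} {e : Edge (Fin n) d}
    (he : K.Descends e.1 e.2.1 e.2.2) {s : RState n d} {c : Counters n} (hs : Safe K e.1 s c) :
    ∃ s' c', STrans n d hn hd (some (s, c)) e 2 (some (s', c')) ∧ Safe K e.2.2 s' c' := by
  classical
  obtain ⟨r, hr, hf⟩ := hs
  obtain ⟨hq1, hqd⟩ := e.2.1.2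
  have hu := update_eq_upd hr e.2.1
  -- an odd priority `2 k + 1` is emitted
  have key : ∀ (k : Fin (rn n + 1)) (q : Upto (2 * rn n + 1)) (s' : RState n d) (r' : ℕ → ℕ),
      (s, e, q, s') ∈ (registerAutomaton n d hd).trans → (q : ℕ) = 2 * k.1 + 1 →
      (∀ i : Fin (rn n), r' i = s'.1 i) →
      (∀ j : Fin (rn n + 1), j < k → K.Fits n j e.2.2 r') →
      (∀ c', K.Fits (c' + 1) k e.1 r → K.Fits c' k e.2.2 r') →
      (∀ j : Fin (rn n + 1), k < j → ∀ c', K.Fits c' j e.1 r → K.Fits c' j e.2.2 r') →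
      ∃ s' c', STrans n d hn hd (some (s, c)) e 2 (some (s', c')) ∧ Safe K e.2.2 s' c' := by
    intro k q s' r' ht hq hr' h1 h2 h3
    obtain ⟨c', hc'⟩ : ∃ c', (c k : ℕ) = c' + 1 := ⟨(c k : ℕ) - 1, by have := (c k).2.1; omega⟩
    have h4 := h2 c' (hc' ▸ hf k)
    have hk : 1 < (c k : ℕ) := by have := h4.left; omega
    refine ⟨s', _, .odd s c e q s' k hk ht hq, r', hr', fun j => ?_⟩
    unfold Counters.refill Counters.decr
    rcases lt_trichotomy j k with hj | rfl | hj
    · simpa [hj] using h1 j hj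
    · simpa [hc'] using h4
    · simpa [hj.not_gt, hj.ne'] using h3 j hj _ (hf j)
  rcases Ranking.jump_or_descent he with ⟨hev, hkey⟩ | ⟨g, hlt, heq, hqg⟩
  · have hsz := K.size_pos (e.2.1 : ℕ) e.1
    set κ := Nat.log 2 (K.size (e.2.1 : ℕ) e.1) with hκ
    have hκ1 : 2 ^ κ ≤ K.size (e.2.1 : ℕ) e.1 := Nat.pow_log_le_self 2 (by omega)
    have hκ2 : K.size (e.2.1 : ℕ) e.1 < 2 ^ (κ + 1) := Nat.lt_pow_succ_log_self (by norm_num) _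
    have hκn : κ < rn n := lt_rn_of_pow_le hκ1 (K.size_le _ _)
    by_cases hall : ∀ i ≤ κ, Even (Ranking.upd r e.2.1 i)
    · refine ⟨_, _, .even s c e ⟨2 * (κ + 1), by simp; omega⟩ _ ⟨κ + 1, by omega⟩
        ⟨_, _, _, _, rfl, Or.inr (Or.inl ⟨⟨κ, hκn⟩, ?_, rfl, rfl⟩)⟩ rfl,
        _, reset_eq_rst hd hu ⟨κ, hκn⟩, fun j => ?_⟩
      · rw [← hu]; exact hall κ le_rfl
      · unfold Counters.refill
        by_cases hj : j < ⟨κ + 1, by omega⟩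
        · rw [if_pos hj]
          exact Ranking.fits_of_fresh fun i hi =>
            Ranking.rst_fresh (fun i hi => hall i (le_of_lt hi)) i (hi.trans hj)
        · rw [if_neg hj]
          exact Ranking.fits_jump_even hqd hev hkey hκ1 hκ2 hall
            (Nat.lt_of_succ_le (not_lt.1 hj)) (hf j)
    · push Not at hall
      have hex : ∃ i, i ≤ κ ∧ ¬ Even (Ranking.upd r e.2.1 i) := hall
      obtain ⟨hi1, hi2⟩ := Nat.find_spec hex
      have hi3 : ∀ i < Nat.find hex, Even (Ranking.upd r e.2.1 i) := fun i hi => by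
        by_contra h
        exact Nat.find_min hex hi ⟨by omega, h⟩
      set i₀ := Nat.find hex with hi₀
      rw [Nat.not_even_iff_odd] at hi2
      have hi0n : i₀ < rn n := by omega
      have hpow : 2 ^ i₀ ≤ K.size (e.2.1 : ℕ) e.1 :=
        (Nat.pow_le_pow_right (by norm_num) hi1).trans hκ1
      refine key ⟨i₀ + 1, by omega⟩ ⟨2 * (i₀ + 1) + 1, by simp; omega⟩ _ _
        ⟨_, _, _, _, rfl, Or.inr (Or.inr ⟨⟨i₀, hi0n⟩, ?_, rfl, rfl⟩)⟩ rfl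
        (reset_eq_rst hd hu ⟨i₀, hi0n⟩) ?_ ?_ ?_
      · rw [← hu]; exact hi2
      · intro j hj
        exact Ranking.fits_of_fresh fun i hi =>
          Ranking.rst_fresh hi3 i (hi.trans hj)
      · intro c' hc'
        exact Ranking.fits_jump_odd_self hqd hev hq1 hkey hpow hi2 hi3 hc'
      · intro j hj c' hc'
        exact Ranking.fits_jump_odd hqd hev hq1 hkey hi2 hj hc'
  · refine key 0 ⟨1, le_rfl, by omega⟩ (s.update e.2.1) _
      ⟨_, _, _, _, rfl, Or.inl ⟨rfl, rfl⟩⟩ rfl hu ?_ ?_ ?_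
    · intro j hj
      exact absurd hj (Fin.not_lt_zero j)
    · intro c' hc'
      exact Ranking.fits_descent_zero hlt hc'
    · intro j _ c' hc'
      exact Ranking.fits_descent hlt heq hqg hc'

lemma exists_run_following {α Q : Type*} {d' : ℕ} (A : ParityAutomaton α d' Q)
    {σ : List α → Q → α → Upto d' × Q} (hσ : A.IsTransitionStrategy σ) (w : ℕ → α) :
    ∃ s p, A.IsRun w s p ∧ ∀ i, (p i, s (i + 1)) = σ (pre w i) (s i) (w i) := by
  let s : ℕ → Q := fun i => Nat.rec A.init (fun i q => (σ (pre w i) q (w i)).2) i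
  exact ⟨s, fun i => (σ (pre w i) (s i) (w i)).1, ⟨rfl, fun i => hσ _ _ _⟩, fun i => rfl⟩

lemma limsupEven_of_eq_two {x : ℕ → ℕ} (hx : ∀ i, x i = 2) : LimsupEven x :=
  limsupEven_of even_two (Filter.Eventually.frequently (Filter.Eventually.of_forall hx))
    (Filter.Eventually.of_forall fun i => (hx i).le)

/-- On the plays of a positional winning strategy of Even, the safety automaton has an accepting
run that can be produced letter by letter. -/
lemma exists_transitionStrategy (hn : 0 < n) (hd : 0 < d) {G : GameGraph (Fin n) d}
    {τ : Set (Edge (Fin n) d)} (hτ : G.IsPositionalWinning .even τ) :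
    ∃ σ, (safetyAutomaton n d hn hd).IsTransitionStrategy σ ∧
      (safetyAutomaton n d hn hd).IsWinningFor σ (G.PlaysOf .even τ) := by
  classical
  obtain ⟨⟨hsub, -, huniq⟩, hwin⟩ := hτ
  have hch : ∀ u, ∃ e : Edge (Fin n) d, G.owner u = .even → e ∈ τ ∧ e.1 = u := fun u => by
    by_cases ho : G.owner u = .even
    · exact ⟨_, fun _ => (huniq u ho).choose_spec.1⟩
    · exact ⟨(G.exists_out u).choose, fun h => absurd h ho⟩
  choose f hf using hch
  obtain ⟨K, R, c, hstart, hstep⟩ := GameGraph.exists_ranking (G := G) (σ := fun _ u => f u)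
    (fun w hw => by
      obtain ⟨hp, hfol⟩ := GameGraph.play_of_consistent hw
      exact hwin w ⟨hp, fun i hi => by rw [hfol i hi]; exact (hf _ hi).1⟩)
  have hchoice : ∀ (s : SState n d) (e : Edge (Fin n) d), ∃ t : Upto 2 × SState n d,
      (s, e, t.1, t.2) ∈ (safetyAutomaton n d hn hd).trans ∧
      ∀ s₀ c₀, s = some (s₀, c₀) → Safe K e.1 s₀ c₀ → K.Descends e.1 e.2.1 e.2.2 →
        (t.1 : ℕ) = 2 ∧ ∃ s' c', t.2 = some (s', c') ∧ Safe K e.2.2 s' c' := by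
    intro s e
    by_cases h : ∃ s₀ c₀, s = some (s₀, c₀) ∧ Safe K e.1 s₀ c₀ ∧ K.Descends e.1 e.2.1 e.2.2
    · obtain ⟨s₀, c₀, rfl, h1, h2⟩ := h
      obtain ⟨s', c', h3, h4⟩ := exists_safe_step hn hd h2 h1
      exact ⟨(⟨2, by simp⟩, some (s', c')), h3, fun _ _ _ _ _ => ⟨rfl, s', c', rfl, h4⟩⟩
    · obtain ⟨p, s', hps⟩ := (safetyAutomaton n d hn hd).total s e
      exact ⟨(p, s'), hps, fun s₀ c₀ h1 h2 h3 => absurd ⟨s₀, c₀, h1, h2, h3⟩ h⟩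
  choose t ht1 ht2 using hchoice
  refine ⟨fun _ s e => t s e, fun _ s e => ht1 s e, fun w hw s p hrun hfol => ?_⟩
  obtain ⟨⟨hw0, hwe, hws⟩, hwτ⟩ := hw
  have hedge : ∀ i, G.owner (w i).1 = .even → w i = f (w i).1 := fun i hi =>
    (huniq _ hi).unique ⟨hwτ i hi, rfl⟩ (hf _ hi)
  have hinv : ∀ i, (w i).1 ∈ R ∧ ∃ s₀ c₀, s i = some (s₀, c₀) ∧ Safe K (w i).1 s₀ c₀ := by
    intro i
    induction i with
    | zero => exact ⟨hw0 ▸ hstart, _, _, hrun.1, safe_init hn hd K _⟩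
    | succ i ih =>
      obtain ⟨hR, s₀, c₀, hs, hsafe⟩ := ih
      obtain ⟨hR', hdesc⟩ := hstep _ (hwe i) hR (hedge i)
      obtain ⟨-, h2⟩ := ht2 (s i) (w i) s₀ c₀ hs hsafe hdesc
      have h3 : s (i + 1) = (t (s i) (w i)).2 := (Prod.ext_iff.1 (hfol i)).2
      rw [hws i, h3]
      exact ⟨hR', h2⟩
  refine limsupEven_of_eq_two fun i => ?_
  obtain ⟨hR, s₀, c₀, hs, hsafe⟩ := hinv i
  obtain ⟨-, hdesc⟩ := hstep _ (hwe i) hR (hedge i)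
  obtain ⟨h1, -⟩ := ht2 (s i) (w i) s₀ c₀ hs hsafe hdesc
  have : p i = _ := (Prod.ext_iff.1 (hfol i)).1
  rw [this]
  exact h1

/-! ### Words rejected by the safety automaton -/

lemma no_infinite_descent {f : ℕ → ℕ} (h1 : ∀ᶠ i in atTop, f (i + 1) ≤ f i)
    (h2 : ∃ᶠ i in atTop, f (i + 1) < f i) : False := by
  obtain ⟨N, hN⟩ := Filter.eventually_atTop.1 h1
  have hanti : ∀ i j, N ≤ i → i ≤ j → f j ≤ f i := fun i j hi hij => by
    induction j, hij using Nat.le_induction with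
    | base => exact le_rfl
    | succ k hk ih => exact (hN k (by omega)).trans ih
  have hall : ∀ m, ∃ i, N ≤ i ∧ f i + m ≤ f N := by
    intro m
    induction m with
    | zero => exact ⟨N, le_rfl, le_rfl⟩
    | succ m ih =>
      obtain ⟨i, hi, hle⟩ := ih
      obtain ⟨j, hj, hlt⟩ := Filter.frequently_atTop.1 h2 i
      have := hanti i j hi hj
      exact ⟨j + 1, by omega, by omega⟩
  obtain ⟨i, -, hi⟩ := hall (f N + 1)
  omega

lemma strans_emits {hn : 0 < n} {hd : 0 < d} {s s' : SState n d} {e : Edge (Fin n) d} {p : ℕ}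
    (h : STrans n d hn hd s e p s') :
    (s' = none → p = 1) ∧ (s' ≠ none → p = 2) ∧ (s = none → s' = none) := by
  cases h <;> simp

lemma safetyAutomaton_isSafety (hn : 0 < n) (hd : 0 < d) :
    (safetyAutomaton n d hn hd).IsSafety := by
  refine ⟨{none}, fun s e p s' h hp => ?_, fun s e p s' hs h => ?_⟩
  · obtain ⟨-, h2, -⟩ := strans_emits h
    by_contra h3
    have : (p : ℕ) = 2 := h2 h3
    omega
  · obtain ⟨h1, -, h3⟩ := strans_emits h
    exact ⟨h1 (h3 hs), h3 hs⟩

lemma not_limsupEven_of_eventually_one {x : ℕ → ℕ} (h : ∀ᶠ i in atTop, x i = 1) :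
    ¬ LimsupEven x := by
  rintro ⟨p, hp, hf, -⟩
  obtain ⟨i, hi, hi'⟩ := (hf.and_eventually h).exists
  rw [← hi, hi'] at hp
  exact absurd hp (by decide)

/-- An accepting run of the safety automaton is a run of the register automaton on which the
largest emitted priority is even. -/
lemma exists_register_run {hn : 0 < n} {hd : 0 < d} {w : ℕ → Edge (Fin n) d}
    (hacc : (safetyAutomaton n d hn hd).Accepts w) :
    ∃ (r : ℕ → RState n d) (q : ℕ → Upto (2 * rn n + 1)),
      (∀ i, (r i, w i, q i, r (i + 1)) ∈ (registerAutomaton n d hd).trans) ∧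
      ∃ k, (∃ᶠ i in atTop, (q i : ℕ) = 2 * k) ∧ ∀ᶠ i in atTop, (q i : ℕ) ≤ 2 * k := by
  obtain ⟨s, p, ⟨-, htr⟩, heven⟩ := hacc
  have htr' : ∀ i, STrans n d hn hd (s i) (w i) (p i) (s (i + 1)) := htr
  have hsome : ∀ i, s i ≠ none := by
    intro i hi
    refine not_limsupEven_of_eventually_one ?_ heven
    have hnone : ∀ j, i ≤ j → s j = none := fun j hj => by
      induction j, hj using Nat.le_induction with
      | base => exact hi
      | succ k _ ih => exact (strans_emits (htr' k)).2.2 ih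
    filter_upwards [Filter.eventually_ge_atTop i] with j hj
    exact (strans_emits (htr' j)).1 (hnone _ (by omega))
  have hex : ∀ i, ∃ x, s i = some x := fun i => Option.ne_none_iff_exists'.1 (hsome i)
  choose x hx using hex
  have hstep : ∀ i, ∃ q : Upto (2 * rn n + 1),
      ((x i).1, w i, q, (x (i + 1)).1) ∈ (registerAutomaton n d hd).trans ∧
      ∀ k : Fin (rn n + 1), ((q : ℕ) ≤ 2 * k + 1 → ((x (i + 1)).2 k : ℕ) ≤ (x i).2 k) ∧
        ((q : ℕ) = 2 * k + 1 → ((x (i + 1)).2 k : ℕ) < (x i).2 k) := by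
    intro i
    have h := htr' i
    rw [hx i, hx (i + 1)] at h
    generalize hpi : (p i : ℕ) = pi at h
    generalize hxi : x i = xi at h
    generalize hxi' : x (i + 1) = xi' at h
    cases h with
    | even s c e q s' k hq hk =>
      refine ⟨q, hq, fun k' => ⟨fun h => ?_, fun h => by omega⟩⟩
      have : ¬ k' < k := fun h' => by
        have : (k' : ℕ) < k := h'
        omega
      simp [Counters.refill, this]
    | odd s c e q s' k hk1 hq hk =>
      have hval : ∀ k' : Fin (rn n + 1), ¬ k' < k →
          (((c.decr k hk1).refill hn k) k' : ℕ) = if k' = k then (c k : ℕ) - 1 else c k' := by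
        intro k' hk'
        by_cases h : k' = k
        · subst h; simp [Counters.refill, Counters.decr]
        · simp [Counters.refill, Counters.decr, hk', h]
      refine ⟨q, hq, fun k' => ⟨fun h => ?_, fun h => ?_⟩⟩
      · have : ¬ k' < k := fun h' => by
          have : (k' : ℕ) < k := h'
          omega
        simp only [hval k' this]
        split_ifs with h2
        · subst h2; omega
        · exact le_rfl
      · obtain rfl : k' = k := Fin.ext (by omega)
        simp only [hval k' (lt_irrefl _), if_true]
        omega
  choose q hq1 hq2 using hstep
  refine ⟨fun i => (x i).1, q, hq1, ?_⟩
  obtain ⟨m, hf, he⟩ := exists_limsup (x := fun i => (q i : ℕ)) fun i => (q i).2.2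
  rcases Nat.even_or_odd' m with ⟨k, rfl | rfl⟩
  · exact ⟨k, hf, he⟩
  · exfalso
    obtain ⟨i, hi⟩ := hf.exists
    have hk : k < rn n + 1 := by
      have := (q i).2.2
      omega
    refine no_infinite_descent (f := fun i => ((x i).2 ⟨k, hk⟩ : ℕ)) ?_ ?_
    · exact he.mono fun i hi => (hq2 i ⟨k, hk⟩).1 hi
    · exact hf.mono fun i hi => (hq2 i ⟨k, hk⟩).2 hi

/-- If the largest priority emitted infinitely often by a run of the register automaton is even,
then the largest priority read infinitely often is not odd. -/
lemma not_limsupOdd_of_register_run {hd : 0 < d} {w : ℕ → Edge (Fin n) d} {r : ℕ → RState n d}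
    {q : ℕ → Upto (2 * rn n + 1)}
    (hrun : ∀ i, (r i, w i, q i, r (i + 1)) ∈ (registerAutomaton n d hd).trans) {k : ℕ}
    (hf : ∃ᶠ i in atTop, (q i : ℕ) = 2 * k) (he : ∀ᶠ i in atTop, (q i : ℕ) ≤ 2 * k) :
    ¬ LimsupOdd (prios w) := by
  intro hodd
  obtain ⟨p, hp, hpf, hpe⟩ := hodd.exists_le (prios_le w)
  obtain ⟨i₁, hi₁⟩ := hf.exists
  obtain ⟨κ, rfl⟩ : ∃ κ, k = κ + 1 := ⟨k - 1, by have := (q i₁).2.1; omega⟩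
  have hκ : κ < rn n := by have := (q i₁).2.2; omega
  obtain ⟨N, hN⟩ := Filter.eventually_atTop.1 (he.and hpe)
  let u : ℕ → RState n d := fun i => (r i).update (w i).2.1
  have hu : ∀ i x, ((u i).1 x : ℕ) = max ((r i).1 x : ℕ) (prios w i) := fun i x =>
    (Subtype.mono_coe _).map_max
  -- the possible transitions from the position `N` on
  have hstep : ∀ i, N ≤ i → r (i + 1) = u i ∨ ∃ k' : Fin (rn n), k'.1 ≤ κ ∧
      r (i + 1) = (u i).reset hd k' ∧ (k'.1 = κ → Even ((u i).1 k' : ℕ)) := by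
    intro i hi
    have hle := (hN i hi).1
    obtain ⟨s, e, q', s', heq, htr⟩ := hrun i
    obtain ⟨rfl, rfl, rfl, rfl⟩ : r i = s ∧ w i = e ∧ q i = q' ∧ r (i + 1) = s' := by
      simpa using heq
    rcases htr with ⟨-, h⟩ | ⟨k', h1, h2, h3⟩ | ⟨k', h1, h2, h3⟩
    · exact Or.inl h
    · exact Or.inr ⟨k', by omega, h3, fun _ => h1⟩
    · exact Or.inr ⟨k', by omega, h3, fun _ => by omega⟩
  have hreset : ∀ i, (q i : ℕ) = 2 * (κ + 1) → r (i + 1) = (u i).reset hd ⟨κ, hκ⟩ := by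
    intro i hi
    obtain ⟨s, e, q', s', heq, htr⟩ := hrun i
    obtain ⟨rfl, rfl, rfl, rfl⟩ : r i = s ∧ w i = e ∧ q i = q' ∧ r (i + 1) = s' := by
      simpa using heq
    rcases htr with ⟨h, -⟩ | ⟨k', -, h2, h3⟩ | ⟨k', -, h2, -⟩
    · omega
    · obtain rfl : k' = ⟨κ, hκ⟩ := Fin.ext (by simp only; omega)
      exact h3
    · omega
  have hu_le : ∀ i, N ≤ i → ∀ x, ((r i).1 x : ℕ) ≤ p → ((u i).1 x : ℕ) ≤ p := fun i hi x hx => by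
    rw [hu]; exact max_le hx (hN i hi).2
  have hp1 : 1 ≤ p := hp.pos
  -- the registers are eventually at most `p`, starting with the lowest ones
  have hsmall : ∀ m, m ≤ κ + 1 → ∃ M, N ≤ M ∧ ∀ i, M ≤ i → ∀ x : Fin (rn n), x.1 < m →
      ((r i).1 x : ℕ) ≤ p := by
    intro m
    induction m with
    | zero => exact fun _ => ⟨N, le_rfl, fun _ _ x hx => absurd hx (Nat.not_lt_zero _)⟩
    | succ m ih =>
      intro hm
      obtain ⟨M, hNM, hM⟩ := ih (by omega)
      have hmn : m < rn n := by omega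
      have hshift : ∀ i, M ≤ i → ∀ k' : Fin (rn n), m ≤ k'.1 →
          (((u i).reset hd k').1 ⟨m, hmn⟩ : ℕ) ≤ p := by
        intro i hi k' hk'
        have h1 : ¬ k' < ⟨m, hmn⟩ := not_lt.2 hk'
        simp only [RState.reset, if_neg h1]
        split_ifs with h2
        · exact hp1
        · exact hu_le i (by omega) _ (hM i hi _ (by simp only at h2 ⊢; omega))
      obtain ⟨i₀, hi₀, hi₀'⟩ := Filter.frequently_atTop.1 hf M
      have hstay : ∀ i, i₀ + 1 ≤ i → ((r i).1 ⟨m, hmn⟩ : ℕ) ≤ p := by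
        intro i hi
        induction i, hi using Nat.le_induction with
        | base => rw [hreset i₀ hi₀']; exact hshift i₀ hi₀ _ (by simp only; omega)
        | succ i hi ih =>
          rcases hstep i (by omega) with h | ⟨k', -, h, -⟩
          · rw [h]; exact hu_le i (by omega) _ ih
          · rw [h]
            by_cases h1 : k' < ⟨m, hmn⟩
            · simp only [RState.reset, if_pos h1]; exact hu_le i (by omega) _ ih
            · exact hshift i (by omega) _ (not_lt.1 h1)
      refine ⟨i₀ + 1, by omega, fun i hi x hx => ?_⟩
      rcases Nat.lt_succ_iff_lt_or_eq.1 hx with h | h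
      · exact hM i (by omega) x h
      · obtain rfl : x = ⟨m, hmn⟩ := Fin.ext h
        exact hstay i hi
  obtain ⟨M, hNM, hM⟩ := hsmall (κ + 1) le_rfl
  -- after the next occurrence of `p` the register `κ` contains `p` forever
  obtain ⟨i₀, hi₀, hi₀'⟩ := Filter.frequently_atTop.1 hpf M
  have hkeep : ∀ i, M ≤ i → ((u i).1 ⟨κ, hκ⟩ : ℕ) = p → ((r (i + 1)).1 ⟨κ, hκ⟩ : ℕ) = p := by
    intro i hi hui
    rcases hstep i (by omega) with h | ⟨k', hk', h, hev⟩
    · rw [h]; exact hui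
    · rcases hk'.lt_or_eq with hlt | heq
      · rw [h]
        have h1 : k' < ⟨κ, hκ⟩ := hlt
        simp only [RState.reset, if_pos h1]; exact hui
      · obtain rfl : k' = ⟨κ, hκ⟩ := Fin.ext heq
        exact absurd (hui ▸ hev rfl) (Nat.not_even_iff_odd.2 hp)
  have hforever : ∀ i, i₀ ≤ i → ((u i).1 ⟨κ, hκ⟩ : ℕ) = p := by
    intro i hi
    induction i, hi using Nat.le_induction with
    | base =>
      rw [hu, hi₀']
      exact max_eq_right (hM i₀ hi₀ _ (Nat.lt_succ_self κ))
    | succ i hi ih =>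
      rw [hu, hkeep i (by omega) ih]
      exact max_eq_left (hN (i + 1) (by omega)).2
  obtain ⟨i, hi, hi'⟩ := Filter.frequently_atTop.1 hf i₀
  obtain ⟨s, e, q', s', heq, htr⟩ := hrun i
  obtain ⟨rfl, rfl, rfl, rfl⟩ : r i = s ∧ w i = e ∧ q i = q' ∧ r (i + 1) = s' := by
    simpa using heq
  rcases htr with ⟨h, -⟩ | ⟨k', h1, h2, -⟩ | ⟨k', -, h2, -⟩
  · omega
  · obtain rfl : k' = ⟨κ, hκ⟩ := Fin.ext (by simp only; omega)
    exact absurd (hforever i hi ▸ h1) (Nat.not_even_iff_odd.2 hp)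
  · omega

lemma not_accepts_of_limsupOdd (hn : 0 < n) (hd : 0 < d) {w : ℕ → Edge (Fin n) d}
    (hw : LimsupOdd (prios w)) : ¬ (safetyAutomaton n d hn hd).Accepts w := fun hacc => by
  obtain ⟨r, q, hrun, k, hf, he⟩ := exists_register_run hacc
  exact not_limsupOdd_of_register_run hrun hf he hw

theorem safetyAutomaton_isStrongSFPGSeparator (hn : 0 < n) (hd : 0 < d) :
    IsStrongSFPGSeparator (safetyAutomaton n d hn hd) := by
  have hsep : IsPGSeparator (safetyAutomaton n d hn hd) := by
    refine ⟨fun w hw => ?_, fun w hw => ?_⟩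
    · obtain ⟨G, τ, hτ, hw⟩ := hw
      obtain ⟨σ, hσ, hwin⟩ := exists_transitionStrategy hn hd hτ
      obtain ⟨s, p, hrun, hfol⟩ := exists_run_following _ hσ w
      exact ⟨s, p, hrun, hwin w hw s p hrun hfol⟩
    · obtain ⟨G, τ, hτ, hw⟩ := hw
      exact not_accepts_of_limsupOdd hn hd (hτ.2 w hw)
  exact ⟨⟨hsep, fun w hw => not_accepts_of_limsupOdd hn hd hw⟩, hsep,
    fun G τ hτ => exists_transitionStrategy hn hd hτ⟩

/-! ### Safety games -/

namespace GameGraph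

variable {V : Type*} {d : ℕ}

/-- A set of nodes avoiding `bad` in which Even can keep the play. -/
def IsSafeSet (G : GameGraph V d) (bad X : Set V) : Prop :=
  (∀ u ∈ X, u ∉ bad) ∧
    (∀ u ∈ X, G.owner u = .even → ∃ e ∈ G.edges, e.1 = u ∧ e.2.2 ∈ X) ∧
    ∀ u ∈ X, G.owner u = .odd → ∀ e ∈ G.edges, e.1 = u → e.2.2 ∈ X

lemma exists_safeSet {G : GameGraph V d} {bad : Set V}
    (hbad : ∀ w, G.IsPlay w → (Wins .even w ↔ ∀ i, (w i).1 ∉ bad))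
    (hwin : G.HasWinningStrategy .even) : ∃ X, G.start ∈ X ∧ G.IsSafeSet bad X := by
  obtain ⟨σ, hσ, hwin⟩ := hwin
  refine ⟨{u | ∃ h, G.Consistent σ h ∧ G.lastNode h = u}, ⟨[], .nil, rfl⟩, ?_, ?_, ?_⟩
  · rintro u ⟨h, hc, rfl⟩ hu
    obtain ⟨w, hw, hp⟩ := hc.exists_play hσ
    obtain ⟨hplay, hfol⟩ := play_of_consistent hw
    have h1 := (hbad w hplay).1 (hwin w hplay hfol) h.length
    have h2 := hw (h.length + 1)
    rw [pre_succ, consistent_snoc_iff, hp] at h2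
    exact h1 (h2.2.2.1 ▸ hu)
  · rintro u ⟨h, hc, rfl⟩ ho
    obtain ⟨h1, h2⟩ := hσ h _ ho
    exact ⟨_, h1, h2, _, .snoc h _ hc h1 h2 fun _ => by rw [h2], by simp⟩
  · rintro u ⟨h, hc, rfl⟩ ho e he heu
    exact ⟨_, .snoc h e hc he heu fun h' => by rw [heu, ho] at h'; exact absurd h' (by simp),
      by simp⟩

lemma IsSafeSet.hasWinningStrategy {G : GameGraph V d} {bad X : Set V}
    (hbad : ∀ w, G.IsPlay w → (Wins .even w ↔ ∀ i, (w i).1 ∉ bad))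
    (hX : G.IsSafeSet bad X) (hs : G.start ∈ X) : G.HasWinningStrategy .even := by
  classical
  have hch : ∀ u, ∃ e ∈ G.edges, e.1 = u ∧ (u ∈ X → G.owner u = .even → e.2.2 ∈ X) := by
    intro u
    by_cases h : u ∈ X ∧ G.owner u = .even
    · obtain ⟨e, h1, h2, h3⟩ := hX.2.1 u h.1 h.2
      exact ⟨e, h1, h2, fun _ _ => h3⟩
    · obtain ⟨e, h1, h2⟩ := G.exists_out u
      exact ⟨e, h1, h2, fun h3 h4 => absurd ⟨h3, h4⟩ h⟩
  choose f hf1 hf2 hf3 using hch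
  refine ⟨fun _ u => f u, fun _ u _ => ⟨hf1 u, hf2 u⟩, fun w hw hfol => ?_⟩
  have hin : ∀ i, (w i).1 ∈ X := by
    intro i
    induction i with
    | zero => exact hw.1 ▸ hs
    | succ i ih =>
      rw [hw.2.2 i]
      rcases ho : G.owner (w i).1 with _ | _
      · rw [hfol i ho]; exact hf3 _ ih ho
      · exact hX.2.2 _ ih ho _ (hw.2.1 i) rfl
  exact (hbad w hw).2 fun i => hX.1 _ (hin i)

end GameGraph

/-! ### The product with the safety automaton -/

section Product

variable {n d : ℕ} (hn : 0 < n) (hd : 0 < d) (G : GameGraph (Fin n) d)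

lemma product_wins_iff (w : ℕ → Edge ((Fin n ⊕ ↥G.edges) × SState n d) 2)
    (hw : (G.product (safetyAutomaton n d hn hd)).IsPlay w) :
    Wins .even w ↔ ∀ i, (w i).1 ∉ {x : (Fin n ⊕ ↥G.edges) × SState n d | x.2 = none} := by
  obtain ⟨-, he, hs⟩ := hw
  constructor
  · intro hwin i hi
    have hnone : ∀ j, i ≤ j → (w j).1.2 = none := by
      intro j hj
      induction j, hj using Nat.le_induction with
      | base => exact hi
      | succ k _ ih =>
        rw [hs k]
        rcases he k with ⟨e, s, p, hp, heq⟩ | ⟨e, s, p, s', htr, heq⟩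
        · rw [heq] at ih ⊢; exact ih
        · rw [heq] at ih ⊢; exact (strans_emits htr).2.2 ih
    refine not_limsupEven_of_eventually_one ?_ hwin
    filter_upwards [Filter.eventually_ge_atTop i] with j hj
    have h1 := hnone (j + 1) (by omega)
    rw [hs j] at h1
    rcases he j with ⟨e, s, p, hp, heq⟩ | ⟨e, s, p, s', htr, heq⟩
    · rw [prios, heq]; exact hp
    · rw [heq] at h1
      rw [prios, heq]; exact (strans_emits htr).1 h1
  · intro hsafe
    have hle : ∀ᶠ i in atTop, prios w i ≤ 2 := Filter.Eventually.of_forall (prios_le w)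
    refine limsupEven_of even_two (Filter.frequently_atTop.2 fun N => ?_) hle
    have htwo : ∀ i e s, (w i).1 = (Sum.inr e, s) → prios w i = 2 := by
      intro i e s hi
      have h1 := hsafe (i + 1)
      rw [hs i] at h1
      rcases he i with ⟨e', s', p, hp, heq⟩ | ⟨e', s', p, s'', htr, heq⟩
      · rw [heq] at hi; simp at hi
      · rw [heq] at h1
        rw [prios, heq]; exact (strans_emits htr).2.1 h1
    rcases he N with ⟨e, s, p, hp, heq⟩ | ⟨e, s, p, s', htr, heq⟩
    · exact ⟨N + 1, by omega, htwo (N + 1) e s (by rw [hs N, heq])⟩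
    · exact ⟨N, le_rfl, htwo N e s (by rw [heq])⟩

lemma product_isSafetyGame : (G.product (safetyAutomaton n d hn hd)).IsSafetyGame :=
  ⟨_, product_wins_iff hn hd G⟩

variable {G}

lemma product_winning (hwin : G.HasWinningStrategy .even) :
    (G.product (safetyAutomaton n d hn hd)).HasWinningStrategy .even := by
  obtain ⟨σ, hσ, hwin⟩ := hwin
  obtain ⟨K, R, c, hstart, hstep⟩ := GameGraph.exists_ranking (G := G) (σ := σ) fun w hw =>
    hwin w (GameGraph.play_of_consistent hw).1 (GameGraph.play_of_consistent hw).2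
  let X : Set ((Fin n ⊕ ↥G.edges) × SState n d) := {x | ∃ s₀ c₀, x.2 = some (s₀, c₀) ∧
    match x.1 with
    | .inl v => v ∈ R ∧ Safe K v s₀ c₀
    | .inr e => e.1.2.2 ∈ R ∧ K.Descends e.1.1 e.1.2.1 e.1.2.2 ∧ Safe K e.1.1 s₀ c₀}
  refine GameGraph.IsSafeSet.hasWinningStrategy (product_wins_iff hn hd G) (X := X) ?_
    ⟨_, _, rfl, hstart, safe_init hn hd K _⟩
  refine ⟨?_, ?_, ?_⟩
  · rintro x ⟨s₀, c₀, hx, -⟩ h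
    have h' : x.2 = none := h
    rw [hx] at h'
    simp at h'
  · rintro ⟨v | e, s⟩ ⟨s₀, c₀, hx, hx'⟩ ho
    · obtain ⟨h1, h2⟩ := hσ (c v) v ho
      have h3 := hstep _ h1 (by rw [h2]; exact hx'.1) fun _ => by rw [h2]
      exact ⟨_, Or.inl ⟨⟨_, h1⟩, s, ⟨1, by simp⟩, rfl, rfl⟩, by rw [h2], s₀, c₀, hx, h3.1, h3.2,
        by rw [h2]; exact hx'.2⟩
    · obtain ⟨hR, hdesc, hsafe⟩ := hx'
      obtain ⟨s', c', htr, hs'⟩ := exists_safe_step hn hd hdesc hsafe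
      obtain rfl : s = some (s₀, c₀) := hx
      exact ⟨_, Or.inr ⟨e, _, ⟨2, by simp⟩, _, htr, rfl⟩, rfl, s', c', rfl, hR, hs'⟩
  · rintro ⟨v | e, s⟩ ⟨s₀, c₀, hx, hx'⟩ ho x hx2 hxu
    · rcases hx2 with ⟨e, s', p, hp, rfl⟩ | ⟨e, s', p, s'', htr, rfl⟩
      · obtain ⟨h1, rfl⟩ : e.1.1 = v ∧ s' = s := by simpa using hxu
        subst h1
        have h3 := hstep _ e.2 hx'.1 fun h => by
          have ho' : G.owner e.1.1 = .odd := ho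
          rw [ho'] at h; exact absurd h (by simp)
        exact ⟨s₀, c₀, hx, h3.1, h3.2, hx'.2⟩
      · simp at hxu
    · exact absurd ho (by simp [GameGraph.product])

lemma winning_of_product
    (hwin : (G.product (safetyAutomaton n d hn hd)).HasWinningStrategy .even) :
    G.HasWinningStrategy .even := by
  classical
  obtain ⟨X, hXs, hX1, hX2, hX3⟩ := GameGraph.exists_safeSet (product_wins_iff hn hd G) hwin
  have hδ : ∀ (s : SState n d) (e : Edge (Fin n) d), ∃ s', ∀ he : e ∈ G.edges,
      (Sum.inr ⟨e, he⟩, s) ∈ X → (Sum.inl e.2.2, s') ∈ X ∧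
        ∃ p, (s, e, p, s') ∈ (safetyAutomaton n d hn hd).trans := by
    intro s e
    by_cases h : ∃ he : e ∈ G.edges, (Sum.inr ⟨e, he⟩, s) ∈ X
    · obtain ⟨he, hx⟩ := h
      obtain ⟨x, hx1, hx2, hx3⟩ := hX2 _ hx rfl
      rcases hx1 with ⟨e', s', p, hp, rfl⟩ | ⟨e', s', p, s'', htr, rfl⟩
      · simp at hx2
      · obtain ⟨rfl, rfl⟩ : e' = ⟨e, he⟩ ∧ s' = s := by simpa using hx2
        exact ⟨s'', fun _ _ => ⟨hx3, p, htr⟩⟩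
    · exact ⟨s, fun he hx => absurd ⟨he, hx⟩ h⟩
  choose δ hδ using hδ
  have hch : ∀ (s : SState n d) (u : Fin n), ∃ e ∈ G.edges, e.1 = u ∧
      ((Sum.inl u, s) ∈ X → G.owner u = .even → ∀ he : e ∈ G.edges,
        (Sum.inr ⟨e, he⟩, s) ∈ X) := by
    intro s u
    by_cases h : (Sum.inl u, s) ∈ X ∧ G.owner u = .even
    · obtain ⟨x, hx1, hx2, hx3⟩ := hX2 _ h.1 h.2
      rcases hx1 with ⟨e', s', p, hp, rfl⟩ | ⟨e', s', p, s'', htr, rfl⟩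
      · obtain ⟨h1, rfl⟩ : e'.1.1 = u ∧ s' = s := by simpa using hx2
        exact ⟨e'.1, e'.2, h1, fun _ _ _ => hx3⟩
      · simp at hx2
    · obtain ⟨e, h1, h2⟩ := G.exists_out u
      exact ⟨e, h1, h2, fun h3 h4 => absurd ⟨h3, h4⟩ h⟩
  choose f hf1 hf2 hf3 using hch
  -- the strategy in `G` simulates the automaton along the history
  let st : List (Edge (Fin n) d) → SState n d :=
    fun h => h.foldl δ (safetyAutomaton n d hn hd).init
  refine ⟨fun h u => f (st h) u, fun h u _ => ⟨hf1 _ u, hf2 _ u⟩, fun w hw hfol => ?_⟩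
  have hst : ∀ i, st (pre w (i + 1)) = δ (st (pre w i)) (w i) := fun i => by
    simp [st, pre_succ]
  have hinr : ∀ i, (Sum.inl (w i).1, st (pre w i)) ∈ X →
      (Sum.inr ⟨w i, hw.2.1 i⟩, st (pre w i)) ∈ X := by
    intro i hi
    rcases ho : G.owner (w i).1 with _ | _
    · have h1 := hf3 _ _ hi ho (hf1 _ _)
      simp only [← hfol i ho] at h1
      exact h1
    · exact hX3 _ hi ho _ (Or.inl ⟨⟨w i, hw.2.1 i⟩, _, ⟨1, by simp⟩, rfl, rfl⟩) rfl
  have hin : ∀ i, (Sum.inl (w i).1, st (pre w i)) ∈ X := by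
    intro i
    induction i with
    | zero => rw [hw.1]; exact hXs
    | succ i ih =>
      rw [hst, hw.2.2 i]
      exact (hδ _ _ (hw.2.1 i) (hinr i ih)).1
  have hrun := fun i => (hδ _ _ (hw.2.1 i) (hinr i (hin i))).2
  choose p hp using hrun
  refine limsupEven_of_not_odd (prios_le w) fun hodd => not_accepts_of_limsupOdd hn hd hodd
    ⟨fun i => st (pre w i), p, ⟨rfl, fun i => by
      have h := hp i
      rw [← hst] at h
      exact h⟩, ?_⟩
  refine limsupEven_of_eq_two fun i => (strans_emits (hp i)).2.1 ?_
  rw [← hst]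
  exact hX1 _ (hin (i + 1))

end Product

/-! ### Numbers of states, nodes and edges -/

lemma card_monotone (α : Type) [LinearOrder α] [Fintype α] (k : ℕ) :
    Nat.card {r : Fin k → α // Monotone r} = (Fintype.card α + k - 1).choose k := by
  classical
  rw [← Sym.card_sym_eq_choose, ← Nat.card_eq_fintype_card]
  refine Nat.card_eq_of_bijective
    (fun r => (⟨(List.ofFn r.1 : Multiset α), by simp⟩ : Sym α k)) ⟨?_, ?_⟩
  · intro r r' h
    have h1 : (List.ofFn r.1).Perm (List.ofFn r'.1) :=
      Multiset.coe_eq_coe.1 (congrArg Subtype.val h)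
    have h2 := (List.sortedLE_ofFn_iff.2 r.2).pairwise
    have h3 := (List.sortedLE_ofFn_iff.2 r'.2).pairwise
    exact Subtype.ext (List.ofFn_injective (h1.eq_of_pairwise' h2 h3))
  · rintro ⟨m, hm⟩
    have hlen : (m.sort (· ≤ ·)).length = k := by rw [Multiset.length_sort, hm]
    subst hlen
    refine ⟨⟨(m.sort (· ≤ ·)).get, ?_⟩, Subtype.ext ?_⟩
    · exact List.sortedLE_iff_monotone_get.1
        (List.sortedLE_iff_pairwise.2 (Multiset.pairwise_sort m _))
    · change ((List.ofFn (m.sort (· ≤ ·)).get : List α) : Multiset α) = m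
      rw [List.ofFn_get, Multiset.sort_eq]

lemma card_upto (k : ℕ) : Nat.card (Upto k) = k := by
  rw [Nat.card_eq_fintype_card]; simp

lemma card_SState (n d : ℕ) : Nat.card (SState n d) = numStates n d := by
  have h1 : Nat.card (RState n d) = (rn n + d - 1).choose (rn n) := by
    rw [RState, card_monotone, ← Nat.card_eq_fintype_card, card_upto, add_comm]
  rw [SState, Finite.card_option, Nat.card_prod, h1, Counters, Nat.card_fun, card_upto,
    Nat.card_fin, numStates]

lemma numStates_le (n d : ℕ) : numStates n d ≤ d ^ rn n * n ^ (rn n + 1) + 1 := by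
  rw [← card_SState, SState, Finite.card_option, Nat.card_prod, Counters, Nat.card_fun, card_upto,
    Nat.card_fin]
  have h1 : Nat.card (RState n d) ≤ Nat.card (Fin (rn n) → Upto d) :=
    Nat.card_le_card_of_injective _ Subtype.val_injective
  rw [Nat.card_fun, card_upto, Nat.card_fin] at h1
  gcongr

lemma card_product_nodes {n d : ℕ} (G : GameGraph (Fin n) d) :
    Nat.card ((Fin n ⊕ ↥G.edges) × SState n d) = (n + G.edges.ncard) * numStates n d := by
  rw [Nat.card_prod, Nat.card_sum, Nat.card_fin, card_SState, Nat.card_coe_set_eq]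

section Edges

variable {n d : ℕ} (hn : 0 < n) (hd : 0 < d)

open Classical in
/-- The transitions of the register automaton from a state, numbered by the register that is
reset. -/
noncomputable def registerTrans (s : RState n d) (p : Upto d) : Option (Fin (rn n)) → ℕ × RState n d
  | none => (1, s.update p)
  | some k => (if Even ((s.update p).1 k : ℕ) then 2 * (k.1 + 1) else 2 * (k.1 + 1) + 1,
      (s.update p).reset hd k)

lemma exists_registerTrans {s s' : RState n d} {e : Edge (Fin n) d} {q : Upto (2 * rn n + 1)}
    (h : (s, e, q, s') ∈ (registerAutomaton n d hd).trans) :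
    ∃ o, registerTrans hd s e.2.1 o = ((q : ℕ), s') := by
  obtain ⟨s₁, e₁, q₁, s₁', heq, htr⟩ := h
  obtain ⟨rfl, rfl, rfl, rfl⟩ : s = s₁ ∧ e = e₁ ∧ q = q₁ ∧ s' = s₁' := by simpa using heq
  rcases htr with ⟨h1, h2⟩ | ⟨k, h1, h2, h3⟩ | ⟨k, h1, h2, h3⟩
  · exact ⟨none, by rw [registerTrans, h1, h2]⟩
  · exact ⟨some k, by rw [registerTrans, if_pos h1, h2, h3]⟩
  · exact ⟨some k, by rw [registerTrans, if_neg (Nat.not_even_iff_odd.2 h1), h2, h3]⟩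

/-- The target state of the transition of the safety automaton that belongs to a transition of the
register automaton emitting `q`. -/
def safetyTarget (c : Counters n) (q : ℕ) (s' : RState n d) : SState n d :=
  if h : q / 2 < rn n + 1 then
    if q % 2 = 0 then some (s', c.refill hn ⟨q / 2, h⟩)
    else if hk : 1 < (c ⟨q / 2, h⟩ : ℕ) then some (s', (c.decr _ hk).refill hn ⟨q / 2, h⟩)
    else none
  else none

section safetyTarget

variable {hn} {c : Counters n} {q : ℕ} {s' : RState n d} (k : Fin (rn n + 1))

lemma safetyTarget_even (hq : q = 2 * k.1) :
    safetyTarget hn c q s' = some (s', c.refill hn k) := by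
  obtain ⟨k, hk⟩ := k
  obtain rfl : k = q / 2 := by simp only at hq; omega
  rw [safetyTarget, dif_pos hk, if_pos (by simp only at hq; omega)]

lemma safetyTarget_odd (hq : q = 2 * k.1 + 1) (hk1 : 1 < (c k : ℕ)) :
    safetyTarget hn c q s' = some (s', (c.decr k hk1).refill hn k) := by
  obtain ⟨k, hk⟩ := k
  obtain rfl : k = q / 2 := by simp only at hq; omega
  rw [safetyTarget, dif_pos hk, if_neg (by simp only at hq; omega), dif_pos hk1]

lemma safetyTarget_reject (hq : q = 2 * k.1 + 1) (hk1 : (c k : ℕ) = 1) :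
    safetyTarget hn c q s' = none := by
  obtain ⟨k, hk⟩ := k
  obtain rfl : k = q / 2 := by simp only at hq; omega
  rw [safetyTarget, dif_pos hk, if_neg (by simp only at hq; omega), dif_neg (by omega)]

end safetyTarget

/-- The transitions of the safety automaton from a state, numbered by the register that is
reset. -/
noncomputable def safetyTrans (s : SState n d) (p : Upto d) (o : Option (Fin (rn n))) :
    SState n d :=
  match s with
  | none => none
  | some (s, c) => safetyTarget hn c (registerTrans hd s p o).1 (registerTrans hd s p o).2

lemma exists_safetyTrans {s s' : SState n d} {e : Edge (Fin n) d} {p : ℕ}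
    (h : STrans n d hn hd s e p s') : ∃ o, safetyTrans hn hd s e.2.1 o = s' := by
  cases h with
  | even s c e q s' k hq hk =>
    obtain ⟨o, ho⟩ := exists_registerTrans hd hq
    exact ⟨o, by rw [safetyTrans, ho, safetyTarget_even k hk]⟩
  | odd s c e q s' k hk1 hq hk =>
    obtain ⟨o, ho⟩ := exists_registerTrans hd hq
    exact ⟨o, by rw [safetyTrans, ho, safetyTarget_odd k hk hk1]⟩
  | reject s c e q s' k hq hk hk1 =>
    obtain ⟨o, ho⟩ := exists_registerTrans hd hq
    exact ⟨o, by rw [safetyTrans, ho, safetyTarget_reject k hk hk1]⟩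
  | sink e => exact ⟨none, rfl⟩

lemma product_edges_ncard_le (G : GameGraph (Fin n) d) :
    (G.product (safetyAutomaton n d hn hd)).edges.ncard ≤
      G.edges.ncard * numStates n d * (rn n + 2) := by
  classical
  let f : (↥G.edges × SState n d) ⊕ (↥G.edges × SState n d × Option (Fin (rn n))) →
      Edge ((Fin n ⊕ ↥G.edges) × SState n d) 2 := fun x =>
    match x with
    | .inl (e, s) => ((.inl e.1.1, s), ⟨1, by simp⟩, (.inr e, s))
    | .inr (e, s, o) => ((.inr e, s),
        if safetyTrans hn hd s e.1.2.1 o = none then ⟨1, by simp⟩ else ⟨2, by simp⟩,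
        (.inl e.1.2.2, safetyTrans hn hd s e.1.2.1 o))
  have hsub : (G.product (safetyAutomaton n d hn hd)).edges ⊆ Set.range f := by
    rintro x (⟨e, s, p, hp, rfl⟩ | ⟨e, s, p, s', htr, rfl⟩)
    · refine ⟨.inl (e, s), ?_⟩
      obtain rfl : p = ⟨1, by simp⟩ := Subtype.ext hp
      rfl
    · obtain ⟨o, ho⟩ := exists_safetyTrans hn hd htr
      obtain ⟨h1, h2, -⟩ := strans_emits htr
      refine ⟨.inr (e, s, o), ?_⟩
      simp only [f, ho]
      congr 2
      by_cases h : s' = none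
      · rw [if_pos h]; exact Subtype.ext (h1 h).symm
      · rw [if_neg h]; exact Subtype.ext (h2 h).symm
  calc (G.product (safetyAutomaton n d hn hd)).edges.ncard ≤ (Set.range f).ncard :=
        Set.ncard_le_ncard hsub (Set.finite_range f)
    _ ≤ Nat.card ((↥G.edges × SState n d) ⊕ (↥G.edges × SState n d × Option (Fin (rn n)))) := by
        rw [← Nat.card_coe_set_eq]; exact Finite.card_range_le f
    _ = G.edges.ncard * numStates n d * (rn n + 2) := by
        rw [Nat.card_sum, Nat.card_prod, Nat.card_prod, Nat.card_prod,
          Finite.card_option (α := Fin (rn n)), card_SState, Nat.card_fin, Nat.card_coe_set_eq]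
        ring

end Edges

lemma card_edge (n d : ℕ) : Nat.card (Edge (Fin n) d) = n * (d * n) := by
  rw [Edge, Nat.card_prod, Nat.card_prod, Nat.card_fin, card_upto]

lemma edges_ncard_le {n d : ℕ} (E : Set (Edge (Fin n) d)) : E.ncard ≤ n * (d * n) := by
  rw [← card_edge]; exact Set.ncard_le_card E

theorem product_size_le {n d : ℕ} (hn : 0 < n) (hd : 0 < d) (heven : Even d) (hdn : d ≤ n)
    (G : GameGraph (Fin n) d) :
    Nat.card ((Fin n ⊕ ↥G.edges) × SState n d) +
      (G.product (safetyAutomaton n d hn hd)).edges.ncard ≤ 12 * n ^ (12 * Nat.log 2 n) := by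
  have hd2 : 2 ≤ d := by
    obtain ⟨k, rfl⟩ := heven
    omega
  have hn2 : 2 ≤ n := hd2.trans hdn
  have hL : 1 ≤ Nat.log 2 n := Nat.log_pos (by norm_num) hn2
  have hLn : Nat.log 2 n < n := Nat.log_lt_self 2 (by omega)
  set L := Nat.log 2 n with hLdef
  have hpow : ∀ k, 1 ≤ n ^ k := fun k => Nat.one_le_pow _ _ hn
  have hm : G.edges.ncard ≤ n ^ 3 :=
    (edges_ncard_le G.edges).trans (by calc n * (d * n) ≤ n * (n * n) := by gcongr
      _ = n ^ 3 := by ring)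
  have hrn : rn n = 1 + L := rfl
  have hxi : numStates n d ≤ n ^ (6 * L) := by
    calc numStates n d ≤ d ^ rn n * n ^ (rn n + 1) + 1 := numStates_le n d
      _ ≤ n ^ rn n * n ^ (rn n + 1) + 1 := by gcongr
      _ = n ^ (2 * L + 3) + 1 := by rw [hrn, ← pow_add]; congr 2; ring
      _ ≤ n ^ (2 * L + 3) + n ^ (2 * L + 3) := by gcongr; exact hpow _
      _ = 2 * n ^ (2 * L + 3) := by ring
      _ ≤ n * n ^ (2 * L + 3) := by gcongr
      _ = n ^ (2 * L + 4) := by ring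
      _ ≤ n ^ (6 * L) := Nat.pow_le_pow_right hn (by omega)
  have hr2 : rn n + 2 ≤ n ^ 2 := by
    have : rn n + 2 ≤ n + 2 := by omega
    nlinarith
  have hnn : n ≤ n ^ 3 := by
    calc n = n ^ 1 := (pow_one n).symm
      _ ≤ n ^ 3 := Nat.pow_le_pow_right hn (by norm_num)
  rw [card_product_nodes]
  calc (n + G.edges.ncard) * numStates n d +
        (G.product (safetyAutomaton n d hn hd)).edges.ncard
      ≤ (n + G.edges.ncard) * numStates n d +
        G.edges.ncard * numStates n d * (rn n + 2) := by
        gcongr; exact product_edges_ncard_le hn hd G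
    _ ≤ (n ^ 3 + n ^ 3) * n ^ (6 * L) + n ^ 3 * n ^ (6 * L) * n ^ 2 := by gcongr
    _ = 2 * n ^ (6 * L + 3) + n ^ (6 * L + 5) := by ring
    _ ≤ 2 * n ^ (12 * L) + n ^ (12 * L) := by
        gcongr <;> first | exact hn | omega
    _ ≤ 12 * n ^ (12 * L) := by omega

/-! ### A universal ordered tree -/

/-- The digits of a vector are cut at the first digit that differs from `d` by at most `p`. -/
def cutAt (d p : ℕ) : List ℕ → List ℕ
  | [] => []
  | a :: l => if d ≤ a + p ∧ a ≤ d + p then [d] else a :: cutAt d p l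

/-- The number with the given digits in base `B`, the most significant digit first. -/
def val (B : ℕ) : List ℕ → ℕ
  | [] => 0
  | a :: l => a * B ^ l.length + val B l

lemma val_cons (B a : ℕ) (l : List ℕ) : val B (a :: l) = a * B ^ l.length + val B l := rfl

lemma val_lt {B : ℕ} {l : List ℕ} (h : ∀ a ∈ l, a < B) : val B l < B ^ l.length := by
  induction l with
  | nil => simp [val]
  | cons a l ih =>
    have h1 := ih fun b hb => h b (List.mem_cons_of_mem _ hb)
    have h2 : a + 1 ≤ B := h a List.mem_cons_self
    calc a * B ^ l.length + val B l < a * B ^ l.length + B ^ l.length := by gcongr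
      _ = (a + 1) * B ^ l.length := by ring
      _ ≤ B * B ^ l.length := by gcongr
      _ = B ^ (a :: l).length := by rw [List.length_cons, pow_succ, mul_comm]

lemma val_append (B : ℕ) (l l' : List ℕ) :
    val B (l ++ l') = val B l * B ^ l'.length + val B l' := by
  induction l with
  | nil => simp [val]
  | cons a l ih =>
    rw [List.cons_append, val, ih, val, List.length_append, pow_add]
    ring

lemma val_replicate_zero (B k : ℕ) : val B (List.replicate k 0) = 0 := by
  induction k with
  | zero => rfl
  | succ k ih => rw [List.replicate_succ, val, ih, zero_mul]

lemma val_replicate_max (b k : ℕ) : val (b + 1) (List.replicate k b) + 1 = (b + 1) ^ k := by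
  induction k with
  | zero => rfl
  | succ k ih =>
    rw [List.replicate_succ, val, List.length_replicate, add_assoc, ih]
    ring

lemma val_increment (b a k : ℕ) (l : List ℕ) :
    val (b + 1) (l ++ (a + 1) :: List.replicate k 0) =
      val (b + 1) (l ++ a :: List.replicate k b) + 1 := by
  have := val_replicate_max b k
  rw [val_append, val_append, val, val, val_replicate_zero]
  simp only [List.length_cons, List.length_replicate]
  rw [← this]
  ring

lemma cons_le_cons {a : ℕ} {l l' : List ℕ} (h : l ≤ l') : a :: l ≤ a :: l' :=
  not_lt.1 fun hlt => by
    rcases List.cons_lt_cons_iff.1 hlt with h1 | ⟨-, h1⟩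
    · exact lt_irrefl _ h1
    · exact not_lt.2 h h1

lemma cutAt_cons_eq {d p a : ℕ} {l : List ℕ} (h : d ≤ a + p ∧ a ≤ d + p) :
    cutAt d p (a :: l) = [d] := by rw [cutAt, if_pos h]

lemma cutAt_cons_ne {d p a : ℕ} {l : List ℕ} (h : ¬ (d ≤ a + p ∧ a ≤ d + p)) :
    cutAt d p (a :: l) = a :: cutAt d p l := by rw [cutAt, if_neg h]

lemma cutAt_cons_lt_cons {d p a b : ℕ} {l l' : List ℕ} (hab : a < b)
    (h : ¬ ((d ≤ a + p ∧ a ≤ d + p) ∧ (d ≤ b + p ∧ b ≤ d + p))) :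
    cutAt d p (a :: l) < cutAt d p (b :: l') := by
  by_cases h1 : d ≤ a + p ∧ a ≤ d + p
  · rw [cutAt_cons_eq h1, cutAt_cons_ne fun h2 => h ⟨h1, h2⟩]
    exact List.cons_lt_cons_iff.2 (Or.inl (by omega))
  · rw [cutAt_cons_ne h1]
    by_cases h2 : d ≤ b + p ∧ b ≤ d + p
    · rw [cutAt_cons_eq h2]
      exact List.cons_lt_cons_iff.2 (Or.inl (by omega))
    · rw [cutAt_cons_ne h2]
      exact List.cons_lt_cons_iff.2 (Or.inl hab)

/-- Cutting is monotone; the bound on the digits is not needed for the leading ones. -/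
lemma cutAt_mono {B d p a b : ℕ} {l l' : List ℕ} (hlen : l.length = l'.length)
    (hl : ∀ x ∈ l, x < B) (hl' : ∀ x ∈ l', x < B) (h : val B (a :: l) ≤ val B (b :: l')) :
    cutAt d p (a :: l) ≤ cutAt d p (b :: l') := by
  induction l generalizing a b l' with
  | nil =>
    obtain rfl : l' = [] := List.length_eq_zero_iff.1 hlen.symm
    have hab : a ≤ b := by simpa [val] using h
    rcases hab.lt_or_eq with hab | rfl
    · by_cases h1 : (d ≤ a + p ∧ a ≤ d + p) ∧ (d ≤ b + p ∧ b ≤ d + p)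
      · rw [cutAt_cons_eq h1.1, cutAt_cons_eq h1.2]
      · exact (cutAt_cons_lt_cons hab h1).le
    · exact le_rfl
  | cons x l ih =>
    obtain ⟨y, l', rfl⟩ : ∃ y l'', l' = y :: l'' := by
      cases l' with
      | nil => simp at hlen
      | cons y l'' => exact ⟨y, l'', rfl⟩
    have hv := val_lt hl
    have hv' := val_lt hl'
    have hab : a ≤ b := by
      by_contra hba
      have h1 : (b + 1) * B ^ (x :: l).length ≤ a * B ^ (x :: l).length :=
        Nat.mul_le_mul_right _ (by omega)
      rw [val_cons, val_cons B b, ← hlen] at h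
      rw [← hlen] at hv'
      nlinarith
    rcases hab.lt_or_eq with hab | rfl
    · by_cases h1 : (d ≤ a + p ∧ a ≤ d + p) ∧ (d ≤ b + p ∧ b ≤ d + p)
      · rw [cutAt_cons_eq h1.1, cutAt_cons_eq h1.2]
      · exact (cutAt_cons_lt_cons hab h1).le
    · by_cases h1 : d ≤ a + p ∧ a ≤ d + p
      · rw [cutAt_cons_eq h1, cutAt_cons_eq h1]
      · rw [cutAt_cons_ne h1, cutAt_cons_ne h1]
        rw [val_cons, val_cons B a (y :: l'), ← hlen] at h
        exact cons_le_cons (ih (a := x) (b := y) (by simpa using hlen)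
          (fun z hz => hl z (List.mem_cons_of_mem _ hz))
          (fun z hz => hl' z (List.mem_cons_of_mem _ hz)) (by omega))

/-- A smaller cut distinguishes more vectors. -/
lemma cutAt_lt_of_le {d p q : ℕ} (hqp : q ≤ p) {l l' : List ℕ} (hlen : l.length = l'.length)
    (h : cutAt d p l < cutAt d p l') : cutAt d q l < cutAt d q l' := by
  induction l generalizing l' with
  | nil =>
    obtain rfl : l' = [] := List.length_eq_zero_iff.1 hlen.symm
    exact h
  | cons a l ih =>
    obtain ⟨b, l', rfl⟩ : ∃ y l'', l' = y :: l'' := by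
      cases l' with
      | nil => simp at hlen
      | cons y l'' => exact ⟨y, l'', rfl⟩
    by_cases h1 : d ≤ a + p ∧ a ≤ d + p
    · rw [cutAt_cons_eq h1] at h
      by_cases h2 : d ≤ b + p ∧ b ≤ d + p
      · rw [cutAt_cons_eq h2] at h
        exact absurd h (lt_irrefl _)
      · rw [cutAt_cons_ne h2] at h
        rcases List.cons_lt_cons_iff.1 h with h3 | ⟨h3, -⟩
        · exact cutAt_cons_lt_cons (by omega) (by omega)
        · omega
    · rw [cutAt_cons_ne h1] at h
      by_cases h2 : d ≤ b + p ∧ b ≤ d + p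
      · rw [cutAt_cons_eq h2] at h
        rcases List.cons_lt_cons_iff.1 h with h3 | ⟨h3, -⟩
        · exact cutAt_cons_lt_cons (by omega) (by omega)
        · omega
      · rw [cutAt_cons_ne h2] at h
        rcases List.cons_lt_cons_iff.1 h with h3 | ⟨rfl, h3⟩
        · exact cutAt_cons_lt_cons h3 (by omega)
        · rw [cutAt_cons_ne (by omega), cutAt_cons_ne (by omega)]
          exact List.cons_lt_cons_iff.2 (Or.inr ⟨rfl, ih (by simpa using hlen) h3⟩)

lemma cutAt_of_near {d p : ℕ} {l : List ℕ} (hl : l ≠ []) (h : ∀ a ∈ l, d ≤ a + p ∧ a ≤ d + p) :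
    cutAt d p l = [d] := by
  cases l with
  | nil => exact absurd rfl hl
  | cons a l => exact cutAt_cons_eq (h a List.mem_cons_self)

/-- In a set of less than `2 ^ (L + 1)` elements there is a median. -/
lemma exists_median {α β : Type*} [LinearOrder β] (A : Finset α) (f : α → β) {L : ℕ}
    (hne : A.Nonempty) (hA : A.card < 2 ^ (L + 1)) :
    ∃ m ∈ A, (A.filter fun x => f x < f m).card < 2 ^ L ∧
      (A.filter fun x => f m < f x).card < 2 ^ L := by
  classical
  obtain ⟨m₀, hm₀, hmin₀⟩ := A.exists_min_image f hne
  have h0 : m₀ ∈ A.filter fun m => (A.filter fun x => f x < f m).card < 2 ^ L := by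
    rw [Finset.mem_filter, Finset.filter_false_of_mem fun x hx => not_lt.2 (hmin₀ x hx)]
    exact ⟨hm₀, by positivity⟩
  obtain ⟨m, hm, hmax⟩ := (A.filter fun m => (A.filter fun x => f x < f m).card < 2 ^ L)
    |>.exists_max_image f ⟨_, h0⟩
  rw [Finset.mem_filter] at hm
  refine ⟨m, hm.1, hm.2, ?_⟩
  rcases (A.filter fun x => f m < f x).eq_empty_or_nonempty with he | hne'
  · rw [he]; positivity
  · obtain ⟨m', hm', hmin'⟩ := Finset.exists_min_image _ f hne'
    rw [Finset.mem_filter] at hm'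
    have h1 : 2 ^ L ≤ (A.filter fun x => f x < f m').card := by
      by_contra h
      exact absurd (hmax m' (Finset.mem_filter.2 ⟨hm'.1, not_le.1 h⟩)) (not_le.2 hm'.2)
    have h2 : Disjoint (A.filter fun x => f x < f m') (A.filter fun x => f m < f x) := by
      rw [Finset.disjoint_left]
      intro x hx hx'
      exact absurd (Finset.mem_filter.1 hx).2 (not_lt.2 (hmin' x hx'))
    have h3 : (A.filter fun x => f x < f m').card + (A.filter fun x => f m < f x).card ≤
        A.card := by
      rw [← Finset.card_union_of_disjoint h2]
      exact Finset.card_le_card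
        (Finset.union_subset (Finset.filter_subset _ _) (Finset.filter_subset _ _))
    rw [pow_succ] at hA
    omega

/-- Every ranking of less than `2 ^ L` nodes embeds into the tree of the vectors of length `L` with
digits up to `2 d`.  A digit `d - h` or `d + h` leads to the left or to the right of the median
child at the level `h`. -/
lemma Ranking.exists_embedding {n d : ℕ} (K : Ranking n d) (h : ℕ) (hd : h ≤ d) (L : ℕ)
    (A : Finset (Fin n)) (hA : A.card < 2 ^ L) (heq : ∀ x ∈ A, ∀ y ∈ A, K.key h x = K.key h y) :
    ∃ φ : Fin n → List ℕ,
      (∀ x ∈ A, (φ x).length = L ∧ ∀ a ∈ φ x, d ≤ a + h ∧ a ≤ d + h) ∧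
      ∀ x ∈ A, ∀ y ∈ A, ∀ p, (K.key p x < K.key p y → cutAt d p (φ x) < cutAt d p (φ y)) ∧
        (K.key p x = K.key p y → cutAt d p (φ x) = cutAt d p (φ y)) := by
  classical
  induction h generalizing L A with
  | zero =>
    refine ⟨fun _ => List.replicate L d, fun x _ => ⟨by simp, fun a ha => ?_⟩,
      fun x hx y hy p => ⟨fun hlt => ?_, fun _ => rfl⟩⟩
    · rw [List.eq_of_mem_replicate ha]; simp
    · exact absurd (K.key_lt (Nat.zero_le p) hlt) (heq x hx y hy).not_lt
  | succ h ihh =>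
    induction L generalizing A with
    | zero =>
      obtain rfl : A = ∅ := Finset.card_eq_zero.1 (by simpa using hA)
      exact ⟨fun _ => [], by simp, by simp⟩
    | succ L ihL =>
      rcases A.eq_empty_or_nonempty with rfl | hne
      · exact ⟨fun _ => [], by simp, by simp⟩
      obtain ⟨m, hm, hl, hr⟩ := exists_median A (K.key h) hne hA
      obtain ⟨φl, hl1, hl2⟩ := ihL _ hl fun x hx y hy =>
        heq x (Finset.mem_filter.1 hx).1 y (Finset.mem_filter.1 hy).1
      obtain ⟨φr, hr1, hr2⟩ := ihL _ hr fun x hx y hy =>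
        heq x (Finset.mem_filter.1 hx).1 y (Finset.mem_filter.1 hy).1
      obtain ⟨φm, hm1, hm2⟩ := ihh (by omega) (L + 1) (A.filter fun x => K.key h x = K.key h m)
        ((Finset.card_filter_le _ _).trans_lt hA) fun x hx y hy => by
          rw [(Finset.mem_filter.1 hx).2, (Finset.mem_filter.1 hy).2]
      simp only [Finset.mem_filter, and_imp] at hl1 hl2 hr1 hr2 hm1 hm2
      let φ : Fin n → List ℕ := fun x => if K.key h x < K.key h m then (d - (h + 1)) :: φl x
        else if K.key h m < K.key h x then (d + (h + 1)) :: φr x else φm x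
      have φ_l : ∀ x, K.key h x < K.key h m → φ x = (d - (h + 1)) :: φl x := fun x hx => if_pos hx
      have φ_r : ∀ x, K.key h m < K.key h x → φ x = (d + (h + 1)) :: φr x := fun x hx => by
        simp only [φ, if_neg hx.not_gt, if_pos hx]
      have φ_m : ∀ x, K.key h x = K.key h m → φ x = φm x := fun x hx => by
        simp only [φ, hx, lt_irrefl, if_false]
      have hφ : ∀ x ∈ A, (φ x).length = L + 1 ∧ ∀ a ∈ φ x, d ≤ a + (h + 1) ∧ a ≤ d + (h + 1) := by
        intro x hx
        rcases lt_trichotomy (K.key h x) (K.key h m) with hxm | hxm | hxm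
        · obtain ⟨h1, h2⟩ := hl1 x hx hxm
          rw [φ_l x hxm]
          refine ⟨by simp [h1], fun a ha => ?_⟩
          rcases List.mem_cons.1 ha with rfl | ha
          · omega
          · exact h2 a ha
        · obtain ⟨h1, h2⟩ := hm1 x hx hxm
          rw [φ_m x hxm]
          exact ⟨h1, fun a ha => by have := h2 a ha; omega⟩
        · obtain ⟨h1, h2⟩ := hr1 x hx hxm
          rw [φ_r x hxm]
          refine ⟨by simp [h1], fun a ha => ?_⟩
          rcases List.mem_cons.1 ha with rfl | ha
          · omega
          · exact h2 a ha
      have hmid : ∀ x ∈ A, K.key h x = K.key h m → ∃ b l,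
          φm x = b :: l ∧ d ≤ b + h ∧ b ≤ d + h := by
        intro x hx hxm
        obtain ⟨h1, h2⟩ := hm1 x hx hxm
        obtain ⟨b, l, hbl⟩ := List.exists_cons_of_length_eq_add_one h1
        exact ⟨b, l, hbl, h2 b (by rw [hbl]; exact List.mem_cons_self)⟩
      -- nodes in different parts are ordered by the leading digits
      have hparts : ∀ x ∈ A, ∀ y ∈ A, ∀ p ≤ h, K.key h x < K.key h y →
          (K.key h x < K.key h m ∨ K.key h m < K.key h y) →
          (K.key h x < K.key h m → K.key h m ≤ K.key h y) →
          (K.key h m < K.key h y → K.key h x ≤ K.key h m) →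
          cutAt d p (φ x) < cutAt d p (φ y) := by
        intro x hx y hy p hp hxy h1 h2 h3
        rcases lt_trichotomy (K.key h x) (K.key h m) with hxm | hxm | hxm
        · rw [φ_l x hxm]
          rcases (h2 hxm).lt_or_eq with hym | hym
          · rw [φ_r y hym]; exact cutAt_cons_lt_cons (by omega) (by omega)
          · obtain ⟨b, l, hbl, hb1, hb2⟩ := hmid y hy hym.symm
            rw [φ_m y hym.symm, hbl]; exact cutAt_cons_lt_cons (by omega) (by omega)
        · rcases h1 with h1 | h1
          · exact absurd hxm h1.ne
          · obtain ⟨b, l, hbl, hb1, hb2⟩ := hmid x hx hxm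
            rw [φ_m x hxm, hbl, φ_r y h1]; exact cutAt_cons_lt_cons (by omega) (by omega)
        · exact absurd (h3 (hxm.trans hxy)) (not_le.2 hxm)
      refine ⟨φ, hφ, fun x hx y hy p => ?_⟩
      rcases lt_or_ge h p with hp | hp
      · have hkey := K.key_eq hp (heq x hx y hy)
        refine ⟨fun hlt => absurd hkey hlt.ne, fun _ => ?_⟩
        have hcut : ∀ z ∈ A, cutAt d p (φ z) = [d] := fun z hz =>
          cutAt_of_near (List.ne_nil_of_length_pos (by rw [(hφ z hz).1]; omega))
            fun a ha => by have := (hφ z hz).2 a ha; omega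
        rw [hcut x hx, hcut y hy]
      · have hn1 : ¬ (d ≤ d - (h + 1) + p ∧ d - (h + 1) ≤ d + p) := by omega
        have hn2 : ¬ (d ≤ d + (h + 1) + p ∧ d + (h + 1) ≤ d + p) := by omega
        have hlt' : K.key h x < K.key h y → K.key p x < K.key p y := K.key_lt hp
        have hgt' : K.key h y < K.key h x → K.key p y < K.key p x := K.key_lt hp
        rcases lt_trichotomy (K.key h x) (K.key h m) with hxm | hxm | hxm <;>
        rcases lt_trichotomy (K.key h y) (K.key h m) with hym | hym | hym
        · rw [φ_l x hxm, φ_l y hym, cutAt_cons_ne hn1, cutAt_cons_ne hn1]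
          obtain ⟨h1, h2⟩ := hl2 x hx hxm y hy hym p
          exact ⟨fun h => List.cons_lt_cons_iff.2 (Or.inr ⟨rfl, h1 h⟩), fun h => by rw [h2 h]⟩
        · have hxy := hxm.trans_eq hym.symm
          exact ⟨fun _ => hparts x hx y hy p hp hxy (Or.inl hxm) (fun _ => hym.ge) fun _ => hxm.le,
            fun h => absurd h (hlt' hxy).ne⟩
        · have hxy := hxm.trans hym
          exact ⟨fun _ => hparts x hx y hy p hp hxy (Or.inl hxm) (fun _ => hym.le) fun _ => hxm.le,
            fun h => absurd h (hlt' hxy).ne⟩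
        · have hxy := hgt' (hym.trans_eq hxm.symm)
          exact ⟨fun h => absurd h hxy.not_gt, fun h => absurd h hxy.ne'⟩
        · rw [φ_m x hxm, φ_m y hym]
          exact hm2 x hx hxm y hy hym p
        · have hxy := hxm.trans_lt hym
          exact ⟨fun _ => hparts x hx y hy p hp hxy (Or.inr hym) (fun _ => hym.le) fun _ => hxm.le,
            fun h => absurd h (hlt' hxy).ne⟩
        · have hxy := hgt' (hym.trans hxm)
          exact ⟨fun h => absurd h hxy.not_gt, fun h => absurd h hxy.ne'⟩
        · have hxy := hgt' (hym.trans_lt hxm)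
          exact ⟨fun h => absurd h hxy.not_gt, fun h => absurd h hxy.ne'⟩
        · rw [φ_r x hxm, φ_r y hym, cutAt_cons_ne hn2, cutAt_cons_ne hn2]
          obtain ⟨h1, h2⟩ := hr2 x hx hxm y hy hym p
          exact ⟨fun h => List.cons_lt_cons_iff.2 (Or.inr ⟨rfl, h1 h⟩), fun h => by rw [h2 h]⟩

/-! ### Lifting progress measures -/

/-- The condition of a progress measure for an edge with priority `p`, where `x` and `y` are the
vectors of its source and of its target. -/
def SatEdge (d p : ℕ) (x y : List ℕ) : Prop :=
  if Even p then cutAt d p y ≤ cutAt d p x else cutAt d (p - 1) y < cutAt d (p - 1) x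

/-- A vector of `L` digits up to `2 d`, preceded by the digit `2 d + 1`, or by `2 d + 2` for the
vectors that mean `⊤`. -/
def IsVec (d L : ℕ) (x : List ℕ) : Prop :=
  ∃ a l, x = a :: l ∧ (a = 2 * d + 1 ∨ a = 2 * d + 2) ∧ l.length = L ∧ ∀ b ∈ l, b < 2 * d + 1

/-- The vectors other than `⊤`. -/
def IsLow (d : ℕ) (x : List ℕ) : Prop := x.head? = some (2 * d + 1)

lemma IsVec.length {d L : ℕ} {x : List ℕ} (h : IsVec d L x) : x.length = L + 1 := by
  obtain ⟨a, l, rfl, -, hl, -⟩ := h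
  simp [hl]

lemma IsVec.cutAt_mono {d L p : ℕ} {x y : List ℕ} (hx : IsVec d L x) (hy : IsVec d L y)
    (h : val (2 * d + 1) x ≤ val (2 * d + 1) y) : cutAt d p x ≤ cutAt d p y := by
  obtain ⟨a, l, rfl, -, hl, hlb⟩ := hx
  obtain ⟨b, l', rfl, -, hl', hlb'⟩ := hy
  exact ParityGames.cutAt_mono (hl.trans hl'.symm) hlb hlb' h

lemma IsVec.val_lt {d L : ℕ} {x : List ℕ} (h : IsVec d L x) :
    val (2 * d + 1) x < (2 * d + 3) * (2 * d + 1) ^ L := by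
  obtain ⟨a, l, rfl, ha, hl, hb⟩ := h
  have h1 := ParityGames.val_lt hb
  rw [val, hl]
  rw [hl] at h1
  have h2 : (a + 1) * (2 * d + 1) ^ L ≤ (2 * d + 3) * (2 * d + 1) ^ L :=
    Nat.mul_le_mul_right _ (by omega)
  rw [add_mul, one_mul] at h2
  omega

section Lifting

variable {n d : ℕ} (G : GameGraph (Fin n) d) (L : ℕ)

/-- The edges of a node satisfy the condition of a progress measure: some edge of a node of Even,
and all edges of a node of Odd. -/
def GoodNode (μ : Fin n → List ℕ) (u : Fin n) : Prop :=
  match G.owner u with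
  | .even => ∃ e ∈ G.edges, e.1 = u ∧ SatEdge d e.2.1 (μ u) (μ e.2.2)
  | .odd => ∀ e ∈ G.edges, e.1 = u → SatEdge d e.2.1 (μ u) (μ e.2.2)

/-- A progress measure on the set `R` of nodes. -/
structure IsMeasure (φ : Fin n → List ℕ) (R : Set (Fin n)) : Prop where
  vec : ∀ u ∈ R, IsVec d L (φ u) ∧ IsLow d (φ u)
  even : ∀ u ∈ R, G.owner u = .even →
    ∃ e ∈ G.edges, e.1 = u ∧ e.2.2 ∈ R ∧ SatEdge d e.2.1 (φ u) (φ e.2.2)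
  odd : ∀ u ∈ R, G.owner u = .odd →
    ∀ e ∈ G.edges, e.1 = u → e.2.2 ∈ R ∧ SatEdge d e.2.1 (φ u) (φ e.2.2)

/-- An assignment of vectors that is at most every progress measure. -/
def Below (μ : Fin n → List ℕ) : Prop :=
  ∀ φ R, IsMeasure G L φ R → ∀ u ∈ R, val (2 * d + 1) (μ u) ≤ val (2 * d + 1) (φ u)

variable {G L}

/-- A winning strategy yields a ranking, and the ranking embeds into the tree of vectors. -/
lemma exists_isMeasure (hL : n < 2 ^ L) (hwin : G.HasWinningStrategy .even) :
    ∃ φ R, IsMeasure G L φ R ∧ G.start ∈ R := by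
  obtain ⟨σ, hσ, hwin⟩ := hwin
  obtain ⟨K, R, c, hstart, hstep⟩ := GameGraph.exists_ranking (G := G) (σ := σ) fun w hw =>
    hwin w (GameGraph.play_of_consistent hw).1 (GameGraph.play_of_consistent hw).2
  obtain ⟨φ, hφ1, hφ2⟩ := K.exists_embedding d le_rfl L Finset.univ (by simpa using hL)
    fun x _ y _ => K.top d le_rfl x y
  have hhead : ∀ p ≤ d, ∀ l : List ℕ,
      cutAt d p ((2 * d + 1) :: l) = (2 * d + 1) :: cutAt d p l := fun p hp l =>
    cutAt_cons_ne (by omega)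
  have hsat : ∀ e : Edge (Fin n) d, K.Descends e.1 e.2.1 e.2.2 →
      SatEdge d e.2.1 ((2 * d + 1) :: φ e.1) ((2 * d + 1) :: φ e.2.2) := by
    intro e he
    have hp := e.2.1.2.2
    unfold SatEdge
    split_ifs with hev
    · rw [hhead _ hp, hhead _ hp]
      refine cons_le_cons ?_
      obtain ⟨h1, h2⟩ := hφ2 e.2.2 (Finset.mem_univ _) e.1 (Finset.mem_univ _) e.2.1
      rcases (he.2 hev).lt_or_eq with h | h
      · exact (h1 h).le
      · exact (h2 h).le
    · rw [hhead _ (by omega), hhead _ (by omega)]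
      exact List.cons_lt_cons_iff.2 (Or.inr ⟨rfl,
        (hφ2 e.2.2 (Finset.mem_univ _) e.1 (Finset.mem_univ _) _).1
          (he.1 (Nat.not_even_iff_odd.1 hev))⟩)
  refine ⟨fun u => (2 * d + 1) :: φ u, R, ⟨fun u _ => ⟨?_, rfl⟩, fun u hu ho => ?_,
    fun u hu ho e he heu => ?_⟩, hstart⟩
  · obtain ⟨h1, h2⟩ := hφ1 u (Finset.mem_univ _)
    exact ⟨_, _, rfl, Or.inl rfl, h1, fun b hb => by have := h2 b hb; omega⟩
  · obtain ⟨h1, h2⟩ := hσ (c u) u ho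
    obtain ⟨h3, h4⟩ := hstep _ h1 (by rw [h2]; exact hu) fun _ => by rw [h2]
    have h5 := hsat _ h4
    rw [h2] at h5
    exact ⟨_, h1, h2, h3, h5⟩
  · subst heu
    obtain ⟨h3, h4⟩ := hstep _ he hu fun h => by rw [ho] at h; exact absurd h (by simp)
    exact ⟨h3, hsat _ h4⟩

/-- A winning strategy yields a progress measure without `⊤` at the starting node, and `μ` is below
it. -/
lemma not_winning_of_top (hL : n < 2 ^ L) {μ : Fin n → List ℕ} (hμ : ∀ u, IsVec d L (μ u))
    (hb : Below G L μ) (htop : ¬ IsLow d (μ G.start)) : ¬ G.HasWinningStrategy .even := by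
  intro hwin
  obtain ⟨φ, R, hφ, hs⟩ := exists_isMeasure hL hwin
  have h1 := hb φ R hφ _ hs
  obtain ⟨⟨b, l', h2, hb', hl', hlb'⟩, hlow⟩ := hφ.vec _ hs
  obtain ⟨a, l, h3, ha, hl, hlb⟩ := hμ G.start
  rw [IsLow, h2] at hlow
  rw [IsLow, h3] at htop
  rw [h2, h3, val, val, hl, hl'] at h1
  have h4 : b = 2 * d + 1 := by simpa using hlow
  have h5 : a = 2 * d + 2 := by
    rcases ha with rfl | ha
    · simp at htop
    · exact ha
  have h6 := val_lt hlb'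
  rw [hl'] at h6
  subst h4 h5
  nlinarith

lemma SatEdge.isLow {p : ℕ} {x y : List ℕ} (hp : p ≤ d) (hx : IsVec d L x) (hy : IsVec d L y)
    (hxl : IsLow d x) (h : SatEdge d p x y) : IsLow d y := by
  obtain ⟨a, l, rfl, -, -, -⟩ := hx
  obtain ⟨b, l', rfl, hb, -, -⟩ := hy
  obtain rfl : a = 2 * d + 1 := by simpa [IsLow] using hxl
  rcases hb with rfl | rfl
  · rfl
  · exfalso
    have hlt : ∀ q ≤ d, cutAt d q ((2 * d + 1) :: l) < cutAt d q ((2 * d + 2) :: l') :=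
      fun q hq => cutAt_cons_lt_cons (by omega) (by omega)
    unfold SatEdge at h
    split_ifs at h
    · exact absurd h (not_le.2 (hlt p hp))
    · exact absurd h (hlt (p - 1) (by omega)).not_gt

/-- A progress measure on the nodes whose vector is not `⊤` is a strategy for Even. -/
lemma winning_of_good {μ : Fin n → List ℕ} (hμ : ∀ u, IsVec d L (μ u))
    (hgood : ∀ u, IsLow d (μ u) → GoodNode G μ u) (hlow : IsLow d (μ G.start)) :
    G.HasWinningStrategy .even := by
  classical
  have hch : ∀ u, ∃ e ∈ G.edges, e.1 = u ∧ (IsLow d (μ u) → G.owner u = .even →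
      SatEdge d e.2.1 (μ u) (μ e.2.2)) := by
    intro u
    by_cases h : IsLow d (μ u) ∧ G.owner u = .even
    · have h1 := hgood u h.1
      rw [GoodNode, h.2] at h1
      obtain ⟨e, h2, h3, h4⟩ := h1
      exact ⟨e, h2, h3, fun _ _ => h4⟩
    · obtain ⟨e, h1, h2⟩ := G.exists_out u
      exact ⟨e, h1, h2, fun h3 h4 => absurd ⟨h3, h4⟩ h⟩
  choose f hf1 hf2 hf3 using hch
  refine ⟨fun _ u => f u, fun _ u _ => ⟨hf1 u, hf2 u⟩, fun w hw hfol => ?_⟩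
  have hsat' : ∀ i, IsLow d (μ (w i).1) → SatEdge d (w i).2.1 (μ (w i).1) (μ (w i).2.2) := by
    intro i hi
    rcases ho : G.owner (w i).1 with _ | _
    · have h1 := hf3 _ hi ho
      have h2 : w i = f (w i).1 := hfol i ho
      rwa [← h2] at h1
    · have h1 := hgood _ hi
      rw [GoodNode, ho] at h1
      exact h1 _ (hw.2.1 i) rfl
  have hlow' : ∀ i, IsLow d (μ (w i).1) := by
    intro i
    induction i with
    | zero => rw [hw.1]; exact hlow
    | succ i ih =>
      rw [hw.2.2 i]
      exact (hsat' i ih).isLow (w i).2.1.2.2 (hμ _) (hμ _) ih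
  have hsat : ∀ i, SatEdge d (w i).2.1 (μ (w i).1) (μ (w (i + 1)).1) := fun i => by
    rw [hw.2.2 i]; exact hsat' i (hlow' i)
  refine limsupEven_of_not_odd (prios_le w) fun hodd => ?_
  obtain ⟨p, hp, hpf, hpe⟩ := hodd.exists_le (prios_le w)
  -- the vectors, cut at `p - 1`, do not increase, and infinitely often they decrease
  let g : Fin n → List ℕ := fun u => cutAt d (p - 1) (μ u)
  have hlen : ∀ u v, (μ u).length = (μ v).length := fun u v => by
    rw [(hμ u).length, (hμ v).length]
  have hle : ∀ i, prios w i ≤ p → g (w (i + 1)).1 ≤ g (w i).1 := by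
    intro i hi
    have h1 := hsat i
    change ((w i).2.1 : ℕ) ≤ p at hi
    rw [← not_lt]
    intro hlt
    unfold SatEdge at h1
    split_ifs at h1 with hev
    · have hne : ((w i).2.1 : ℕ) ≠ p := fun h =>
        (Nat.not_even_iff_odd.2 hp) (h ▸ hev)
      exact absurd (cutAt_lt_of_le (q := ((w i).2.1 : ℕ)) (by omega) (hlen _ _) hlt) (not_lt.2 h1)
    · exact absurd (cutAt_lt_of_le (q := ((w i).2.1 : ℕ) - 1) (by omega) (hlen _ _) hlt)
        h1.not_gt
  have hlt : ∀ i, prios w i = p → g (w (i + 1)).1 < g (w i).1 := by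
    intro i hi
    have h1 := hsat i
    change ((w i).2.1 : ℕ) = p at hi
    rw [SatEdge, hi, if_neg (Nat.not_even_iff_odd.2 hp)] at h1
    exact h1
  refine no_infinite_descent
    (f := fun i => (Finset.univ.filter fun u => g u < g (w i).1).card) ?_ ?_
  · exact hpe.mono fun i hi => Finset.card_le_card
      (Finset.monotone_filter_right _ fun u _ hu => lt_of_lt_of_le hu (hle i hi))
  · refine hpf.mono fun i hi => Finset.card_lt_card ?_
    rw [Finset.ssubset_iff_of_subset
      (Finset.monotone_filter_right _ fun u _ hu => lt_of_lt_of_le hu (hlt i hi).le)]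
    exact ⟨(w (i + 1)).1, by simpa using hlt i hi, by simp⟩

/-- If the vector of a node is equal to that of a progress measure, then its edges satisfy the
condition, because the vectors of the other nodes are not larger.  So the vectors of the other nodes
can be incremented. -/
lemma Below.lift {μ : Fin n → List ℕ} (hμ : ∀ u, IsVec d L (μ u)) (hb : Below G L μ) {u : Fin n}
    (hu : ¬ GoodNode G μ u) {x : List ℕ} (hx : val (2 * d + 1) x = val (2 * d + 1) (μ u) + 1) :
    Below G L (Function.update μ u x) := by
  intro φ R hφ v hv
  by_cases hvu : v = u
  · subst hvu
    rw [Function.update_self, hx]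
    refine lt_of_le_of_ne (hb φ R hφ v hv) fun heq => hu ?_
    have hvec := (hφ.vec v hv).1
    have hcut : ∀ p, cutAt d p (μ v) = cutAt d p (φ v) := fun p =>
      le_antisymm ((hμ v).cutAt_mono hvec heq.le) (hvec.cutAt_mono (hμ v) heq.ge)
    have hsat : ∀ e : Edge (Fin n) d, e.2.2 ∈ R → SatEdge d e.2.1 (φ v) (φ e.2.2) →
        SatEdge d e.2.1 (μ v) (μ e.2.2) := by
      intro e he h
      have hle : ∀ p, cutAt d p (μ e.2.2) ≤ cutAt d p (φ e.2.2) := fun p =>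
        (hμ _).cutAt_mono (hφ.vec _ he).1 (hb φ R hφ _ he)
      unfold SatEdge at h ⊢
      split_ifs at h ⊢
      · exact hcut _ ▸ (hle _).trans h
      · exact hcut _ ▸ (hle _).trans_lt h
    rcases ho : G.owner v with _ | _
    · rw [GoodNode, ho]
      obtain ⟨e, h1, h2, h3, h4⟩ := hφ.even v hv ho
      exact ⟨e, h1, h2, hsat e h3 h4⟩
    · rw [GoodNode, ho]
      intro e h1 h2
      obtain ⟨h3, h4⟩ := hφ.odd v hv ho e h1 h2
      exact hsat e h3 h4
  · rw [Function.update_of_ne hvu]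
    exact hb φ R hφ v hv

lemma below_init : Below G L fun _ => (2 * d + 1) :: List.replicate L 0 := by
  intro φ R hφ u hu
  obtain ⟨⟨a, l, h1, -, hl, -⟩, h2⟩ := hφ.vec u hu
  rw [h1, IsLow] at h2
  obtain rfl : a = 2 * d + 1 := by simpa using h2
  rw [h1, val, val, val_replicate_zero, List.length_replicate, hl]
  omega

end Lifting

namespace RAM

/-! ### Reasoning about programs -/

namespace Program

/-- The registers to which a program assigns. -/
def writes : Program → List ℕ
  | .const x _ => [x]
  | .add x _ _ => [x]
  | .sub x _ _ => [x]
  | .load x _ => [x]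
  | .store _ _ => []
  | .seq P Q => P.writes ++ Q.writes
  | .branch _ P Q => P.writes ++ Q.writes
  | .loop _ P => P.writes

/-- The program does not change the memory. -/
def noStore : Program → Bool
  | .store _ _ => false
  | .seq P Q => P.noStore && Q.noStore
  | .branch _ P Q => P.noStore && Q.noStore
  | .loop _ P => P.noStore
  | _ => true

/-- The program has no loops. -/
def loopFree : Program → Bool
  | .seq P Q => P.loopFree && Q.loopFree
  | .branch _ P Q => P.loopFree && Q.loopFree
  | .loop _ _ => false
  | _ => true

/-- A bound on the number of steps of a program without loops. -/
def cost : Program → ℕ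
  | .seq P Q => P.cost + Q.cost
  | .branch _ P Q => max P.cost Q.cost + 1
  | _ => 1

/-- The final state of a program without loops. -/
def eval : Program → State → State
  | .const x a, s => s.setReg x a
  | .add x y z, s => s.setReg x (s.reg y + s.reg z)
  | .sub x y z, s => s.setReg x (s.reg y - s.reg z)
  | .load x y, s => s.setReg x (s.mem (s.reg y))
  | .store x y, s => s.setMem (s.reg x) (s.reg y)
  | .seq P Q, s => Q.eval (P.eval s)
  | .branch x P Q, s => if s.reg x = 0 then Q.eval s else P.eval s
  | .loop _ _, s => s

/-- Sequential composition. -/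
def seqs (P : Program) : List Program → Program
  | [] => P
  | Q :: l => .seq P (seqs Q l)

end Program

open Program

@[simp] lemma setReg_reg (s : State) (x a y : ℕ) :
    (s.setReg x a).reg y = if y = x then a else s.reg y := by
  simp [State.setReg, Function.update_apply]

@[simp] lemma setReg_mem (s : State) (x a : ℕ) : (s.setReg x a).mem = s.mem := rfl

@[simp] lemma setMem_reg (s : State) (i a : ℕ) : (s.setMem i a).reg = s.reg := rfl

@[simp] lemma setMem_mem (s : State) (i a : ℕ) :
    (s.setMem i a).mem = Function.update s.mem i a := rfl

/-- What a program leaves unchanged. -/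
structure Frame (P : Program) (s s' : State) : Prop where
  reg : ∀ r, r ∉ P.writes → s'.reg r = s.reg r
  mem : P.noStore = true → s'.mem = s.mem

lemma Frame.refl (P : Program) (s : State) : Frame P s s := ⟨fun _ _ => rfl, fun _ => rfl⟩

lemma Frame.trans {P : Program} {s₁ s₂ s₃ : State} (h : Frame P s₁ s₂) (h' : Frame P s₂ s₃) :
    Frame P s₁ s₃ :=
  ⟨fun r hr => (h'.reg r hr).trans (h.reg r hr), fun hP => (h'.mem hP).trans (h.mem hP)⟩

lemma Exec.frame {P : Program} {s s' : State} {t : ℕ} (h : Exec P s t s') : Frame P s s' := by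
  induction h with
  | const s x a | add s x y z | sub s x y z | load s x y =>
    refine ⟨fun r hr => ?_, fun _ => rfl⟩
    have : r ≠ x := by simpa [writes] using hr
    simp [this]
  | store s x y => exact ⟨fun r hr => rfl, fun h => by simp [noStore] at h⟩
  | seq _ _ ih1 ih2 =>
    refine ⟨fun r hr => ?_, fun h => ?_⟩
    · simp only [writes, List.mem_append, not_or] at hr
      rw [ih2.reg r hr.2, ih1.reg r hr.1]
    · simp only [noStore, Bool.and_eq_true] at h
      rw [ih2.mem h.2, ih1.mem h.1]
  | branch_true _ _ ih =>
    refine ⟨fun r hr => ?_, fun h => ?_⟩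
    · simp only [writes, List.mem_append, not_or] at hr
      exact ih.reg r hr.1
    · simp only [noStore, Bool.and_eq_true] at h
      exact ih.mem h.1
  | branch_false _ _ ih =>
    refine ⟨fun r hr => ?_, fun h => ?_⟩
    · simp only [writes, List.mem_append, not_or] at hr
      exact ih.reg r hr.2
    · simp only [noStore, Bool.and_eq_true] at h
      exact ih.mem h.2
  | loop_true _ _ _ ih1 ih2 =>
    exact ⟨fun r hr => (ih2.reg r hr).trans (ih1.reg r hr), fun h => (ih2.mem h).trans (ih1.mem h)⟩
  | loop_false _ => exact Frame.refl _ _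

/-- Started in `s`, the program halts after at most `T` steps in a state satisfying `Q`. -/
def Runs (P : Program) (s : State) (T : ℕ) (Q : State → Prop) : Prop :=
  ∃ t s', Exec P s t s' ∧ t ≤ T ∧ Q s'

lemma Runs.mono {P : Program} {s : State} {T T' : ℕ} {Q Q' : State → Prop} (h : Runs P s T Q)
    (hT : T ≤ T') (hQ : ∀ s', Frame P s s' → Q s' → Q' s') : Runs P s T' Q' := by
  obtain ⟨t, s', h1, h2, h3⟩ := h
  exact ⟨t, s', h1, h2.trans hT, hQ s' h1.frame h3⟩

lemma Runs.seq {P P' : Program} {s : State} {T T' : ℕ} {Q R : State → Prop} (h : Runs P s T Q)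
    (h' : ∀ s', Frame P s s' → Q s' → Runs P' s' T' R) : Runs (.seq P P') s (T + T') R := by
  obtain ⟨t, s', h1, h2, h3⟩ := h
  obtain ⟨t', s'', h4, h5, h6⟩ := h' s' h1.frame h3
  exact ⟨_, s'', .seq h1 h4, by omega, h6⟩

lemma Runs.branch {x : ℕ} {P P' : Program} {s : State} {T : ℕ} {Q : State → Prop}
    (h : s.reg x ≠ 0 → Runs P s T Q) (h' : s.reg x = 0 → Runs P' s T Q) :
    Runs (.branch x P P') s (T + 1) Q := by
  by_cases hx : s.reg x = 0
  · obtain ⟨t, s', h1, h2, h3⟩ := h' hx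
    exact ⟨_, s', .branch_false hx h1, by omega, h3⟩
  · obtain ⟨t, s', h1, h2, h3⟩ := h hx
    exact ⟨_, s', .branch_true hx h1, by omega, h3⟩

lemma runs_eval {P : Program} (hP : P.loopFree = true) (s : State) :
    Runs P s P.cost fun s' => s' = P.eval s := by
  induction P generalizing s with
  | const x a => exact ⟨_, _, .const s x a, le_rfl, rfl⟩
  | add x y z => exact ⟨_, _, .add s x y z, le_rfl, rfl⟩
  | sub x y z => exact ⟨_, _, .sub s x y z, le_rfl, rfl⟩
  | load x y => exact ⟨_, _, .load s x y, le_rfl, rfl⟩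
  | store x y => exact ⟨_, _, .store s x y, le_rfl, rfl⟩
  | seq P P' ih ih' =>
    simp only [loopFree, Bool.and_eq_true] at hP
    exact (ih hP.1 s).seq fun s' _ h => by subst h; exact ih' hP.2 _
  | branch x P P' ih ih' =>
    simp only [loopFree, Bool.and_eq_true] at hP
    refine Runs.branch (fun hx => ?_) fun hx => ?_
    · exact (ih hP.1 s).mono (le_max_left _ _) fun s' _ h => by rw [h, eval, if_neg hx]
    · exact (ih' hP.2 s).mono (le_max_right _ _) fun s' _ h => by rw [h, eval, if_pos hx]
  | loop x P => simp [loopFree] at hP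

/-- A loop with an invariant `I` and a variant `k`. -/
lemma Runs.loop {x : ℕ} {P : Program} {s₀ : State} {T k : ℕ} {I : ℕ → State → Prop}
    (h0 : I k s₀) (hstep : ∀ k s, I k s → Frame P s₀ s → s.reg x ≠ 0 →
      Runs P s T fun s' => ∃ k' < k, I k' s') :
    Runs (.loop x P) s₀ (k * (T + 1) + 1) fun s' => (∃ k', I k' s') ∧ s'.reg x = 0 := by
  have main : ∀ k s, Frame P s₀ s → I k s →
      Runs (.loop x P) s (k * (T + 1) + 1) fun s' => (∃ k', I k' s') ∧ s'.reg x = 0 := by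
    intro k
    induction k using Nat.strong_induction_on with
    | _ k ih =>
      intro s hf hI
      by_cases hx : s.reg x = 0
      · exact ⟨_, s, .loop_false hx, by omega, ⟨k, hI⟩, hx⟩
      · obtain ⟨t, s', h1, h2, k', hk', h3⟩ := hstep k s hI hf hx
        obtain ⟨t', s'', h4, h5, h6⟩ := ih k' hk' s' (hf.trans h1.frame) h3
        refine ⟨_, s'', .loop_true hx h1 h4, ?_, h6⟩
        have : (k' + 1) * (T + 1) ≤ k * (T + 1) := Nat.mul_le_mul_right _ hk'
        rw [add_mul, one_mul] at this
        omega
  exact main k s₀ (Frame.refl _ _) h0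

/-- A loop that is executed exactly `k` times. -/
lemma Runs.for {x : ℕ} {P : Program} {s₀ : State} {T k : ℕ} {I : ℕ → State → Prop}
    (h0 : I k s₀) (hx : ∀ k s, I k s → (s.reg x = 0 ↔ k = 0))
    (hstep : ∀ k s, I (k + 1) s → Frame P s₀ s → Runs P s T (I k)) :
    Runs (.loop x P) s₀ (k * (T + 1) + 1) (I 0) := by
  refine (Runs.loop (I := I) h0 fun k s hI hf hne => ?_).mono le_rfl ?_
  · obtain ⟨k, rfl⟩ := Nat.exists_eq_succ_of_ne_zero fun h => hne ((hx _ _ hI).2 h)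
    exact (hstep k s hI hf).mono le_rfl fun s' _ h => ⟨k, Nat.lt_succ_self k, h⟩
  · rintro s' - ⟨⟨k', h⟩, h0⟩
    rwa [(hx _ _ h).1 h0] at h

/-! ### Comparison of two vectors -/

/-- The digit `a`, replaced by `d` if it differs from `d` by at most `p`. -/
def cutDigit (d p a : ℕ) : ℕ := if d ≤ a + p ∧ a ≤ d + p then d else a

/-- The result of the comparison of two vectors cut at `p`; it is `flag` if they are equal. -/
noncomputable def cmpResult (d p flag : ℕ) (x y : List ℕ) : ℕ :=
  if cutAt d p x < cutAt d p y then 0 else if cutAt d p y < cutAt d p x then 1 else flag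

section cmpResult

variable {d p flag a b : ℕ} {x y : List ℕ}

lemma cutAt_cons_lt_of_cutDigit (h : cutDigit d p a < cutDigit d p b) :
    cutAt d p (a :: x) < cutAt d p (b :: y) := by
  unfold cutDigit at h
  refine cutAt_cons_lt_cons ?_ ?_ <;> split_ifs at h <;> omega

lemma cmpResult_of_lt (h : cutDigit d p a < cutDigit d p b) :
    cmpResult d p flag (a :: x) (b :: y) = 0 := if_pos (cutAt_cons_lt_of_cutDigit h)

lemma cmpResult_of_gt (h : cutDigit d p b < cutDigit d p a) :
    cmpResult d p flag (a :: x) (b :: y) = 1 := by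
  have := cutAt_cons_lt_of_cutDigit (x := y) (y := x) h
  rw [cmpResult, if_neg this.not_gt, if_pos this]

lemma cmpResult_of_cut (h : cutDigit d p a = d) (h' : cutDigit d p b = d) :
    cmpResult d p flag (a :: x) (b :: y) = flag := by
  have key : ∀ {a x}, cutDigit d p a = d → cutAt d p (a :: x) = [d] := fun {a x} h => by
    refine cutAt_cons_eq ?_
    unfold cutDigit at h
    split_ifs at h with h1
    · exact h1
    · omega
  rw [cmpResult, key h, key h', if_neg (lt_irrefl _), if_neg (lt_irrefl _)]

lemma cmpResult_of_eq (h : cutDigit d p a = cutDigit d p b) (hd : cutDigit d p a ≠ d) :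
    cmpResult d p flag (a :: x) (b :: y) = cmpResult d p flag x y := by
  unfold cutDigit at h hd
  have h1 : ¬ (d ≤ a + p ∧ a ≤ d + p) := fun h1 => hd (if_pos h1)
  rw [if_neg h1] at h hd
  have h2 : ¬ (d ≤ b + p ∧ b ≤ d + p) := fun h2 => hd (by rw [h, if_pos h2])
  rw [if_neg h2] at h
  subst h
  simp [cmpResult, cutAt_cons_ne h1]

lemma cmpResult_nil : cmpResult d p flag [] [] = flag := by simp [cmpResult, cutAt]

lemma cmpResult_le (h : flag ≤ 1) : cmpResult d p flag x y ≤ 1 := by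
  unfold cmpResult
  split_ifs <;> omega

/-- With the parameters chosen here one comparison covers both parities: for an even priority the
vectors are cut at `p` and equality is allowed, for an odd one they are cut at `p - 1` and the
decrease is strict. -/
lemma cmpResult_eq_one_iff :
    cmpResult d (p - (1 - if Even p then 1 else 0)) (if Even p then 1 else 0) x y = 1 ↔
      SatEdge d p x y := by
  unfold cmpResult SatEdge
  by_cases hp : Even p
  · simp only [if_pos hp, Nat.sub_self, Nat.sub_zero]
    constructor
    · intro h
      by_contra hlt
      rw [if_pos (not_le.1 hlt)] at h
      omega
    · intro h
      rw [if_neg (not_lt.2 h)]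
      split_ifs <;> rfl
  · simp only [if_neg hp, Nat.sub_zero]
    constructor
    · intro h
      split_ifs at h with h1 h2
      exact h2
    · intro h
      rw [if_neg h.not_gt, if_pos h]

end cmpResult

/-- The digits of the node `v`; the digit number `i` of all nodes is stored in the row `i`, a block
of `n` memory cells. -/
def column (n base rows : ℕ) (M : ℕ → ℕ) (v : ℕ) : List ℕ :=
  (List.range rows).map fun i => M (base + i * n + v)

lemma column_drop {n base rows : ℕ} {M : ℕ → ℕ} {v i : ℕ} (hi : i < rows) :
    (column n base rows M v).drop i =
      M (base + i * n + v) :: (column n base rows M v).drop (i + 1) := by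
  have h : i < (column n base rows M v).length := by simpa [column] using hi
  rw [List.drop_eq_getElem_cons h]
  simp [column]

lemma column_drop_rows {n base rows : ℕ} {M : ℕ → ℕ} {v : ℕ} :
    (column n base rows M v).drop rows = [] := by
  simp [column]

/-- The registers that keep their values after the initialization: the constants `0` and `1`, the
numbers `n`, `d`, `2 d` and `2 d + 1`, the addresses of the first vector digit, of the end of the
vectors, and of the first edge. -/
structure Consts (n d base fin e₀ : ℕ) (s : State) : Prop where
  r0 : s.reg 0 = 0
  r1 : s.reg 1 = n
  r2 : s.reg 2 = d
  r4 : s.reg 4 = 1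
  r5 : s.reg 5 = base
  r6 : s.reg 6 = fin
  r22 : s.reg 22 = 2 * d
  r23 : s.reg 23 = 2 * d + 1
  r24 : s.reg 24 = e₀

lemma Consts.frame {n d base fin e₀ : ℕ} {s s' : State} {P : Program}
    (h : Consts n d base fin e₀ s) (hf : Frame P s s')
    (hP : ∀ r ∈ [0, 1, 2, 4, 5, 6, 22, 23, 24], r ∉ P.writes) : Consts n d base fin e₀ s' := by
  constructor
  · rw [hf.reg 0 (hP 0 (by decide)), h.r0]
  · rw [hf.reg 1 (hP 1 (by decide)), h.r1]
  · rw [hf.reg 2 (hP 2 (by decide)), h.r2]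
  · rw [hf.reg 4 (hP 4 (by decide)), h.r4]
  · rw [hf.reg 5 (hP 5 (by decide)), h.r5]
  · rw [hf.reg 6 (hP 6 (by decide)), h.r6]
  · rw [hf.reg 22 (hP 22 (by decide)), h.r22]
  · rw [hf.reg 23 (hP 23 (by decide)), h.r23]
  · rw [hf.reg 24 (hP 24 (by decide)), h.r24]

/-- A program without effect on the registers in use. -/
def nop : Program := .const 20 0

/-- Replaces the digit in the register `z` by `d` if it lies between the registers 17 and 18. -/
def cutStep (z : ℕ) : Program :=
  seqs (.sub 20 17 z) [.sub 25 z 18, .add 20 20 25, .branch 20 nop (.add z 2 0)]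

/-- One row of the comparison of two vectors.  The registers 13 and 14 point to the current digits,
the register 19 contains the result, and the comparison stops when the register 29 is `0`. -/
def rowStep : Program :=
  seqs (.load 15 13) [.load 16 14, cutStep 15, cutStep 16, .sub 20 16 15,
    .branch 20 (.seq (.const 19 0) (.const 29 0))
      (.seq (.sub 20 15 16)
        (.branch 20 (.seq (.const 19 1) (.const 29 0))
          (seqs (.sub 20 15 2) [.sub 25 2 15, .add 20 20 25,
            .branch 20 (seqs (.add 13 13 1) [.add 14 14 1, .sub 29 6 13]) (.const 29 0)])))]

section Compare

variable {n d base fin e₀ : ℕ}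

lemma cutStep_eval {p z : ℕ} {s : State} (hc : Consts n d base fin e₀ s) (h17 : s.reg 17 = d - p)
    (h18 : s.reg 18 = d + p) (hz : z = 15 ∨ z = 16) :
    ((cutStep z).eval s).reg z = cutDigit d p (s.reg z) := by
  have key : (d - p - s.reg z) + (s.reg z - (d + p)) = 0 ↔
      (d ≤ s.reg z + p ∧ s.reg z ≤ d + p) := by omega
  unfold cutDigit
  rcases hz with rfl | rfl <;>
  · simp only [cutStep, seqs, eval, nop, setReg_reg, h17, h18, reduceIte, Nat.reduceEqDiff, key]
    split_ifs with h <;> simp [h, hc.r0, hc.r2]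

/-- The invariant of the loop that compares the vectors `x` and `y`. -/
def RowInv (n d fin p flag v w base : ℕ) (x y : List ℕ) (rows k : ℕ) (s : State) : Prop :=
  (s.reg 29 = 0 ∧ s.reg 19 = cmpResult d p flag x y) ∨
    ∃ i, k = rows - i ∧ i ≤ rows ∧ s.reg 19 = flag ∧ s.reg 13 = base + i * n + v ∧
      s.reg 14 = base + i * n + w ∧ s.reg 29 = fin - s.reg 13 ∧
      cmpResult d p flag x y = cmpResult d p flag (x.drop i) (y.drop i)

lemma eval_frame {P : Program} (hP : P.loopFree = true) (s : State) : Frame P s (P.eval s) := by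
  obtain ⟨t, s', h1, -, h3⟩ := runs_eval hP s
  exact h3 ▸ h1.frame

lemma rowStep_spec {p flag v w rows i : ℕ} {s : State} (hc : Consts n d base fin e₀ s)
    (hi : i < rows) (h17 : s.reg 17 = d - p) (h18 : s.reg 18 = d + p)
    (h19 : s.reg 19 = flag) (h13 : s.reg 13 = base + i * n + v) (h14 : s.reg 14 = base + i * n + w)
    (hcmp : cmpResult d p flag (column n base rows s.mem v) (column n base rows s.mem w) =
      cmpResult d p flag ((column n base rows s.mem v).drop i)
        ((column n base rows s.mem w).drop i)) :
    ∃ k' < rows - i, RowInv n d fin p flag v w base (column n base rows s.mem v)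
      (column n base rows s.mem w) rows k' (rowStep.eval s) := by
  rw [column_drop hi, column_drop hi] at hcmp
  set x := column n base rows s.mem v
  set y := column n base rows s.mem w
  -- the state after loading and cutting the digits
  set s₁ : State := (seqs (.load 15 13) [.load 16 14]).eval s with hs₁
  have hf₁ : Frame _ s s₁ := eval_frame rfl s
  have h15 : s₁.reg 15 = s.mem (base + i * n + v) := by simp [hs₁, seqs, eval, h13]
  have h16 : s₁.reg 16 = s.mem (base + i * n + w) := by simp [hs₁, seqs, eval, h14]
  set s₂ := (cutStep 15).eval s₁ with hs₂
  have hf₂ : Frame _ s₁ s₂ := eval_frame rfl s₁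
  have hc₁ := hc.frame hf₁ (by decide)
  have h15' : s₂.reg 15 = cutDigit d p (s.mem (base + i * n + v)) := by
    rw [← h15]
    exact cutStep_eval hc₁ ((hf₁.reg 17 (by decide)).trans h17)
      ((hf₁.reg 18 (by decide)).trans h18) (Or.inl rfl)
  have hc₂ := hc₁.frame hf₂ (by decide)
  set s₃ := (cutStep 16).eval s₂ with hs₃
  have hf₃ : Frame _ s₂ s₃ := eval_frame rfl s₂
  have hc₃ := hc₂.frame hf₃ (by decide)
  have hreg : ∀ r, r ∉ [15, 16, 20, 25] → s₃.reg r = s.reg r := fun r hr => by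
    simp only [List.mem_cons, List.not_mem_nil, or_false, not_or] at hr
    rw [hf₃.reg r (by simp [cutStep, writes, seqs, nop, hr]),
      hf₂.reg r (by simp [cutStep, writes, seqs, nop, hr]),
      hf₁.reg r (by simp [writes, seqs, hr])]
  have h16' : s₃.reg 16 = cutDigit d p (s.mem (base + i * n + w)) := by
    rw [← h16, ← hf₂.reg 16 (by decide)]
    exact cutStep_eval hc₂
      ((hf₂.reg 17 (by decide)).trans ((hf₁.reg 17 (by decide)).trans h17))
      ((hf₂.reg 18 (by decide)).trans ((hf₁.reg 18 (by decide)).trans h18)) (Or.inr rfl)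
  have h15'' : s₃.reg 15 = cutDigit d p (s.mem (base + i * n + v)) := by
    rw [hf₃.reg 15 (by decide), h15']
  have hstep : rowStep.eval s = (seqs (.sub 20 16 15) [
    .branch 20 (.seq (.const 19 0) (.const 29 0))
      (.seq (.sub 20 15 16)
        (.branch 20 (.seq (.const 19 1) (.const 29 0))
          (seqs (.sub 20 15 2) [.sub 25 2 15, .add 20 20 25,
            .branch 20 (seqs (.add 13 13 1) [.add 14 14 1, .sub 29 6 13]) (.const 29 0)])))]).eval
      s₃ := rfl
  have h13' := (hreg 13 (by decide)).trans h13
  have h14' := (hreg 14 (by decide)).trans h14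
  have h19' := (hreg 19 (by decide)).trans h19
  rw [hstep]
  clear_value s₃
  set X := cutDigit d p (s.mem (base + i * n + v)) with hX
  set Y := cutDigit d p (s.mem (base + i * n + w)) with hY
  simp only [seqs, eval, setReg_reg, h15'', h16', hc₃.r2, hc₃.r1, hc₃.r6, h13', h14', RowInv]
  rcases lt_trichotomy X Y with hlt | heq | hlt
  · have h1 : Y - X ≠ 0 := by omega
    refine ⟨0, by omega, Or.inl ?_⟩
    rw [hcmp, cmpResult_of_lt hlt]
    simp [h1]
  · have h1 : Y - X = 0 := by omega
    have h2 : X - Y = 0 := by omega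
    by_cases hXd : X = d
    · refine ⟨0, by omega, Or.inl ?_⟩
      rw [hcmp, cmpResult_of_cut hXd (heq.symm.trans hXd)]
      have h3 : X - d + (d - X) = 0 := by omega
      simp [h1, h2, h3, h19']
    · have h3 : X - d + (d - X) ≠ 0 := by omega
      refine ⟨rows - (i + 1), by omega, Or.inr ⟨i + 1, rfl, hi, ?_⟩⟩
      rw [hcmp, cmpResult_of_eq heq hXd]
      simp only [h1, h2, h3, setReg_reg, if_true, if_false, Nat.reduceEqDiff, h13',
        h14', h19', add_mul, one_mul, and_true, true_and]
      constructor <;> ring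
  · have h1 : Y - X = 0 := by omega
    have h2 : X - Y ≠ 0 := by omega
    refine ⟨0, by omega, Or.inl ?_⟩
    rw [hcmp, cmpResult_of_gt hlt]
    simp [h1, h2]

lemma compare_spec {p flag v w rows : ℕ} {s : State} (hc : Consts n d base fin e₀ s) (hv : v < n)
    (hfin : fin = base + rows * n) (h17 : s.reg 17 = d - p) (h18 : s.reg 18 = d + p)
    (h19 : s.reg 19 = flag) (h13 : s.reg 13 = base + v) (h14 : s.reg 14 = base + w)
    (h29 : s.reg 29 = fin - (base + v)) :
    Runs (.loop 29 rowStep) s (rows * (rowStep.cost + 1) + 1) fun s' =>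
      s'.reg 19 = cmpResult d p flag (column n base rows s.mem v) (column n base rows s.mem w) := by
  refine (Runs.loop (k := rows) (T := rowStep.cost) (I := RowInv n d fin p flag v w base
    (column n base rows s.mem v) (column n base rows s.mem w) rows) ?_ ?_).mono le_rfl ?_
  · exact Or.inr ⟨0, by simp, by simp, h19, by simp [h13], by simp [h14], by rw [h29, h13],
      by simp⟩
  · rintro k s₁ (⟨h0, -⟩ | ⟨i, rfl, hi, h1, h2, h3, h4, h5⟩) hf hne
    · exact absurd h0 hne
    · have hi' : i < rows := by
        refine lt_of_le_of_ne hi fun h => hne ?_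
        rw [h4, h2, hfin, h]
        omega
      have hm := hf.mem rfl
      rw [← hm] at h5 ⊢
      refine (runs_eval rfl s₁).mono le_rfl fun s' _ h => h ▸ ?_
      exact rowStep_spec (hc.frame hf (by decide)) hi' ((hf.reg 17 (by decide)).trans h17)
        ((hf.reg 18 (by decide)).trans h18) h1 h2 h3 h5
  · rintro s' - ⟨⟨k, ⟨-, h⟩ | ⟨i, rfl, hi, h1, h2, h3, h4, h5⟩⟩, h0⟩
    · exact h
    · have hi' : i = rows := by
        by_contra hne
        have h6 : (i + 1) * n ≤ rows * n := Nat.mul_le_mul_right _ (by omega)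
        rw [add_mul, one_mul] at h6
        rw [h4, h2] at h0
        omega
      rw [h1, h5, hi', column_drop_rows, column_drop_rows, cmpResult_nil]

/-- Loads the priority and the target of the edge at the address in the register 10. -/
def loadEdge : Program :=
  seqs (.add 20 10 4) [.load 11 20, .add 20 20 4, .load 12 20, .const 19 1, .add 16 11 0]

/-- Computes whether the number in the register 16 is even. -/
def parity : Program := .loop 16 (.seq (.sub 19 4 19) (.sub 16 16 4))

/-- Prepares the comparison of the vectors of the source and the target of an edge. -/
def prepareCompare : Program :=
  seqs (.sub 15 4 19) [.sub 15 11 15, .sub 17 2 15, .add 18 2 15, .add 13 5 7, .add 14 5 12,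
    .sub 29 6 13]

/-- If the registers 8 and 19 differ, then the register 8 is copied to the register 9. -/
def recordResult : Program :=
  seqs (.sub 15 19 8) [.sub 16 8 19, .add 20 15 16, .branch 20 (.add 9 8 0) nop]

/-- Tests the condition of a progress measure for an edge of the node in the register 7. -/
def checkEdge : Program :=
  seqs loadEdge [parity, prepareCompare, .loop 29 rowStep, recordResult]

lemma parity_spec {p : ℕ} {s : State} (h4 : s.reg 4 = 1) (h16 : s.reg 16 = p)
    (h19 : s.reg 19 = 1) :
    Runs parity s (p * 3 + 1) fun s' => s'.reg 19 = if Even p then 1 else 0 := by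
  refine (Runs.for (k := p) (T := 2) (I := fun k s' => s'.reg 16 = k ∧ k ≤ p ∧
    s'.reg 19 = if Even (p - k) then 1 else 0) ?_ ?_ ?_).mono le_rfl ?_
  · simp [h16, h19]
  · rintro k s' ⟨h, -⟩
    rw [h]
  · rintro k s' ⟨h1, h2, h3⟩ hf
    have h4' := (hf.reg 4 (by decide)).trans h4
    refine (runs_eval rfl s').mono le_rfl fun s'' _ h => h ▸ ?_
    have h5 : p - k = p - (k + 1) + 1 := by omega
    simp only [eval, setReg_reg, h1, h3, h4', reduceIte, Nat.reduceEqDiff]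
    refine ⟨by omega, by omega, ?_⟩
    have h6 : Even (p - k) ↔ ¬ Even (p - (k + 1)) := by rw [h5, Nat.even_add_one]
    by_cases h7 : Even (p - (k + 1)) <;> simp [h6, h7]
  · rintro s' - ⟨-, -, h⟩
    simpa using h

open Classical in
lemma checkEdge_spec {p v w own rows : ℕ} {s : State} (hc : Consts n d base fin e₀ s) (hv : v < n)
    (hfin : fin = base + rows * n) (h7 : s.reg 7 = v) (h8 : s.reg 8 = own) (hown : own ≤ 1)
    (hp : s.mem (s.reg 10 + 1) = p) (hw : s.mem (s.reg 10 + 2) = w) (hpd : p ≤ d) :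
    Runs checkEdge s (3 * d + rows * (rowStep.cost + 1) + 20) fun s' =>
      s'.reg 9 = if (if SatEdge d p (column n base rows s.mem v) (column n base rows s.mem w)
        then 1 else 0) = own then s.reg 9 else own := by
  set flag := if Even p then 1 else 0 with hflag
  set x := column n base rows s.mem v
  set y := column n base rows s.mem w
  have hflag1 : flag ≤ 1 := by rw [hflag]; split_ifs <;> omega
  have hle := cmpResult_le (d := d) (p := p - (1 - flag)) (x := x) (y := y) hflag1
  have hiff : cmpResult d (p - (1 - flag)) flag x y = 1 ↔ SatEdge d p x y := cmpResult_eq_one_iff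
  have main : Runs checkEdge s (loadEdge.cost + ((p * 3 + 1) + (prepareCompare.cost +
      ((rows * (rowStep.cost + 1) + 1) + recordResult.cost)))) fun s' =>
      s'.reg 9 = if cmpResult d (p - (1 - flag)) flag x y = own then s.reg 9 else own := by
    refine (runs_eval rfl s).seq fun s₁ hf₁ h₁ => ?_
    have a11 : s₁.reg 11 = p := by simp [h₁, loadEdge, seqs, eval, hc.r4, hp]
    have a12 : s₁.reg 12 = w := by simp [h₁, loadEdge, seqs, eval, hc.r4, add_assoc, hw]
    have a16 : s₁.reg 16 = p := by simp [h₁, loadEdge, seqs, eval, hc.r4, hc.r0, hp]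
    have a19 : s₁.reg 19 = 1 := by simp [h₁, loadEdge, seqs, eval]
    have hc₁ := hc.frame hf₁ (by decide)
    refine (parity_spec hc₁.r4 a16 a19).seq fun s₂ hf₂ b19 => ?_
    have hc₂ := hc₁.frame hf₂ (by decide)
    have b11 : s₂.reg 11 = p := (hf₂.reg 11 (by decide)).trans a11
    have b12 : s₂.reg 12 = w := (hf₂.reg 12 (by decide)).trans a12
    have b7 : s₂.reg 7 = v := (hf₂.reg 7 (by decide)).trans ((hf₁.reg 7 (by decide)).trans h7)
    refine (runs_eval rfl s₂).seq fun s₃ hf₃ h₃ => ?_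
    have hc₃ := hc₂.frame hf₃ (by decide)
    have hm : s₃.mem = s.mem := by rw [hf₃.mem rfl, hf₂.mem rfl, hf₁.mem rfl]
    rw [← hflag] at b19
    have hcmp := compare_spec (p := p - (1 - flag)) (flag := flag) (v := v) (w := w) (rows := rows)
      hc₃ hv hfin
      (by simp [h₃, prepareCompare, seqs, eval, hc₂.r2, hc₂.r4, b11, b19])
      (by simp [h₃, prepareCompare, seqs, eval, hc₂.r2, hc₂.r4, b11, b19])
      (by simp [h₃, prepareCompare, seqs, eval, b19])
      (by simp [h₃, prepareCompare, seqs, eval, hc₂.r5, b7])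
      (by simp [h₃, prepareCompare, seqs, eval, hc₂.r5, b12])
      (by simp [h₃, prepareCompare, seqs, eval, hc₂.r5, hc₂.r6, b7])
    rw [hm] at hcmp
    refine hcmp.seq fun s₄ hf₄ c19 => ?_
    have hc₄ := hc₃.frame hf₄ (by decide)
    have c8 : s₄.reg 8 = own := by
      rw [hf₄.reg 8 (by decide), hf₃.reg 8 (by decide), hf₂.reg 8 (by decide),
        hf₁.reg 8 (by decide), h8]
    have c9 : s₄.reg 9 = s.reg 9 := by
      rw [hf₄.reg 9 (by decide), hf₃.reg 9 (by decide), hf₂.reg 9 (by decide),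
        hf₁.reg 9 (by decide)]
    refine (runs_eval rfl s₄).mono le_rfl fun s₅ _ h₅ => ?_
    rw [h₅]
    change s₄.reg 19 = cmpResult d (p - (1 - flag)) flag x y at c19
    generalize cmpResult d (p - (1 - flag)) flag x y = c at c19
    simp only [recordResult, seqs, eval, nop, setReg_reg, c8, c19, reduceIte, Nat.reduceEqDiff]
    by_cases h : c = own
    · have h' : c - own + (own - c) = 0 := by omega
      simp only [h', if_pos h, if_true, setReg_reg, c9, Nat.reduceEqDiff, if_false]
    · have h' : c - own + (own - c) ≠ 0 := by omega
      simp only [h', if_neg h, if_true, setReg_reg, hc₄.r0, Nat.reduceEqDiff, if_false,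
        add_zero]
  refine main.mono ?_ fun s' _ h => ?_
  · have : loadEdge.cost + prepareCompare.cost + recordResult.cost ≤ 18 := by decide
    omega
  · rw [h]
    congr 2
    split_ifs with h1
    · exact hiff.2 h1
    · have := mt hiff.1 h1
      omega

end Compare

/-! ### The edges of a node -/

section Edges

variable {n d base fin e₀ : ℕ}

/-- Compares the source of the edge at the address in the register 10 with the node in the
register 7. -/
def compareSource : Program := seqs (.load 20 10) [.sub 15 20 7, .sub 16 7 20, .add 20 15 16]

/-- Moves to the next edge. -/
def nextEdge : Program := seqs (.add 10 10 4) [.add 10 10 4, .add 10 10 4, .sub 28 5 10]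

/-- Tests an edge if it leaves the node in the register 7. -/
def edgeStep : Program :=
  seqs compareSource [.branch 20 nop checkEdge, nextEdge]

open Classical in
lemma edgeStep_spec {u p v w own rows : ℕ} {s : State} (hc : Consts n d base fin e₀ s) (hv : v < n)
    (hfin : fin = base + rows * n) (h7 : s.reg 7 = v) (h8 : s.reg 8 = own) (hown : own ≤ 1)
    (hu : s.mem (s.reg 10) = u) (hp : s.mem (s.reg 10 + 1) = p) (hw : s.mem (s.reg 10 + 2) = w)
    (hpd : p ≤ d) :
    Runs edgeStep s (3 * d + rows * (rowStep.cost + 1) + 29) fun s' =>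
      (s'.reg 9 = if u = v ∧ (if SatEdge d p (column n base rows s.mem v)
        (column n base rows s.mem w) then 1 else 0) ≠ own then own else s.reg 9) ∧
      s'.reg 10 = s.reg 10 + 3 ∧ s'.reg 28 = base - (s.reg 10 + 3) := by
  have main : Runs edgeStep s (compareSource.cost +
      ((3 * d + rows * (rowStep.cost + 1) + 20 + 1) + nextEdge.cost)) fun s' =>
      (s'.reg 9 = if u = v ∧ (if SatEdge d p (column n base rows s.mem v)
        (column n base rows s.mem w) then 1 else 0) ≠ own then own else s.reg 9) ∧
      s'.reg 10 = s.reg 10 + 3 ∧ s'.reg 28 = base - (s.reg 10 + 3) := by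
    refine (runs_eval rfl s).seq fun s₁ hf₁ h₁ => ?_
    have a20 : s₁.reg 20 = (u - v) + (v - u) := by simp [h₁, compareSource, seqs, eval, h7, hu]
    have hc₁ := hc.frame hf₁ (by decide)
    have a10 := hf₁.reg 10 (by decide)
    have a9 := hf₁.reg 9 (by decide)
    have hm₁ := hf₁.mem rfl
    refine (Runs.branch (Q := fun s' => s'.reg 9 = if u = v ∧ (if SatEdge d p
      (column n base rows s.mem v) (column n base rows s.mem w) then 1 else 0) ≠ own then own
        else s.reg 9) (fun h => ?_) fun h => ?_).seq fun s₂ hf₂ h₂ => ?_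
    · refine (runs_eval rfl s₁).mono (by simp [nop, cost]) fun s' hf _ => ?_
      rw [hf.reg 9 (by decide), a9, if_neg]
      rintro ⟨rfl, -⟩
      omega
    · have huv : u = v := by omega
      have := checkEdge_spec (p := p) (w := w) (own := own) hc₁ hv hfin
        ((hf₁.reg 7 (by decide)).trans h7) ((hf₁.reg 8 (by decide)).trans h8) hown
        (by rw [hm₁, a10, hp]) (by rw [hm₁, a10, hw]) hpd
      refine this.mono le_rfl fun s' hf h' => ?_
      rw [h', hm₁, a9]
      by_cases h3 : (if SatEdge d p (column n base rows s.mem v) (column n base rows s.mem w)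
        then 1 else 0) = own <;> simp [h3, huv]
    · refine (runs_eval rfl s₂).mono le_rfl fun s₃ hf₃ h₃ => ?_
      have b10 := (hf₂.reg 10 (by decide)).trans a10
      have hc₂ := hc₁.frame hf₂ (by decide)
      refine ⟨(hf₃.reg 9 (by decide)).trans h₂, ?_, ?_⟩ <;>
      simp [h₃, nextEdge, seqs, eval, hc₂.r4, hc₂.r5, b10, add_assoc]
  refine main.mono ?_ fun s' _ h => h
  have : compareSource.cost + nextEdge.cost = 8 := by decide
  omega

/-- The starting node, the owners of the nodes and the edges are in the memory. -/
structure HasInput (G : GameGraph (Fin n) d) (l : List (Edge (Fin n) d)) (M : ℕ → ℕ) : Prop where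
  start : M 2 = G.start
  owner : ∀ u : Fin n, M (4 + u) = (G.owner u).code
  edge : ∀ (j : ℕ) (h : j < l.length), M (4 + n + 3 * j) = l[j].1 ∧
    M (4 + n + 3 * j + 1) = (l[j].2.1 : ℕ) ∧ M (4 + n + 3 * j + 2) = l[j].2.2

/-- The vectors of the nodes that are stored in the memory. -/
def vectors (n base rows : ℕ) (M : ℕ → ℕ) (u : Fin n) : List ℕ := column n base rows M u

variable {G : GameGraph (Fin n) d} {l : List (Edge (Fin n) d)}

open Classical in
lemma goodNode_iff (hl : ∀ e, e ∈ l ↔ e ∈ G.edges) (μ : Fin n → List ℕ) (v : Fin n) :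
    (if ∃ e ∈ l, e.1 = v ∧ (if SatEdge d e.2.1 (μ v) (μ e.2.2) then 1 else 0) ≠ (G.owner v).code
      then (G.owner v).code else 1 - (G.owner v).code) = 0 ↔ GoodNode G μ v := by
  unfold GoodNode
  rcases G.owner v with _ | _
  · have h1 : ∀ e : Edge (Fin n) d, ((if SatEdge d e.2.1 (μ v) (μ e.2.2) then 1 else 0) ≠
        Player.even.code ↔ SatEdge d e.2.1 (μ v) (μ e.2.2)) := fun e => by
      split_ifs with h <;> simp [Player.code, h]
    simp only [h1, hl]
    split_ifs with h <;> simp only [h, Player.code, Nat.sub_zero, one_ne_zero]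
  · have h1 : ∀ e : Edge (Fin n) d, ((if SatEdge d e.2.1 (μ v) (μ e.2.2) then 1 else 0) ≠
        Player.odd.code ↔ ¬ SatEdge d e.2.1 (μ v) (μ e.2.2)) := fun e => by
      split_ifs with h <;> simp [Player.code, h]
    simp only [h1, hl]
    split_ifs with h
    · obtain ⟨e, h2, h3, h4⟩ := h
      simpa only [Player.code, one_ne_zero, false_iff] using fun h => h4 (h e h2 h3)
    · simp only [Player.code, Nat.sub_self, true_iff]
      exact fun e h2 h3 => by_contra fun h4 => h ⟨e, h2, h3, h4⟩

open Classical in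
lemma edges_spec {rows : ℕ} {s : State} (hc : Consts n d base fin (4 + n) s) (v : Fin n)
    (hbase : base = 4 + n + 3 * l.length) (hfin : fin = base + rows * n)
    (hin : HasInput G l s.mem) (hl : ∀ e, e ∈ l ↔ e ∈ G.edges) (h7 : s.reg 7 = v)
    (h8 : s.reg 8 = (G.owner v).code) (h9 : s.reg 9 = 1 - (G.owner v).code)
    (h10 : s.reg 10 = 4 + n) (h28 : s.reg 28 = base - (4 + n)) :
    Runs (.loop 28 edgeStep) s (l.length * (3 * d + rows * (rowStep.cost + 1) + 30) + 1) fun s' =>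
      s'.reg 9 = 0 ↔ GoodNode G (vectors n base rows s.mem) v := by
  set μ := vectors n base rows s.mem with hμ
  set own := (G.owner v).code with hown
  have hown1 : own ≤ 1 := by rw [hown]; cases G.owner v <;> simp [Player.code]
  refine (Runs.for (k := l.length) (T := 3 * d + rows * (rowStep.cost + 1) + 29) (I := fun k s' =>
    ∃ j, j + k = l.length ∧ s'.reg 10 = 4 + n + 3 * j ∧ s'.reg 28 = base - s'.reg 10 ∧
      s'.reg 9 = if ∃ e ∈ l.take j, e.1 = v ∧
        (if SatEdge d e.2.1 (μ v) (μ e.2.2) then 1 else 0) ≠ own then own else 1 - own)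
    ?_ ?_ ?_).mono le_rfl ?_
  · exact ⟨0, by simp, by simp [h10], by rw [h28, h10], by simp [h9]⟩
  · rintro k s' ⟨j, h1, h2, h3, -⟩
    rw [h3, h2, hbase]
    omega
  · rintro k s' ⟨j, h1, h2, h3, h4⟩ hf
    have hj : j < l.length := by omega
    obtain ⟨e1, e2, e3⟩ := hin.edge j hj
    have hm := hf.mem rfl
    have := edgeStep_spec (u := l[j].1) (p := l[j].2.1) (w := l[j].2.2) (own := own) (v := v)
      (hc.frame hf (by decide)) v.2 hfin ((hf.reg 7 (by decide)).trans h7)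
      ((hf.reg 8 (by decide)).trans h8) hown1 (by rw [hm, h2, e1]) (by rw [hm, h2, e2])
      (by rw [hm, h2, e3]) l[j].2.1.2.2
    refine this.mono le_rfl fun s'' _ ⟨h5, h6, h7⟩ => ⟨j + 1, by omega, by rw [h6, h2]; ring,
      by rw [h7, h6], ?_⟩
    have h11 : (∃ e ∈ l.take (j + 1), e.1 = v ∧
        (if SatEdge d e.2.1 (μ v) (μ e.2.2) then 1 else 0) ≠ own) ↔ (∃ e ∈ l.take j, e.1 = v ∧
        (if SatEdge d e.2.1 (μ v) (μ e.2.2) then 1 else 0) ≠ own) ∨ ((l[j].1 : ℕ) = v ∧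
        (if SatEdge d l[j].2.1 (μ v) (μ l[j].2.2) then 1 else 0) ≠ own) := by
      rw [List.take_succ_eq_append_getElem hj]
      simp only [List.mem_append, List.mem_singleton, or_and_right, exists_or, exists_eq_left,
        Fin.val_inj]
    rw [h5, h4, hm, if_congr h11 rfl rfl]
    change (if (l[j].1 : ℕ) = v ∧ (if SatEdge d l[j].2.1 (μ v) (μ l[j].2.2) then 1 else 0) ≠ own
      then own else _) = _
    by_cases h12 : (l[j].1 : ℕ) = v ∧
      (if SatEdge d l[j].2.1 (μ v) (μ l[j].2.2) then 1 else 0) ≠ own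
    · rw [if_pos h12, if_pos (Or.inr h12)]
    · rw [if_neg h12]
      exact if_congr (or_iff_left h12).symm rfl rfl
  · rintro s' - ⟨j, h1, h2, h3, h4⟩
    rw [h4, ← goodNode_iff hl, List.take_of_length_le (by omega)]

end Edges

/-! ### Incrementing a vector -/

section Increment

variable {n d base fin e₀ : ℕ}

lemma column_update {rows : ℕ} {M : ℕ → ℕ} {u v i c : ℕ} (hu : u < n) (hv : v < n) :
    column n base rows (Function.update M (base + i * n + v) c) u =
      if u = v then (column n base rows M v).set i c else column n base rows M u := by
  have key : ∀ j, base + j * n + u = base + i * n + v ↔ j = i ∧ u = v := by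
    intro j
    constructor
    · intro h
      rcases lt_trichotomy j i with hj | rfl | hj
      · have := Nat.mul_le_mul_right n (show j + 1 ≤ i from hj)
        rw [add_mul] at this
        omega
      · exact ⟨rfl, by omega⟩
      · have := Nat.mul_le_mul_right n (show i + 1 ≤ j from hj)
        rw [add_mul] at this
        omega
    · rintro ⟨rfl, rfl⟩
      rfl
  split_ifs with huv
  · subst huv
    refine List.ext_getElem (by simp [column]) fun j h1 h2 => ?_
    simp only [column, List.getElem_map, List.getElem_range, Function.update_apply, key,
      List.getElem_set, and_true, eq_comm]
  · refine List.ext_getElem (by simp [column]) fun j h1 h2 => ?_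
    simp only [column, List.getElem_map, List.getElem_range, Function.update_apply, key, huv,
      and_false, if_false]

/-- Loads the digit at the address in the register 13; the register 29 tells whether it is
`2 d`. -/
def readDigit : Program :=
  seqs (.load 15 13) [.sub 20 22 15, .sub 25 15 22, .add 20 20 25, .sub 29 4 20]

/-- Replaces the current digit by `0` and moves to the preceding digit. -/
def carry : Program := seqs (.store 13 0) [.sub 13 13 1, readDigit]

/-- Increments the vector of the node in the register 7. -/
def increment : Program :=
  seqs (.seq (.sub 13 6 1) (.seq (.add 13 13 7) readDigit))
    [.loop 29 carry, .seq (.add 15 15 4) (.store 13 15)]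

/-- The invariant of the loop that propagates the carry, where `M` and `x` are the memory and the
vector before the increment: the digits after the position `k` have been `2 d` and are `0` now. -/
structure CarryInv (n d base L v : ℕ) (M : ℕ → ℕ) (x : List ℕ) (k : ℕ) (s : State) : Prop where
  low : ∀ i < base, s.mem i = M i
  other : ∀ u < n, u ≠ v → column n base (L + 1) s.mem u = column n base (L + 1) M u
  split : ∃ y a t, y.length = k ∧ column n base (L + 1) s.mem v = y ++ a :: List.replicate t 0 ∧
    x = y ++ a :: List.replicate t (2 * d) ∧ s.reg 15 = a ∧
    s.reg 29 = 1 - (2 * d - a + (a - 2 * d))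
  ptr : s.reg 13 = base + k * n + v

lemma mem_eq_of_column {rows k v a : ℕ} {M : ℕ → ℕ} {y z : List ℕ} (hy : y.length = k)
    (h : column n base rows M v = y ++ a :: z) : M (base + k * n + v) = a := by
  have hlen := congrArg List.length h
  simp only [column, List.length_map, List.length_range, List.length_append,
    List.length_cons] at hlen
  have h1 := column_drop (n := n) (base := base) (M := M) (v := v) (show k < rows by omega)
  rw [h, ← hy, List.drop_left, hy] at h1
  exact (List.cons.inj h1).1.symm

/-- The leading digit is not `2 d`, so the carry stops before it has passed through all digits; it
turns the leading digit into that of `⊤` if all other digits are `2 d`. -/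
lemma increment_spec {L v : ℕ} {s : State} (hc : Consts n d base fin e₀ s) (hv : v < n)
    (hfin : fin = base + (L + 1) * n) (h7 : s.reg 7 = v)
    (hvec : IsVec d L (column n base (L + 1) s.mem v))
    (hlow : IsLow d (column n base (L + 1) s.mem v)) :
    Runs increment s (L * (carry.cost + 1) + 20) fun s' =>
      (∀ i < base, s'.mem i = s.mem i) ∧
      (∀ u < n, u ≠ v → column n base (L + 1) s'.mem u = column n base (L + 1) s.mem u) ∧
      IsVec d L (column n base (L + 1) s'.mem v) ∧
      val (2 * d + 1) (column n base (L + 1) s'.mem v) =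
        val (2 * d + 1) (column n base (L + 1) s.mem v) + 1 := by
  set x := column n base (L + 1) s.mem v with hx
  have hlen : x.length = L + 1 := hvec.length
  obtain ⟨b, xs, hbx, hb, hxs, hdig⟩ := hvec
  obtain rfl : b = 2 * d + 1 := by simpa [IsLow, hbx] using hlow
  have main : Runs increment s (7 + ((L * (carry.cost + 1) + 1) + 2)) fun s' =>
      (∀ i < base, s'.mem i = s.mem i) ∧
      (∀ u < n, u ≠ v → column n base (L + 1) s'.mem u = column n base (L + 1) s.mem u) ∧
      IsVec d L (column n base (L + 1) s'.mem v) ∧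
      val (2 * d + 1) (column n base (L + 1) s'.mem v) = val (2 * d + 1) x + 1 := by
    refine (runs_eval rfl s).seq fun s₁ hf₁ h₁ => ?_
    have hc₁ := hc.frame hf₁ (by decide)
    have hm₁ : s₁.mem = s.mem := hf₁.mem rfl
    have a13 : s.reg 6 - s.reg 1 + s.reg 7 = base + L * n + v := by
      rw [hc.r6, hc.r1, h7, hfin, add_mul, one_mul]
      omega
    have hI : CarryInv n d base L v s.mem x L s₁ := by
      refine ⟨fun i _ => by rw [hm₁], fun u _ _ => by rw [hm₁], ?_, ?_⟩
      · obtain ⟨y, a, hya⟩ : ∃ y a, x = y ++ [a] := by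
          rcases List.eq_nil_or_concat x with h | ⟨y, a, h⟩
          · rw [h] at hbx; simp at hbx
          · exact ⟨y, a, by simpa using h⟩
        have hy : y.length = L := by
          rw [hya] at hlen
          simpa using hlen
        have hma := mem_eq_of_column hy (hx.symm.trans hya)
        refine ⟨y, a, 0, hy, by rw [hm₁, ← hx, hya]; rfl, by rw [hya]; rfl, ?_, ?_⟩ <;>
        simp [h₁, readDigit, seqs, eval, a13, hma, hc.r22, hc.r4]
      · simp [h₁, readDigit, seqs, eval, a13]
    refine (Runs.loop (T := carry.cost) hI fun k s₂ hI₂ hf₂ hne => ?_).seq fun s₂ hf₂ hI₂ => ?_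
    · obtain ⟨hI1, hI2, ⟨y, a, t, hy, hcol, hxy, h15, h29⟩, hptr⟩ := hI₂
      have hc₂ := hc₁.frame hf₂ (by decide)
      have ha : a = 2 * d := by omega
      obtain ⟨y', a', rfl⟩ : ∃ y' a', y = y' ++ [a'] := by
        rcases List.eq_nil_or_concat y with h | ⟨y', a', h⟩
        · rw [h, hbx] at hxy
          have := (List.cons.inj hxy).1
          omega
        · exact ⟨y', a', by simpa using h⟩
      have hk : y'.length + 1 = k := by simpa using hy
      subst hk
      have hptr' : s₂.reg 13 - n = base + y'.length * n + v := by
        rw [hptr, add_mul, one_mul]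
        omega
      refine (runs_eval rfl s₂).mono le_rfl fun s₃ hf₃ h₃ => ⟨y'.length, Nat.lt_succ_self _, ?_⟩
      have hm₃ : s₃.mem = Function.update s₂.mem (base + (y'.length + 1) * n + v) 0 := by
        rw [h₃, ← hptr, ← hc₂.r0]
        rfl
      have hcol₃ : column n base (L + 1) s₃.mem v = y' ++ a' :: List.replicate (t + 1) 0 := by
        rw [hm₃, column_update hv hv, if_pos rfl, hcol]
        have : y'.length + 1 = (y' ++ [a']).length := by simp
        rw [this, List.set_append_right _ _ le_rfl, Nat.sub_self]
        simp [List.replicate_succ]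
      have hma := mem_eq_of_column rfl hcol₃
      have h13 : s₃.reg 13 = base + y'.length * n + v := by
        simp [h₃, carry, readDigit, seqs, eval, hc₂.r1, hptr']
      have h15 : s₃.reg 15 = a' := by
        rw [← hma, ← h13]
        simp [h₃, carry, readDigit, seqs, eval]
      refine ⟨fun i hi => ?_, fun u hu huv => ?_, ⟨y', a', t + 1, rfl, hcol₃, ?_, h15, ?_⟩, h13⟩
      · rw [hm₃, Function.update_of_ne (by omega), hI1 i hi]
      · rw [hm₃, column_update hu hv, if_neg huv, hI2 u hu huv]
      · rw [hxy, ha]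
        simp [List.replicate_succ]
      · rw [← h15]
        simp [h₃, carry, readDigit, seqs, eval, hc₂.r4, hc₂.r22]
    · obtain ⟨⟨k, hI1, hI2, ⟨y, a, t, hy, hcol, hxy, h15, h29⟩, hptr⟩, h29'⟩ := hI₂
      have hc₂ := hc₁.frame hf₂ (by decide)
      have ha : a ≠ 2 * d := by omega
      refine (runs_eval rfl s₂).mono le_rfl fun s₃ hf₃ h₃ => ?_
      have hm₃ : s₃.mem = Function.update s₂.mem (base + k * n + v) (a + 1) := by
        rw [h₃, ← hptr, ← h15, ← hc₂.r4]
        simp [seqs, eval]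
      have hcol₃ : column n base (L + 1) s₃.mem v = y ++ (a + 1) :: List.replicate t 0 := by
        rw [hm₃, column_update hv hv, if_pos rfl, hcol, ← hy,
          List.set_append_right _ _ le_rfl, Nat.sub_self]
        simp
      refine ⟨fun i hi => ?_, fun u hu huv => ?_, ?_, ?_⟩
      · rw [hm₃, Function.update_of_ne (by omega), hI1 i hi]
      · rw [hm₃, column_update hu hv, if_neg huv, hI2 u hu huv]
      · rw [hcol₃]
        rw [hbx] at hxy
        cases y with
        | nil =>
          obtain ⟨rfl, rfl⟩ := List.cons.inj hxy
          refine ⟨_, _, rfl, Or.inr rfl, by simpa using hxs, fun b hb => ?_⟩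
          rw [List.eq_of_mem_replicate hb]
          omega
        | cons c y =>
          obtain ⟨rfl, rfl⟩ := List.cons.inj hxy
          refine ⟨_, _, rfl, Or.inl rfl, by simpa using hxs, fun b hb => ?_⟩
          rcases List.mem_append.1 hb with hb | hb
          · exact hdig b (List.mem_append_left _ hb)
          · rcases List.mem_cons.1 hb with rfl | hb
            · have := hdig a (by simp)
              omega
            · rw [List.eq_of_mem_replicate hb]
              omega
      · rw [hcol₃, hxy, val_increment]
  exact main.mono (by omega) fun s' _ h => h

end Increment

/-! ### The lifting algorithm -/

section Algorithm

variable {n d base fin e₀ : ℕ}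

/-- Prepares the loop over the edges of the node in the register 7. -/
def prepareNode : Program :=
  seqs (.const 20 4) [.add 20 20 7, .load 8 20, .sub 9 4 8, .add 10 24 0, .sub 28 5 10]

/-- Tests the condition of a progress measure for the node in the register 7, and increments its
vector if the condition fails. -/
def processNode : Program :=
  seqs prepareNode [.loop 28 edgeStep, .branch 9 (.seq increment (.const 21 1)) nop]

/-- Tests whether the vector of the node in the register 7 is `⊤`. -/
def testTop : Program := seqs (.add 13 5 7) [.load 15 13, .sub 20 15 23]

/-- Lifts the node in the register 7, if necessary. -/
def liftNode : Program := .seq testTop (.branch 20 nop processNode)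

/-- The memory contains the input and vectors that are below every progress measure. -/
structure Good (G : GameGraph (Fin n) d) (l : List (Edge (Fin n) d)) (L base : ℕ) (M : ℕ → ℕ) :
    Prop where
  input : HasInput G l M
  vec : ∀ u, IsVec d L (vectors n base (L + 1) M u)
  below : Below G L (vectors n base (L + 1) M)

/-- A bound on the number of liftings to come. -/
def slack (n d L base : ℕ) (M : ℕ → ℕ) : ℕ :=
  ∑ u : Fin n, ((2 * d + 3) * (2 * d + 1) ^ L - val (2 * d + 1) (vectors n base (L + 1) M u))

variable {G : GameGraph (Fin n) d} {l : List (Edge (Fin n) d)} {L : ℕ}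

lemma HasInput.of_eq {M M' : ℕ → ℕ} (h : HasInput G l M)
    (heq : ∀ i < 4 + n + 3 * l.length, M' i = M i) : HasInput G l M' := by
  refine ⟨by rw [heq _ (by omega), h.start], fun u => by rw [heq _ (by omega), h.owner],
    fun j hj => ?_⟩
  rw [heq _ (by omega), heq _ (by omega), heq _ (by omega)]
  exact h.edge j hj

lemma vectors_eq_cons (M : ℕ → ℕ) (v : Fin n) :
    ∃ x, vectors n base (L + 1) M v = M (base + v) :: x := by
  have := column_drop (n := n) (base := base) (rows := L + 1) (M := M) (v := v) (i := 0) (by omega)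
  rw [List.drop_zero, Nat.zero_mul, Nat.add_zero] at this
  exact ⟨_, this⟩

lemma isLow_iff {M : ℕ → ℕ} {v : Fin n} (h : IsVec d L (vectors n base (L + 1) M v)) :
    IsLow d (vectors n base (L + 1) M v) ↔ M (base + v) - (2 * d + 1) = 0 := by
  obtain ⟨x, hx⟩ := vectors_eq_cons (base := base) (L := L) M v
  obtain ⟨a, y, hy, ha, -, -⟩ := h
  rw [hx] at hy
  obtain ⟨h1, -⟩ := List.cons.inj hy
  rw [IsLow, hx]
  simp only [List.head?_cons, Option.some.injEq]
  omega

/-- A bound on the number of steps of the loop over the edges. -/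
def edgesTime (d m L : ℕ) : ℕ := m * (3 * d + (L + 1) * (rowStep.cost + 1) + 30) + 1

/-- A bound on the number of steps of `liftNode`. -/
def nodeTime (d m L : ℕ) : ℕ := edgesTime d m L + L * (carry.cost + 1) + 32

lemma testTop_spec {s : State} {v : Fin n} (hc : Consts n d base fin e₀ s) (h7 : s.reg 7 = v)
    (hvec : IsVec d L (vectors n base (L + 1) s.mem v)) :
    Runs testTop s 3 fun s' => s'.reg 20 = 0 ↔ IsLow d (vectors n base (L + 1) s.mem v) := by
  refine (runs_eval rfl s).mono le_rfl fun s' _ h => ?_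
  rw [isLow_iff hvec, h]
  simp [testTop, seqs, eval, hc.r5, h7, hc.r23]

lemma processNode_spec {s : State} (v : Fin n) (hc : Consts n d base fin (4 + n) s)
    (hbase : base = 4 + n + 3 * l.length) (hfin : fin = base + (L + 1) * n)
    (hgood : Good G l L base s.mem) (hl : ∀ e, e ∈ l ↔ e ∈ G.edges) (h7 : s.reg 7 = v)
    (hlow : IsLow d (vectors n base (L + 1) s.mem v)) :
    Runs processNode s (edgesTime d l.length L + L * (carry.cost + 1) + 28) fun s' =>
      (s'.reg 21 = s.reg 21 ∧ s'.mem = s.mem ∧ GoodNode G (vectors n base (L + 1) s.mem) v) ∨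
      (s'.reg 21 = 1 ∧ Good G l L base s'.mem ∧
        slack n d L base s'.mem < slack n d L base s.mem) := by
  have main : Runs processNode s (prepareNode.cost + (edgesTime d l.length L +
      ((L * (carry.cost + 1) + 20 + 1) + 1))) fun s' =>
      (s'.reg 21 = s.reg 21 ∧ s'.mem = s.mem ∧ GoodNode G (vectors n base (L + 1) s.mem) v) ∨
      (s'.reg 21 = 1 ∧ Good G l L base s'.mem ∧
        slack n d L base s'.mem < slack n d L base s.mem) := by
    refine (runs_eval rfl s).seq fun s₁ hf₁ h₁ => ?_
    have hc₁ := hc.frame hf₁ (by decide)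
    have hm₁ := hf₁.mem rfl
    have a8 : s₁.reg 8 = (G.owner v).code := by
      rw [← hgood.input.owner v, ← h7, h₁]
      simp [prepareNode, seqs, eval]
    have a9 : s₁.reg 9 = 1 - (G.owner v).code := by
      rw [← a8, h₁]
      simp [prepareNode, seqs, eval, hc.r4]
    have h := edges_spec (rows := L + 1) hc₁ v hbase hfin (hm₁ ▸ hgood.input) hl
      ((hf₁.reg 7 (by decide)).trans h7) a8 a9
      (by simp [h₁, prepareNode, seqs, eval, hc.r24, hc.r0])
      (by simp [h₁, prepareNode, seqs, eval, hc.r24, hc.r0, hc.r5])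
    rw [hm₁] at h
    refine h.seq fun s₂ hf₂ h₂ => ?_
    have hc₂ := hc₁.frame hf₂ (by decide)
    have hm₂ : s₂.mem = s.mem := (hf₂.mem rfl).trans hm₁
    have b21 : s₂.reg 21 = s.reg 21 := by rw [hf₂.reg 21 (by decide), hf₁.reg 21 (by decide)]
    have b7 : s₂.reg 7 = v := by rw [hf₂.reg 7 (by decide), hf₁.reg 7 (by decide), h7]
    refine Runs.branch (fun h9 => ?_) fun h9 => ?_
    · have hvec := hgood.vec v
      rw [← hm₂] at hvec hlow
      refine ((increment_spec hc₂ v.2 hfin b7 hvec hlow).seq (T' := 1)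
        fun s₃ hf₃ ⟨i1, i2, i3, i4⟩ => ?_).mono le_rfl fun s' _ h => h
      refine (runs_eval rfl s₃).mono le_rfl fun s₄ hf₄ h₄ => Or.inr ⟨by rw [h₄]; simp [eval], ?_⟩
      have hm₄ := hf₄.mem rfl
      rw [hm₄]
      have hupd : vectors n base (L + 1) s₃.mem =
          Function.update (vectors n base (L + 1) s.mem) v (vectors n base (L + 1) s₃.mem v) := by
        funext u
        by_cases huv : u = v
        · rw [huv, Function.update_self]
        · rw [Function.update_of_ne huv, ← hm₂]
          exact i2 u u.2 fun h => huv (Fin.ext h)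
      rw [hm₂] at i1 i4
      refine ⟨⟨hgood.input.of_eq fun i hi => i1 i (hbase ▸ hi), fun u => ?_, ?_⟩, ?_⟩
      · rw [hupd]
        by_cases huv : u = v
        · rw [huv, Function.update_self]
          exact i3
        · rw [Function.update_of_ne huv]
          exact hgood.vec u
      · rw [hupd]
        exact hgood.below.lift hgood.vec (fun hg => h9 (h₂.2 hg)) i4
      · refine Finset.sum_lt_sum (fun u _ => ?_) ⟨v, Finset.mem_univ _, ?_⟩
        · by_cases huv : u = v
          · subst huv
            change _ - val _ (column _ _ _ _ _) ≤ _
            rw [i4]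
            exact Nat.sub_le_sub_left (Nat.le_succ _) _
          · rw [hupd, Function.update_of_ne huv]
        · have h5 := (hgood.vec v).val_lt
          change _ - val _ (column _ _ _ _ _) < _
          rw [i4]
          change val _ (column _ _ _ _ _) < _ at h5
          change _ < _ - val _ (column _ _ _ _ _)
          omega
    · refine (runs_eval rfl s₂).mono (by simp [nop, cost]) fun s₃ hf₃ _ => Or.inl ⟨?_, ?_, h₂.1 h9⟩
      · rw [hf₃.reg 21 (by decide), b21]
      · rw [hf₃.mem rfl, hm₂]
  have : prepareNode.cost = 6 := rfl
  exact main.mono (by omega) fun s' _ h => h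

lemma liftNode_spec {s : State} (v : Fin n) (hc : Consts n d base fin (4 + n) s)
    (hbase : base = 4 + n + 3 * l.length) (hfin : fin = base + (L + 1) * n)
    (hgood : Good G l L base s.mem) (hl : ∀ e, e ∈ l ↔ e ∈ G.edges) (h7 : s.reg 7 = v) :
    Runs liftNode s (nodeTime d l.length L) fun s' =>
      (s'.reg 21 = s.reg 21 ∧ s'.mem = s.mem ∧ (IsLow d (vectors n base (L + 1) s.mem v) →
        GoodNode G (vectors n base (L + 1) s.mem) v)) ∨
      (s'.reg 21 = 1 ∧ Good G l L base s'.mem ∧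
        slack n d L base s'.mem < slack n d L base s.mem) := by
  refine ((testTop_spec hc h7 (hgood.vec v)).seq (T' := edgesTime d l.length L +
    L * (carry.cost + 1) + 28 + 1) fun s₁ hf₁ h₁ => ?_).mono ?_ fun s' _ h => h
  · have hm₁ := hf₁.mem rfl
    refine Runs.branch (fun h20 => ?_) fun h20 => ?_
    · refine (runs_eval rfl s₁).mono (by simp [nop, cost]) fun s₃ hf₃ _ => Or.inl ⟨?_, ?_, ?_⟩
      · rw [hf₃.reg 21 (by decide), hf₁.reg 21 (by decide)]
      · rw [hf₃.mem rfl, hm₁]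
      · exact fun h => absurd (h₁.2 h) h20
    · have := processNode_spec v (hc.frame hf₁ (by decide)) hbase hfin (hm₁ ▸ hgood) hl
        ((hf₁.reg 7 (by decide)).trans h7) (hm₁ ▸ h₁.1 h20)
      rw [hm₁, hf₁.reg 21 (by decide)] at this
      exact this.mono le_rfl fun s' _ h => h.imp_left fun ⟨h1, h2, h3⟩ => ⟨h1, h2, fun _ => h3⟩
  · unfold nodeTime
    omega

/-- One pass over all nodes; the register 21 tells whether some vector has been incremented. -/
def pass : Program :=
  seqs (.seq (.const 21 0) (.seq (.const 7 0) (.sub 27 1 7)))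
    [.loop 27 (.seq liftNode (.seq (.add 7 7 4) (.sub 27 1 7)))]

lemma pass_spec {s : State} (hc : Consts n d base fin (4 + n) s)
    (hbase : base = 4 + n + 3 * l.length) (hfin : fin = base + (L + 1) * n)
    (hgood : Good G l L base s.mem) (hl : ∀ e, e ∈ l ↔ e ∈ G.edges) :
    Runs pass s (n * (nodeTime d l.length L + 3) + 4) fun s' =>
      (s'.reg 21 = 0 ∧ Good G l L base s'.mem ∧ ∀ u, IsLow d (vectors n base (L + 1) s'.mem u) →
        GoodNode G (vectors n base (L + 1) s'.mem) u) ∨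
      (s'.reg 21 = 1 ∧ Good G l L base s'.mem ∧
        slack n d L base s'.mem < slack n d L base s.mem) := by
  refine ((runs_eval rfl s).seq (T' := n * (nodeTime d l.length L + 3) + 1)
    fun s₁ hf₁ h₁ => ?_).mono ?_ fun s' _ h => h
  · have hc₁ := hc.frame hf₁ (by decide)
    have hm₁ : s₁.mem = s.mem := hf₁.mem rfl
    refine (Runs.for (k := n) (T := nodeTime d l.length L + 2) (I := fun k s' =>
      ∃ j, j + k = n ∧ s'.reg 7 = j ∧ s'.reg 27 = n - j ∧
      ((s'.reg 21 = 0 ∧ s'.mem = s.mem ∧ ∀ u : Fin n, u < j →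
        IsLow d (vectors n base (L + 1) s.mem u) → GoodNode G (vectors n base (L + 1) s.mem) u) ∨
      (s'.reg 21 = 1 ∧ Good G l L base s'.mem ∧
        slack n d L base s'.mem < slack n d L base s.mem))) ?_ ?_ ?_).mono le_rfl ?_
    · exact ⟨0, by simp, by simp [h₁, eval], by simp [h₁, eval, hc.r1],
        Or.inl ⟨by simp [h₁, eval], hm₁, fun u hu => absurd hu (Nat.not_lt_zero _)⟩⟩
    · rintro k s' ⟨j, h1, -, h3, -⟩
      omega
    · rintro k s₂ ⟨j, h1, h2, h3, h4⟩ hf₂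
      have hc₂ := hc₁.frame hf₂ (by decide)
      have hj : j < n := by omega
      have hgood₂ : Good G l L base s₂.mem := by
        rcases h4 with ⟨-, h5, -⟩ | ⟨-, h5, -⟩
        · exact h5 ▸ hgood
        · exact h5
      refine (liftNode_spec ⟨j, hj⟩ hc₂ hbase hfin hgood₂ hl h2).seq fun s₃ hf₃ h₃ => ?_
      have hc₃ := hc₂.frame hf₃ (by decide)
      have h7 : s₃.reg 7 = j := (hf₃.reg 7 (by decide)).trans h2
      refine (runs_eval rfl s₃).mono le_rfl fun s₄ hf₄ h₄ => ?_
      refine ⟨j + 1, by omega, by simp [h₄, eval, h7, hc₃.r4],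
        by simp [h₄, eval, h7, hc₃.r4, hc₃.r1], ?_⟩
      rw [hf₄.reg 21 (by decide), hf₄.mem rfl]
      rcases h₃ with ⟨h5, h6, h8⟩ | ⟨h5, h6, h8⟩
      · rw [h5, h6]
        rcases h4 with ⟨h9, h10, h11⟩ | h4
        · refine Or.inl ⟨h9, h10, fun u hu hlow => ?_⟩
          rcases Nat.lt_succ_iff_lt_or_eq.1 hu with hu | hu
          · exact h11 u hu hlow
          · obtain rfl : u = ⟨j, hj⟩ := Fin.ext hu
            rw [h10] at h8
            exact h8 hlow
        · exact Or.inr h4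
      · refine Or.inr ⟨h5, h6, h8.trans_le ?_⟩
        rcases h4 with ⟨-, h10, -⟩ | ⟨-, -, h10⟩
        · rw [h10]
        · exact h10.le
    · rintro s' - ⟨j, h1, -, -, ⟨h2, h3, h4⟩ | h⟩
      · refine Or.inl ⟨h2, h3 ▸ hgood, fun u => ?_⟩
        rw [h3]
        exact h4 u (by omega)
      · exact Or.inr h
  · simp only [cost]
    omega

/-- The loop that lifts the nodes until all vectors except `⊤` satisfy the condition of a progress
measure. -/
def liftAll : Program := .seq (.const 21 1) (.loop 21 pass)

lemma liftAll_spec {s : State} (hc : Consts n d base fin (4 + n) s)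
    (hbase : base = 4 + n + 3 * l.length) (hfin : fin = base + (L + 1) * n)
    (hgood : Good G l L base s.mem) (hl : ∀ e, e ∈ l ↔ e ∈ G.edges) :
    Runs liftAll s ((slack n d L base s.mem + 1) * (n * (nodeTime d l.length L + 3) + 5) + 2)
      fun s' => Good G l L base s'.mem ∧ ∀ u, IsLow d (vectors n base (L + 1) s'.mem u) →
        GoodNode G (vectors n base (L + 1) s'.mem) u := by
  refine ((runs_eval rfl s).seq (T' := (slack n d L base s.mem + 1) *
    (n * (nodeTime d l.length L + 3) + 5) + 1) fun s₁ hf₁ h₁ => ?_).mono ?_ fun s' _ h => h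
  · have hc₁ := hc.frame hf₁ (by decide)
    have hm₁ : s₁.mem = s.mem := hf₁.mem rfl
    refine (Runs.loop (k := slack n d L base s.mem + 1) (T := n * (nodeTime d l.length L + 3) + 4)
      (I := fun k s' => Good G l L base s'.mem ∧
        ((s'.reg 21 = 1 ∧ k = slack n d L base s'.mem + 1) ∨
        (s'.reg 21 = 0 ∧ k = 0 ∧ ∀ u, IsLow d (vectors n base (L + 1) s'.mem u) →
          GoodNode G (vectors n base (L + 1) s'.mem) u))) ?_ ?_).mono le_rfl ?_
    · exact ⟨hm₁ ▸ hgood, Or.inl ⟨by simp [h₁, eval], by rw [hm₁]⟩⟩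
    · rintro k s₂ ⟨hg, ⟨-, rfl⟩ | ⟨h2, -⟩⟩ hf₂ hne
      · refine (pass_spec (hc₁.frame hf₂ (by decide)) hbase hfin hg hl).mono le_rfl
          fun s₃ _ h => ?_
        rcases h with ⟨h2, h3, h4⟩ | ⟨h2, h3, h4⟩
        · exact ⟨0, by omega, h3, Or.inr ⟨h2, rfl, h4⟩⟩
        · exact ⟨_, by omega, h3, Or.inl ⟨h2, rfl⟩⟩
      · exact absurd h2 hne
    · rintro s' - ⟨⟨k, hg, ⟨h1, -⟩ | ⟨-, -, h⟩⟩, h0⟩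
      · omega
      · exact ⟨hg, h⟩
  · simp only [cost]
    omega

/-- Writes the answer to the register 0. -/
def answer : Program :=
  seqs (.const 20 2) [.load 7 20, testTop, .branch 20 (.const 0 0) (.const 0 1)]

lemma answer_spec {s : State} (hc : Consts n d base fin (4 + n) s)
    (hgood : Good G l L base s.mem) (hL : n < 2 ^ L)
    (hall : ∀ u, IsLow d (vectors n base (L + 1) s.mem u) →
      GoodNode G (vectors n base (L + 1) s.mem) u) :
    Runs answer s 7 fun s' => (G.HasWinningStrategy .even → s'.reg 0 = 1) ∧
      (¬ G.HasWinningStrategy .even → s'.reg 0 = 0) := by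
  change Runs answer s (1 + (1 + (3 + (1 + 1)))) _
  refine (runs_eval rfl s).seq fun s₁ hf₁ h₁ => (runs_eval rfl s₁).seq fun s₂ hf₂ h₂ => ?_
  have hc₂ := (hc.frame hf₁ (by decide)).frame hf₂ (by decide)
  have hm₂ : s₂.mem = s.mem := (hf₂.mem rfl).trans (hf₁.mem rfl)
  have h7 : s₂.reg 7 = G.start := by simp [h₂, h₁, eval, hgood.input.start]
  refine (testTop_spec hc₂ h7 (hm₂ ▸ hgood.vec _)).seq fun s₃ hf₃ h₃ => ?_
  rw [hm₂] at h₃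
  refine Runs.branch (fun h => ?_) fun h => ?_
  · have hnot := not_winning_of_top hL hgood.vec hgood.below fun h' => h (h₃.2 h')
    exact (runs_eval rfl s₃).mono le_rfl fun s₄ _ h₄ =>
      ⟨fun h => absurd h hnot, fun _ => by simp [h₄, eval]⟩
  · have hwin := winning_of_good hgood.vec hall (h₃.1 h)
    exact (runs_eval rfl s₃).mono le_rfl fun s₄ _ h₄ =>
      ⟨fun _ => by simp [h₄, eval], fun h => absurd hwin h⟩

end Algorithm

/-! ### The input -/

lemma getD_flatMap_triple {α : Type*} (f g h : α → ℕ) (l : List α) (j : ℕ) (hj : j < l.length) :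
    (l.flatMap fun e => [f e, g e, h e]).getD (3 * j) 0 = f l[j] ∧
    (l.flatMap fun e => [f e, g e, h e]).getD (3 * j + 1) 0 = g l[j] ∧
    (l.flatMap fun e => [f e, g e, h e]).getD (3 * j + 2) 0 = h l[j] := by
  induction l generalizing j with
  | nil => simp at hj
  | cons e l ih =>
    cases j with
    | zero => simp
    | succ j => exact ih j (by simpa using hj)

section Input

variable {n d : ℕ} (G : GameGraph (Fin n) d) (l : List (Edge (Fin n) d))

lemma length_encode : (G.encode l).length = 4 + n + 3 * l.length := by
  simp [GameGraph.encode, List.length_flatMap]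
  omega

lemma input_header : (input (G.encode l)).mem 0 = n ∧ (input (G.encode l)).mem 1 = d ∧
    (input (G.encode l)).mem 2 = G.start ∧ (input (G.encode l)).mem 3 = l.length := by
  simp [input, GameGraph.encode]

lemma hasInput_input : HasInput G l (input (G.encode l)).mem := by
  have hlen : ([n, d, G.start.1, l.length] ++ List.ofFn fun u => (G.owner u).code).length =
      4 + n := by
    simp
    omega
  refine ⟨(input_header G l).2.2.1, fun u => ?_, fun j hj => ?_⟩
  · change (G.encode l).getD (4 + u) 0 = _
    rw [GameGraph.encode, List.getD_append _ _ _ _ (by rw [hlen]; omega),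
      List.getD_append_right _ _ _ _ (by simp)]
    simp
  · have key : ∀ i, (input (G.encode l)).mem (4 + n + i) =
        (l.flatMap fun e => [e.1.1, (e.2.1 : ℕ), e.2.2.1]).getD i 0 := fun i => by
      change (G.encode l).getD _ 0 = _
      rw [GameGraph.encode, List.getD_append_right _ _ _ _ (by rw [hlen]; omega), hlen,
        Nat.add_sub_cancel_left]
    rw [add_assoc _ (3 * j), add_assoc _ (3 * j), key, key, key]
    exact getD_flatMap_triple (fun e : Edge (Fin n) d => e.1.1) (fun e => (e.2.1 : ℕ))
      (fun e => e.2.2.1) l j hj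

lemma input_mem_of_le {i : ℕ} (hi : 4 + n + 3 * l.length ≤ i) :
    (input (G.encode l)).mem i = 0 :=
  List.getD_eq_default _ _ ((length_encode G l).trans_le hi)

end Input

/-! ### The initialization -/

/-- Loads the parameters and computes the addresses. -/
def setup : Program :=
  seqs (.const 4 1) [.const 20 0, .load 1 20, .load 2 4, .const 20 3, .load 3 20, .add 22 2 2,
    .add 23 22 4, .const 24 4, .add 24 24 1, .add 5 24 3, .add 5 5 3, .add 5 5 3, .add 6 5 1,
    .const 15 1, .add 20 1 4, .sub 20 20 15]

/-- Computes the end of the memory block of the vectors, by doubling the register 15 until it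
exceeds the number of nodes. -/
def reserveRows : Program :=
  .loop 20 (seqs (.add 15 15 15) [.add 6 6 1, .add 20 1 4, .sub 20 20 15])

/-- Writes the leading digits of all vectors. -/
def fillRow : Program :=
  .seq (seqs (.add 13 5 0) [.add 16 5 1, .sub 20 16 13])
    (.loop 20 (seqs (.store 13 23) [.add 13 13 4, .sub 20 16 13]))

/-- The program that solves parity games. -/
def solver : Program := seqs setup [reserveRows, fillRow, liftAll, answer]

section Initialization

variable {n d base : ℕ}

lemma reserveRows_spec {s : State} (hn : n ≠ 0) (hc : Consts n d base (base + n) (4 + n) s)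
    (h15 : s.reg 15 = 1) (h20 : s.reg 20 = n) :
    Runs reserveRows s ((Nat.log 2 n + 1) * 5 + 1) fun s' =>
      Consts n d base (base + (Nat.log 2 n + 1 + 1) * n) (4 + n) s' := by
  refine (Runs.for (k := Nat.log 2 n + 1) (T := 4) (I := fun k s' =>
    ∃ j, j + k = Nat.log 2 n + 1 ∧ s'.reg 15 = 2 ^ j ∧ s'.reg 20 = n + 1 - 2 ^ j ∧
      s'.reg 6 = base + (j + 1) * n) ?_ ?_ ?_).mono le_rfl ?_
  · exact ⟨0, by simp, by simp [h15], by simp [h20], by simp [hc.r6]⟩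
  · rintro k s' ⟨j, h1, -, h3, -⟩
    rw [h3]
    have h4 : n < 2 ^ j ↔ Nat.log 2 n < j := (Nat.log_lt_iff_lt_pow (by norm_num) hn).symm
    omega
  · rintro k s' ⟨j, h1, h2, h3, h4⟩ hf
    have e1 := (hf.reg 1 (by decide)).trans hc.r1
    have e4 := (hf.reg 4 (by decide)).trans hc.r4
    refine (runs_eval rfl s').mono le_rfl fun s'' _ h => h ▸ ⟨j + 1, by omega, ?_, ?_, ?_⟩
    · simp [seqs, eval, h2, pow_succ, mul_two]
    · simp [seqs, eval, h2, pow_succ, mul_two, e1, e4]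
    · simp only [seqs, eval, setReg_reg, h4, e1, reduceIte, Nat.reduceEqDiff]
      ring
  · rintro s' hf ⟨j, h1, -, -, h4⟩
    constructor
    · rw [hf.reg 0 (by decide), hc.r0]
    · rw [hf.reg 1 (by decide), hc.r1]
    · rw [hf.reg 2 (by decide), hc.r2]
    · rw [hf.reg 4 (by decide), hc.r4]
    · rw [hf.reg 5 (by decide), hc.r5]
    · rw [h4, ← h1, add_zero]
    · rw [hf.reg 22 (by decide), hc.r22]
    · rw [hf.reg 23 (by decide), hc.r23]
    · rw [hf.reg 24 (by decide), hc.r24]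

lemma fillRow_spec {fin : ℕ} {s : State} (hc : Consts n d base fin (4 + n) s) :
    Runs fillRow s (3 + (n * 4 + 1)) fun s' =>
      ∀ i, s'.mem i = if base ≤ i ∧ i < base + n then 2 * d + 1 else s.mem i := by
  refine (runs_eval rfl s).seq fun s₁ hf₁ h₁ => ?_
  have hc₁ := hc.frame hf₁ (by decide)
  have hm₁ : s₁.mem = s.mem := hf₁.mem rfl
  have h16 : s₁.reg 16 = base + n := by simp [h₁, seqs, eval, hc.r5, hc.r1]
  refine (Runs.for (k := n) (T := 3) (I := fun k s' =>
    ∃ j, j + k = n ∧ s'.reg 13 = base + j ∧ s'.reg 20 = n - j ∧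
      ∀ i, s'.mem i = if base ≤ i ∧ i < base + j then 2 * d + 1 else s.mem i)
    ?_ ?_ ?_).mono le_rfl ?_
  · refine ⟨0, by simp, by simp [h₁, seqs, eval, hc.r5, hc.r0],
      by simp [h₁, seqs, eval, hc.r5, hc.r0, hc.r1], fun i => ?_⟩
    rw [if_neg (by omega), hm₁]
  · rintro k s' ⟨j, h1, -, h3, -⟩
    omega
  · rintro k s' ⟨j, h1, h2, h3, h4⟩ hf
    have hc' := hc₁.frame hf (by decide)
    have e16 := (hf.reg 16 (by decide)).trans h16
    refine (runs_eval rfl s').mono le_rfl fun s'' _ h => h ▸ ⟨j + 1, by omega, ?_, ?_, ?_⟩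
    · simp [seqs, eval, h2, hc'.r4, add_assoc]
    · simp only [seqs, eval, setReg_reg, setMem_reg, h2, hc'.r4, e16, reduceIte, Nat.reduceEqDiff]
      omega
    · intro i
      simp only [seqs, eval, setReg_mem, setMem_mem, h2, hc'.r23, Function.update_apply, h4]
      split_ifs <;> first | rfl | omega
  · rintro s' - ⟨j, h1, -, -, h4⟩ i
    rw [h4, show j = n by omega]

/-- A bound on the number of steps of `solver`, summed over its parts. -/
def solverTime (n d m : ℕ) : ℕ :=
  17 + (((Nat.log 2 n + 1) * 5 + 1) + ((3 + (n * 4 + 1)) +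
    (((n * (2 * (2 * d + 1) ^ (Nat.log 2 n + 1)) + 1) *
      (n * (nodeTime d m (Nat.log 2 n + 1) + 3) + 5) + 2) + 7)))

lemma solver_spec (G : GameGraph (Fin n) d) (l : List (Edge (Fin n) d))
    (hl : ∀ e, e ∈ l ↔ e ∈ G.edges) :
    Runs solver (input (G.encode l)) (solverTime n d l.length) fun s' =>
      (G.HasWinningStrategy .even → s'.reg 0 = 1) ∧
      (¬ G.HasWinningStrategy .even → s'.reg 0 = 0) := by
  have hn : n ≠ 0 := by
    rintro rfl
    exact G.start.elim0
  obtain ⟨i0, i1, i2, i3⟩ := input_header G l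
  set M := (input (G.encode l)).mem with hM
  have hreg : ∀ r, (input (G.encode l)).reg r = 0 := fun _ => rfl
  set L := Nat.log 2 n + 1 with hL
  have hnL : n < 2 ^ L := Nat.lt_pow_succ_log_self (by norm_num) n
  generalize hbase : 4 + n + 3 * l.length = base
  refine (runs_eval rfl _).seq fun s₁ hf₁ h₁ => ?_
  have hm₁ : s₁.mem = M := hf₁.mem rfl
  have hc₁ : Consts n d base (base + n) (4 + n) s₁ := by
    subst h₁
    constructor <;> simp [setup, seqs, eval, hreg, ← hM, i0, i1, i3] <;> omega
  refine (reserveRows_spec hn hc₁ (by simp [h₁, setup, seqs, eval])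
    (by simp [h₁, setup, seqs, eval, ← hM, i0])).seq fun s₂ hf₂ hc₂ => ?_
  have hm₂ : s₂.mem = M := (hf₂.mem rfl).trans hm₁
  refine (fillRow_spec hc₂).seq fun s₃ hf₃ h₃ => ?_
  have hc₃ := hc₂.frame hf₃ (by decide)
  rw [hm₂] at h₃
  have hvec : vectors n base (L + 1) s₃.mem = fun _ => (2 * d + 1) :: List.replicate L 0 := by
    funext v
    refine List.ext_getElem (by simp [vectors, column]) fun i hi1 hi2 => ?_
    simp only [vectors, column, List.getElem_map, List.getElem_range]
    cases i with
    | zero => simp [h₃]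
    | succ i =>
      have : base + n ≤ base + (i + 1) * n + v := by
        rw [add_mul, one_mul]
        omega
      rw [h₃, if_neg (by omega), hM, input_mem_of_le G l (by omega)]
      simp
  have hgood : Good G l L base s₃.mem := by
    refine ⟨(hasInput_input G l).of_eq fun i hi => ?_, fun u => ?_, ?_⟩
    · rw [h₃, if_neg (by omega)]
    · rw [hvec]
      refine ⟨_, _, rfl, Or.inl rfl, by simp, fun b hb => ?_⟩
      rw [List.eq_of_mem_replicate hb]
      omega
    · rw [hvec]
      exact below_init
  have hslack : slack n d L base s₃.mem = n * (2 * (2 * d + 1) ^ L) := by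
    simp only [slack, hvec, val, val_replicate_zero, List.length_replicate, Finset.sum_const,
      Finset.card_univ, Fintype.card_fin, smul_eq_mul]
    rw [add_zero, ← Nat.sub_mul]
    congr 2
    omega
  have hlift := liftAll_spec hc₃ hbase.symm rfl hgood hl
  rw [hslack] at hlift
  exact hlift.seq fun s₄ hf₄ ⟨hg, hall⟩ => answer_spec (hc₃.frame hf₄ (by decide)) hg hnL hall

end Initialization

/-! ### The running time -/

lemma two_mul_add_one_pow_le {n d : ℕ} (hn : 0 < n) (hd : 0 < d) :
    (2 * d + 1) ^ (Nat.log 2 n + 1) ≤ 4 * (n * d) ^ (Nat.log 2 n + 3) := by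
  have h1 : 2 ^ (Nat.log 2 n + 1) ≤ 2 * n := by
    rw [pow_succ, mul_comm]
    exact Nat.mul_le_mul_left _ (Nat.pow_log_le_self 2 hn.ne')
  calc (2 * d + 1) ^ (Nat.log 2 n + 1) ≤ (2 ^ 2 * d) ^ (Nat.log 2 n + 1) := by gcongr; omega
    _ = (2 ^ (Nat.log 2 n + 1)) ^ 2 * d ^ (Nat.log 2 n + 1) := by
      rw [mul_pow, ← pow_mul, ← pow_mul, mul_comm 2]
    _ ≤ (2 * (n * d)) ^ 2 * (n * d) ^ (Nat.log 2 n + 1) := by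
      gcongr
      · exact h1.trans (Nat.mul_le_mul_left _ (Nat.le_mul_of_pos_right _ hd))
      · exact Nat.le_mul_of_pos_left _ hn
    _ = 4 * (n * d) ^ (Nat.log 2 n + 3) := by ring

lemma nodeTime_le {N d m L : ℕ} (hN : 0 < N) (hd : d ≤ N) (hm : m ≤ N ^ 2) (hL : L ≤ N) :
    nodeTime d m L ≤ 200 * N ^ 3 := by
  have h1 : rowStep.cost + 1 ≤ 40 := by decide
  have h2 : carry.cost + 1 ≤ 10 := by decide
  have hN3 : N ≤ N ^ 3 := Nat.le_self_pow (by norm_num) N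
  unfold nodeTime edgesTime
  calc m * (3 * d + (L + 1) * (rowStep.cost + 1) + 30) + 1 + L * (carry.cost + 1) + 32
      ≤ N ^ 2 * (3 * N + (N + N) * 40 + 30 * N) + 1 + N * 10 + 32 := by
        gcongr
        · exact hN
        · omega
    _ = 113 * N ^ 3 + 10 * N + 33 := by ring
    _ ≤ 200 * N ^ 3 := by omega

lemma solverTime_le {n d m : ℕ} (hn : 0 < n) (hd : 0 < d) (hm : m ≤ (n * d) ^ 2) :
    solverTime n d m ≤ 10000 * (n * d) ^ (Nat.log 2 n + 8) := by
  have hN : 0 < n * d := Nat.mul_pos hn hd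
  have hnN : n ≤ n * d := Nat.le_mul_of_pos_right _ hd
  have hdN : d ≤ n * d := Nat.le_mul_of_pos_left _ hn
  have hL : Nat.log 2 n + 1 ≤ n := Nat.log_lt_self 2 hn.ne'
  have h1 := nodeTime_le hN hdN hm (hL.trans hnN)
  have h2 := two_mul_add_one_pow_le hn hd
  set N := n * d
  have hpow : N ^ (Nat.log 2 n + 8) = N ^ (Nat.log 2 n + 4) * N ^ 4 := by
    rw [← pow_add]
  have h3 : N ≤ N ^ (Nat.log 2 n + 8) := Nat.le_self_pow (by omega) N
  have h4 : n * (2 * (2 * d + 1) ^ (Nat.log 2 n + 1)) + 1 ≤ 9 * N ^ (Nat.log 2 n + 4) := by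
    have h5 : 0 < N ^ (Nat.log 2 n + 4) := by positivity
    calc n * (2 * (2 * d + 1) ^ (Nat.log 2 n + 1)) + 1
        ≤ N * (2 * (4 * N ^ (Nat.log 2 n + 3))) + 1 := by gcongr
      _ = 8 * N ^ (Nat.log 2 n + 4) + 1 := by ring
      _ ≤ 9 * N ^ (Nat.log 2 n + 4) := by omega
  have h5 : n * (nodeTime d m (Nat.log 2 n + 1) + 3) + 5 ≤ 208 * N ^ 4 := by
    have h6 : N ≤ N ^ 4 := Nat.le_self_pow (by norm_num) N
    calc n * (nodeTime d m (Nat.log 2 n + 1) + 3) + 5 ≤ N * (200 * N ^ 3 + 3) + 5 := by gcongr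
      _ = 200 * N ^ 4 + 3 * N + 5 := by ring
      _ ≤ 208 * N ^ 4 := by omega
  have h6 := Nat.mul_le_mul h4 h5
  have h7 : 9 * N ^ (Nat.log 2 n + 4) * (208 * N ^ 4) = 1872 * N ^ (Nat.log 2 n + 8) := by
    rw [hpow]; ring
  unfold solverTime
  omega

end RAM

lemma SolvesWithin.mono {P : RAM.Program} {n d T T' : ℕ} {G : GameGraph (Fin n) d}
    (h : SolvesWithin P G T) (hT : T ≤ T') : SolvesWithin P G T' := fun l hl hl' => by
  obtain ⟨t, s', h1, h2, h3⟩ := h l hl hl'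
  exact ⟨t, s', h1, h2.trans hT, h3⟩

lemma solver_solves {n d : ℕ} (G : GameGraph (Fin n) d) :
    SolvesWithin RAM.solver G (10000 * (n * d) ^ (Nat.log 2 n + 8)) := by
  intro l hnd hl
  obtain ⟨t, s', h1, h2, h3⟩ := RAM.solver_spec G l hl
  refine ⟨t, s', h1, h2.trans (RAM.solverTime_le (Fin.pos G.start) ?_ ?_), h3⟩
  · obtain ⟨e, -⟩ := G.exists_out G.start
    exact e.2.1.2.1.trans e.2.1.2.2
  · classical
    have h4 : G.edges.ncard = l.length := by
      rw [← List.toFinset_card_of_nodup hnd, ← Set.ncard_coe_finset]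
      congr 1
      ext e
      simp [hl]
    have hd : 0 < d := by
      obtain ⟨e, -⟩ := G.exists_out G.start
      exact e.2.1.2.1.trans e.2.1.2.2
    calc l.length ≤ n * (d * n) := h4 ▸ edges_ncard_le G.edges
      _ ≤ (n * d) ^ 2 := by
        rw [show (n * d) ^ 2 = n * (d * n) * d by ring]
        exact Nat.le_mul_of_pos_right _ hd

lemma solver_solves_mul {n d : ℕ} (G : GameGraph (Fin n) d) :
    SolvesWithin RAM.solver G (40000 * (n * d) ^ (40000 * (1 + Nat.log 2 n))) := by
  refine (solver_solves G).mono ?_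
  obtain ⟨e, -⟩ := G.exists_out G.start
  have hN : 0 < n * d := Nat.mul_pos (Fin.pos G.start) (e.2.1.2.1.trans e.2.1.2.2)
  gcongr <;> omega

lemma solver_solves_of_le {n d : ℕ} (G : GameGraph (Fin n) d) (hdn : d ≤ n) :
    SolvesWithin RAM.solver G (40000 * n ^ (40000 * Nat.log 2 n)) := by
  refine (solver_solves G).mono ?_
  have hn : 0 < n := Fin.pos G.start
  rcases (show 1 ≤ n from hn).eq_or_lt with rfl | hn2
  · have : (1 * d) ^ (Nat.log 2 1 + 8) ≤ 1 := Nat.pow_le_one_iff (by omega) |>.2 (by omega)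
    simp only [one_pow]
    omega
  · have hlog : 1 ≤ Nat.log 2 n := Nat.log_pos (by norm_num) hn2
    calc 10000 * (n * d) ^ (Nat.log 2 n + 8) ≤ 40000 * (n * n) ^ (Nat.log 2 n + 8) :=
          Nat.mul_le_mul (by norm_num) (Nat.pow_le_pow_left (Nat.mul_le_mul_left _ hdn) _)
      _ = 40000 * n ^ (2 * (Nat.log 2 n + 8)) := by rw [← pow_two, ← pow_mul]
      _ ≤ 40000 * n ^ (40000 * Nat.log 2 n) :=
          Nat.mul_le_mul_left _ (Nat.pow_le_pow_right hn (by omega))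

end ParityGames

theorem mainTheorem3 :
    -- `S_{n,d}` is a safety automaton and a strong SFPG separator; the product is an equivalent
    -- safety game, with the following numbers of nodes and edges
    (∀ (n d : ℕ) (hn : 0 < n) (hd : 0 < d), Even d →
      (ParityGames.safetyAutomaton n d hn hd).IsSafety ∧
      ParityGames.IsStrongSFPGSeparator (ParityGames.safetyAutomaton n d hn hd) ∧
      Nat.card (ParityGames.SState n d) = ParityGames.numStates n d ∧
      ∀ G : ParityGames.GameGraph (Fin n) d,
        (G.product (ParityGames.safetyAutomaton n d hn hd)).IsSafetyGame ∧
        (G.HasWinningStrategy .even ↔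
          (G.product (ParityGames.safetyAutomaton n d hn hd)).HasWinningStrategy .even) ∧
        Nat.card ((Fin n ⊕ ↥G.edges) × ParityGames.SState n d) =
          (n + G.edges.ncard) * ParityGames.numStates n d ∧
        (G.product (ParityGames.safetyAutomaton n d hn hd)).edges.ncard ≤
          G.edges.ncard * ParityGames.numStates n d * (ParityGames.rn n + 2)) ∧
    -- for `d ≤ n` the product has size `n ^ O(log n)`
    (∃ C : ℕ, ∀ (n d : ℕ) (hn : 0 < n) (hd : 0 < d), Even d → d ≤ n →
      ∀ G : ParityGames.GameGraph (Fin n) d,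
        Nat.card ((Fin n ⊕ ↥G.edges) × ParityGames.SState n d) +
          (G.product (ParityGames.safetyAutomaton n d hn hd)).edges.ncard ≤
            C * n ^ (C * Nat.log 2 n)) ∧
    -- parity games can be solved in time `(n d) ^ O(log n)`, which is `n ^ O(log n)` for `d ≤ n`
    (∃ (P : ParityGames.RAM.Program) (C : ℕ), ∀ (n d : ℕ) (G : ParityGames.GameGraph (Fin n) d),
      ParityGames.SolvesWithin P G (C * (n * d) ^ (C * (1 + Nat.log 2 n))) ∧
      (d ≤ n → ParityGames.SolvesWithin P G (C * n ^ (C * Nat.log 2 n)))) := by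
  refine ⟨fun n d hn hd _ => ⟨?_, ?_, ?_, fun G => ⟨?_, ⟨?_, ?_⟩, ?_, ?_⟩⟩,
    ⟨12, fun n d hn hd heven hdn G => ParityGames.product_size_le hn hd heven hdn G⟩,
    ParityGames.RAM.solver, 40000, fun n d G =>
      ⟨ParityGames.solver_solves_mul G, ParityGames.solver_solves_of_le G⟩⟩
  · exact ParityGames.safetyAutomaton_isSafety hn hd
  · exact ParityGames.safetyAutomaton_isStrongSFPGSeparator hn hd
  · exact ParityGames.card_SState n d
  · exact ParityGames.product_isSafetyGame hn hd G
  · exact ParityGames.product_winning hn hd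
  · exact ParityGames.winning_of_product hn hd
  · exact ParityGames.card_product_nodes G
  · exact ParityGames.product_edges_ncard_le hn hd G
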